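/- \textbf{Proposition.} Let $\mathfrak g$ be a finite-dimensional real Lie algebra with a vector-space norm and $I=[0,1]$. Write $\mathfrak g$-valued connection 1-forms on $I$ as $A=A(t)\,dt$ with $A(t)$ continuous, with the sup norm (smooth forms are a special case). Put $$\pi(A)=\int_0^1A,\qquad \iota(x)=x\,dt,\qquad (\kappa A)(t)=\int_0^1(\theta(t-t')-t)\,A(t')\,dt'$$ with $\theta$ the Heaviside function (Whitney--Dupont gauge-fixing), and $d_Ac=dc+[A,c]$. Let $\Phi_T$ be the time-$T$ flow of $-H^{\mathrm{cl}}$ on connections, $H^{\mathrm{cl}}=[\widehat\kappa,Q^{\mathrm{cl}}]\colon A\mapsto d_A\kappa(A)$, i.e. $\partial_TA_T=-d_{A_T}\kappa(A_T)$, $A_0=A$; the classical $L_\infty$ projection is $\pi^{\mathrm{cl}}_{\mathrm{int}}(A)=\lim_{T\to\infty}\pi(\Phi_T(A))$, the coefficient of the 1-cell. Let $\Omega_n(a)$, $n\ge1$, be the terms of the Magnus expansion for $U'=a(t)U$ on $[0,1]$, defined through iterated brackets, integrals and Bernoulli numbers ($B_1=-\tfrac12$): $\Omega_n(a)=\Omega_n(1)$,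 where $$\Omega_{n+1}(t)=\sum_{j\ge 0}\frac{B_j}{j!}\sum_{\substack{k_1+\dots+k_j=n\\ k_i\ge1}}\int_0^t[\Omega_{k_1}(s),[\dots,[\Omega_{k_j}(s),a(s)]\dots]]\,ds ,$$ and put $M_n(A)=-\Omega_n(-A)$, $M_0=0$. A representation $\rho$ below is a linear map from $\mathfrak g$ to an associative real Banach algebra with unit that takes brackets to commutators. (1) (Formal version.) For every $A$ the flow equation with initial value $\epsilon A$ has a unique solution $\sum_n\epsilon^nA^{(n)}_T$ ($T\ge 0$) as a formal power series in $\epsilon$; every $A^{(n)}_T$ is smooth if $A$ is; and $\lim_{T\to\infty}\pi(A_T^{(n)})=M_n(A)$ for all $n$. These are the coefficients of $-\log P\exp(-\epsilon\int_0^1A)$: for every representation $\rho$ and every $n$, $\rho(M_n(A))$ is the coefficient of $\epsilon^n$ in the formal series $-\log P\exp(-\epsilon\int_0^1\rho(A))$. Here $P\exp$ is the series of iterated integrals with later times to the left. (2) (Magnus expansion.) The homological perturbation series $i^{\mathrm{cl}}_{\mathrm{int}}=\sum_n(-KQ_{\mathrm{int}})^ni$ recovers the Magnus expansion: for all $\xi\in\mathfrak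 g^*$, $n\ge0$ and all $A$, $$\big((-KQ_{\mathrm{int}})^n\,i\langle\xi,A_I\rangle\big)(A)=\langle\xi,M_{n+1}(A)\rangle .$$ Here $i\langle\xi,A_I\rangle=\langle\xi,\pi(A)\rangle$; $(Q_{\mathrm{int}}f)(A;c)=Df(A)[[A,c]]$ for $\mathfrak g$-valued functions $c$ on $I$; and, for $g(A;c)$ linear in $c$, $(Kg)(A)=\int_0^\infty e^{-s}g\big(e^{-s}A+(1-e^{-s})\iota\pi A;\,\kappa A\big)ds$. In particular $M_1(A)=\int_0^1A$ and $M_2(A)=-\frac12\int_0^1\!dt\int_0^t\!dt'\,[A(t),A(t')]$. (3) (Small connections.) There is $r>0$ such that for $\|A\|<r$ the flow line $A_T=\Phi_T(A)$ exists for all $T\ge0$ and is unique, $A_T$ is smooth for all $T$ if $A$ is, the limit $\pi^{\mathrm{cl}}_{\mathrm{int}}(A)=\lim_{T\to\infty}\pi(A_T)\in\mathfrak g$ exists and equals $\sum_{n\ge1}M_n(A)$, and, as $A\to 0$, $\pi^{\mathrm{cl}}_{\mathrm{int}}(A)=\int_0^1A+O(\|A\|^2)$, so that $\pi^{\mathrm{cl}}_{\mathrm{int}}$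 is a deformation, in general nonlinear, of $A\mapsto\int_I A$. Moreover $$\pi^{\mathrm{cl}}_{\mathrm{int}}(A)=-\log P\exp\Big(-\int_0^1A\Big)$$ in the following sense. For every representation $\rho$, let $U$ be the unique solution on $[0,1]$ of $U'=-\rho(A(t))U$, $U(0)=1$, so that $U(1)=P\exp(-\int_0^1\rho(A))$. Then $U(1)=\exp(-\rho(\pi^{\mathrm{cl}}_{\mathrm{int}}(A)))$ whenever $\|A\|<r$; and there is $\delta\in(0,r]$, depending on $\rho$, such that for $\|A\|<\delta$ one has $\|U(1)-1\|<1$ and $\rho(\pi^{\mathrm{cl}}_{\mathrm{int}}(A))=-\log U(1)$, with $\log u=\sum_{n\ge0}\frac{(-1)^n}{n+1}(u-1)^{n+1}$. -/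

import Mathlib

open Set Filter Topology MeasureTheory

universe u v

noncomputable section

namespace OneDimBF

/-! ### The structure Lie algebra

A real Lie algebra whose underlying vector space carries a norm. The norm is only used to speak
about limits, derivatives and integrals; in the finite-dimensional case all norms are equivalent
and the bracket is automatically continuous. -/

/-- A Lie ring whose additive group is normed (one common additive structure). -/
class NormedLieRing (𝔤 : Type*) extends NormedAddCommGroup 𝔤, LieRing 𝔤

/-- A real Lie algebra that is a normed space (one common scalar multiplication). -/
class NormedRealLieAlgebra (𝔤 : Type*) [NormedLieRing 𝔤] extends NormedSpace ℝ 𝔤, LieAlgebra ℝ 𝔤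

section Coefficients

variable {𝔤 : Type u} [NormedLieRing 𝔤]

/-! ### Forms on the interval `I = [0,1]` -/

/-- `𝔤`-valued 1-forms (connections) `A = A(t) dt` on `I`, given by their coefficient `A(t)`;
the space carries the supremum norm. -/
abbrev Form1 (𝔤 : Type u) [NormedLieRing 𝔤] : Type u := C(unitInterval, 𝔤)

/-- The coefficient of a form as a function of a real variable, constant outside `[0,1]`. -/
def ext (A : C(unitInterval, 𝔤)) : ℝ → 𝔤 := IccExtend (zero_le_one : (0 : ℝ) ≤ 1) A

theorem continuous_ext (A : C(unitInterval, 𝔤)) : Continuous (ext A) :=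
  A.continuous.Icc_extend'

theorem ext_coe (A : C(unitInterval, 𝔤)) (t : unitInterval) : ext A t = A t :=
  IccExtend_val _ _ t

end Coefficients

variable {𝔤 : Type u} [NormedLieRing 𝔤] [NormedRealLieAlgebra 𝔤]

/-- `𝔤`-valued 0-forms on `I` (of class `C¹`, so that `d` is defined on them). -/
structure Form0 (𝔤 : Type u) [NormedLieRing 𝔤] [NormedRealLieAlgebra 𝔤] where
  toMap : C(unitInterval, 𝔤)
  contDiffOn : ContDiffOn ℝ 1 (ext toMap) (Icc 0 1)

/-- A 1-form is smooth if its coefficient is `C^∞` on the closed interval. -/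
def SmoothForm (A : Form1 𝔤) : Prop := ContDiffOn ℝ ((⊤ : ℕ∞) : WithTop ℕ∞) (ext A) (Icc 0 1)

/-- The de Rham differential `c ↦ c'(t) dt` from 0-forms to 1-forms. -/
def extD (c : Form0 𝔤) : Form1 𝔤 where
  toFun t := derivWithin (ext c.toMap) (Icc 0 1) t
  continuous_toFun :=
    (c.contDiffOn.continuousOn_derivWithin (uniqueDiffOn_Icc zero_lt_one) le_rfl).domRestrict

theorem continuous_lie [FiniteDimensional ℝ 𝔤] {X : Type*} [TopologicalSpace X] {f g : X → 𝔤}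
    (hf : Continuous f) (hg : Continuous g) : Continuous fun x => ⁅f x, g x⁆ := by
  let L : 𝔤 →ₗ[ℝ] 𝔤 →L[ℝ] 𝔤 :=
    (LinearMap.toContinuousLinearMap : (𝔤 →ₗ[ℝ] 𝔤) ≃ₗ[ℝ] 𝔤 →L[ℝ] 𝔤).toLinearMap ∘ₗ
      (LieAlgebra.ad ℝ 𝔤 : 𝔤 →ₗ[ℝ] Module.End ℝ 𝔤)
  have hL : Continuous L := L.continuous_of_finiteDimensional
  exact (hL.comp hf).clm_apply hg

/-- The bracket `[A, c]` of a 1-form with a 0-form (pointwise bracket of coefficients). -/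
def bracket [FiniteDimensional ℝ 𝔤] (A : Form1 𝔤) (c : Form0 𝔤) : Form1 𝔤 where
  toFun t := ⁅A t, c.toMap t⁆
  continuous_toFun := continuous_lie A.continuous c.toMap.continuous

/-- The covariant derivative `d_A c = dc + [A, c]`. -/
def covD [FiniteDimensional ℝ 𝔤] (A : Form1 𝔤) (c : Form0 𝔤) : Form1 𝔤 := extD c + bracket A c

/-! ### The Whitney–Dupont gauge-fixing on connections -/

/-- The projection `π : A ↦ ∫₀¹ A`, the coefficient of the 1-cell of `I`. -/
def proj (A : Form1 𝔤) : 𝔤 := ∫ t in (0 : ℝ)..1, ext A t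

/-- The inclusion `ι`, sending the coefficient `x` of the 1-cell to the constant form `x dt`. -/
def incl (x : 𝔤) : Form1 𝔤 := ContinuousMap.const _ x

/-- The Heaviside step function. -/
def theta (x : ℝ) : ℝ := if 0 < x then 1 else 0

/-- The Dupont homotopy as a function: `(κA)(t) = ∫₀¹ (θ(t - t') - t) A(t') dt'`. -/
def kappaFun (A : Form1 𝔤) (t : ℝ) : 𝔤 := ∫ t' in (0 : ℝ)..1, (theta (t - t') - t) • ext A t'

theorem kappaFun_eq [FiniteDimensional ℝ 𝔤] (A : Form1 𝔤) {t : ℝ} (ht : t ∈ Icc (0 : ℝ) 1) :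
    kappaFun A t = (∫ s in (0 : ℝ)..t, ext A s) - t • proj A := by
  have : CompleteSpace 𝔤 := FiniteDimensional.complete ℝ 𝔤
  have hc := continuous_ext A
  have h1 : EqOn (fun t' => theta (t - t') • ext A t') ((Iio t).indicator (ext A)) univ := by
    intro s _
    by_cases h : s < t <;> simp [theta, h]
  have hint : ∀ a b : ℝ, IntervalIntegrable (fun t' => theta (t - t') • ext A t') volume a b := by
    intro a b
    have := (hc.intervalIntegrable (μ := volume) a b)
    rw [intervalIntegrable_iff] at this ⊢
    exact (this.indicator measurableSet_Iio).congr
      (Eventually.of_forall fun s => (h1 (mem_univ s)).symm)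
  have e1 : (∫ s in (0 : ℝ)..t, theta (t - s) • ext A s) = ∫ s in (0 : ℝ)..t, ext A s := by
    rw [intervalIntegral.integral_of_le ht.1, intervalIntegral.integral_of_le ht.1,
      integral_Ioc_eq_integral_Ioo, integral_Ioc_eq_integral_Ioo]
    refine setIntegral_congr_fun measurableSet_Ioo fun s hs => ?_
    simp [theta, hs.2]
  have e2 : (∫ s in t..(1 : ℝ), theta (t - s) • ext A s) = 0 := by
    rw [intervalIntegral.integral_of_le ht.2]
    refine setIntegral_eq_zero_of_forall_eq_zero fun s hs => ?_
    simp [theta, not_lt.2 hs.1.le]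
  have e3 : kappaFun A t = (∫ s in (0 : ℝ)..1, theta (t - s) • ext A s)
      - ∫ s in (0 : ℝ)..1, t • ext A s := by
    have h3 : IntervalIntegrable (fun s => t • ext A s) volume 0 1 :=
      (hc.const_smul t).intervalIntegrable 0 1
    rw [← intervalIntegral.integral_sub (hint 0 1) h3]
    simp only [kappaFun, sub_smul]
  rw [e3, ← intervalIntegral.integral_add_adjacent_intervals (hint 0 t) (hint t 1), e1, e2,
    add_zero, intervalIntegral.integral_smul, proj]

theorem contDiff_primitive [FiniteDimensional ℝ 𝔤] (A : Form1 𝔤) :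
    ContDiff ℝ 1 fun t : ℝ => (∫ s in (0 : ℝ)..t, ext A s) - t • proj A := by
  have : CompleteSpace 𝔤 := FiniteDimensional.complete ℝ 𝔤
  have hc := continuous_ext A
  have hd : ∀ t, HasDerivAt (fun t : ℝ => ∫ s in (0 : ℝ)..t, ext A s) (ext A t) t := fun t =>
    intervalIntegral.integral_hasDerivAt_right (hc.intervalIntegrable _ _)
      (hc.stronglyMeasurableAtFilter _ _) hc.continuousAt
  have h1 : ContDiff ℝ 1 fun t : ℝ => ∫ s in (0 : ℝ)..t, ext A s := by
    rw [contDiff_one_iff_deriv]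
    refine ⟨fun t => (hd t).differentiableAt, ?_⟩
    rw [show deriv (fun t : ℝ => ∫ s in (0 : ℝ)..t, ext A s) = ext A from
      funext fun t => (hd t).deriv]
    exact hc
  exact h1.sub (contDiff_id.smul contDiff_const)

/-- The Dupont homotopy `κ : A ↦ ∫₀¹ (θ(t - t') - t) A(t')` from 1-forms to 0-forms. -/
def kappa [FiniteDimensional ℝ 𝔤] (A : Form1 𝔤) : Form0 𝔤 where
  toMap :=
    { toFun := fun t => kappaFun A t
      continuous_toFun := by
        have h : (fun t : unitInterval => kappaFun A t)
            = fun t : unitInterval => (∫ s in (0 : ℝ)..t, ext A s) - (t : ℝ) • proj A :=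
          funext fun t => kappaFun_eq A t.2
        rw [h]
        exact (contDiff_primitive A).continuous.comp continuous_subtype_val }
  contDiffOn := by
    refine (contDiff_primitive A).contDiffOn.congr fun t ht => ?_
    rw [← kappaFun_eq A ht]
    exact ext_coe _ ⟨t, ht⟩

/-! ### The classical BV differential, the vector field `H^cl` and its flow

On the functions of the connection `A` (ghost number 0) the differential `Q^cl` takes values in
the functions of `A` that are linear in the ghost `c` (ghost number 1); no other field enters.
The derivation `κ̂` dual to `κ` replaces `c` by `κ(A)` and kills the functions of `A`. -/

/-- `Q^cl` on a function `f` of the connection: `(Q^cl f)(A; c) = Df(A)[d_A c]`. -/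
def diffQ [FiniteDimensional ℝ 𝔤] (f : Form1 𝔤 → ℝ) (A : Form1 𝔤) (c : Form0 𝔤) : ℝ :=
  fderiv ℝ f A (covD A c)

/-- The interaction part of `Q^cl`: `(Q_int f)(A; c) = Df(A)[[A, c]]`. -/
def diffQint [FiniteDimensional ℝ 𝔤] (f : Form1 𝔤 → ℝ) (A : Form1 𝔤) (c : Form0 𝔤) : ℝ :=
  fderiv ℝ f A (bracket A c)

/-- The derivation `κ̂` on functions linear in the ghost. -/
def kappaHat [FiniteDimensional ℝ 𝔤] (g : Form1 𝔤 → Form0 𝔤 → ℝ) (A : Form1 𝔤) : ℝ :=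
  g A (kappa A)

/-- The component of the vector field `H^cl = [κ̂, Q^cl]` along connections: `A ↦ d_A κ(A)`.
(The other components of `H^cl` vanish at the points where all fields but `A` are zero.) -/
def hamField [FiniteDimensional ℝ 𝔤] (A : Form1 𝔤) : Form1 𝔤 := covD A (kappa A)

/-- `H^cl = [κ̂, Q^cl]` acts on functions of the connection as the derivative along `hamField`
(the summand `Q^cl κ̂` is zero on such functions). -/
theorem kappaHat_diffQ [FiniteDimensional ℝ 𝔤] (f : Form1 𝔤 → ℝ) (A : Form1 𝔤) :
    kappaHat (diffQ f) A = fderiv ℝ f A (hamField A) := rfl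

/-- `a` is the trajectory `T ↦ Φ_T(A)`, `T ≥ 0`, of the flow of `-H^cl` starting at `A`. -/
structure IsFlow [FiniteDimensional ℝ 𝔤] (A : Form1 𝔤) (a : ℝ → Form1 𝔤) : Prop where
  init : a 0 = A
  flow : ∀ T, 0 ≤ T → HasDerivWithinAt a (-hamField (a T)) (Ici 0) T

/-- The flow on the formal neighbourhood of zero: the formal power series
`∑ₙ εⁿ aₙ(T) = Φ_T(ε A)` solves the flow equation of `-H^cl` order by order in `ε`. -/
structure IsFormalFlow [FiniteDimensional ℝ 𝔤] (A : Form1 𝔤) (a : ℕ → ℝ → Form1 𝔤) : Prop where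
  init : ∀ n, a n 0 = if n = 1 then A else 0
  flow : ∀ n, ∀ T, 0 ≤ T → HasDerivWithinAt (a n)
    (-(extD (kappa (a n T))
      + ∑ p ∈ Finset.HasAntidiagonal.antidiagonal n, bracket (a p.1 T) (kappa (a p.2 T)))) (Ici 0) T

/-! ### Homological perturbation series of a linear observable -/

/-- The symmetrized chain homotopy `K = κ^sym` on a function `g(A; c)` linear in the ghost:
`(K g)(A) = ∫₀^∞ e^{-s} g(e^{-s} A + (1 - e^{-s}) ιπA ; κA) ds`, i.e. the `ds`-component of
`g` evaluated on `exp(-s (id - ιπ) + ds κ) A`, integrated over `s`. -/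
def homotopyK [FiniteDimensional ℝ 𝔤] (g : Form1 𝔤 → Form0 𝔤 → ℝ) (A : Form1 𝔤) : ℝ :=
  ∫ s in Ioi (0 : ℝ), Real.exp (-s) *
    g (Real.exp (-s) • A + (1 - Real.exp (-s)) • incl (proj A)) (kappa A)

/-- The `n`-th term `(-K Q_int)ⁿ i ⟨ξ, A_I⟩` of the homological perturbation series for
`i_int^cl`, applied to the linear infrared observable `⟨ξ, A_I⟩`. -/
def hplTerm [FiniteDimensional ℝ 𝔤] (ξ : Module.Dual ℝ 𝔤) : ℕ → Form1 𝔤 → ℝ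
  | 0 => fun A => ξ (proj A)
  | n + 1 => fun A => -homotopyK (diffQint (hplTerm ξ n)) A

/-! ### Magnus expansion, parallel transport -/

/-- The `n`-th term `Ωₙ(t)` of the Magnus expansion of the logarithm of the solution of
`U' = a(t) U`, `U(0) = 1`: `Ω₀ = 0` and
`Ωₙ₊₁(t) = ∑_{k₁+⋯+kⱼ=n} (Bⱼ / j!) ∫₀ᵗ [Ω_{k₁}(s), [⋯, [Ω_{kⱼ}(s), a(s)]⋯]] ds`
over all `j ≥ 0` and `k₁, …, kⱼ ≥ 1`, with the Bernoulli numbers `Bⱼ`, `B₁ = -1/2`. -/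
def magnus (a : Form1 𝔤) : ℕ → ℝ → 𝔤
  | 0 => fun _ => 0
  | n + 1 => fun t => ∑ k : Composition n,
      ((bernoulli k.length : ℝ) / (k.length.factorial : ℝ)) •
        ∫ s in (0 : ℝ)..t,
          (List.ofFn fun i : Fin k.length => magnus a (k.blocksFun i) s).foldr
            (fun x y => ⁅x, y⁆) (ext a s)
  termination_by n => n
  decreasing_by exact Nat.lt_succ_of_le (k.blocksFun_le i)

/-- The term of order `n` in `A` of the Magnus expansion of `-log P exp(-∫₀¹ A)`. -/
def magnusLog (A : Form1 𝔤) (n : ℕ) : 𝔤 := -magnus (-A) n 1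

/-- A linear map `ρ` from `𝔤` to an associative algebra is a representation if it maps the
bracket of `𝔤` to the commutator. -/
def IsLieRep {𝔸 : Type v} [NormedRing 𝔸] [NormedAlgebra ℝ 𝔸] (ρ : 𝔤 →ₗ[ℝ] 𝔸) : Prop :=
  ∀ x y : 𝔤, ρ ⁅x, y⁆ = ρ x * ρ y - ρ y * ρ x

/-- `U(t) = P exp(-∫₀ᵗ ρ(A))`: parallel transport of the connection `d + A` along `I`, in an
algebra `𝔸` on which `𝔤` is represented by `ρ`. -/
structure IsParallelTransport {𝔸 : Type v} [NormedRing 𝔸] [NormedAlgebra ℝ 𝔸]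
    (ρ : 𝔤 →ₗ[ℝ] 𝔸) (A : Form1 𝔤) (U : ℝ → 𝔸) : Prop where
  init : U 0 = 1
  transport : ∀ t ∈ Icc (0 : ℝ) 1, HasDerivWithinAt U (-(ρ (ext A t) * U t)) (Icc 0 1) t

/-- The `n`-th iterated integral of `P exp(-∫₀ᵗ ρ(A))`:
`(-1)ⁿ ∫_{t > s₁ > ⋯ > sₙ > 0} ρ(A(s₁)) ⋯ ρ(A(sₙ)) ds₁ ⋯ dsₙ`. -/
def holTerm {𝔸 : Type v} [NormedRing 𝔸] [NormedAlgebra ℝ 𝔸]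
    (ρ : 𝔤 →ₗ[ℝ] 𝔸) (A : Form1 𝔤) : ℕ → ℝ → 𝔸
  | 0 => fun _ => 1
  | n + 1 => fun t => -∫ s in (0 : ℝ)..t, ρ (ext A s) * holTerm ρ A n s

/-- The formal parallel transport `P exp(-ε ∫₀¹ ρ(A))`, a power series in `ε`. -/
def holSeries {𝔸 : Type v} [NormedRing 𝔸] [NormedAlgebra ℝ 𝔸]
    (ρ : 𝔤 →ₗ[ℝ] 𝔸) (A : Form1 𝔤) : PowerSeries 𝔸 :=
  PowerSeries.mk fun n => holTerm ρ A n 1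

/-- The coefficient of `εⁿ` in `log u = ∑ₖ (-1)ᵏ (u - 1)ᵏ⁺¹ / (k + 1)`, for a power series `u`
with constant coefficient `1` (the summands with `k ≥ n` do not contribute). -/
def logCoeff {𝔸 : Type v} [NormedRing 𝔸] [NormedAlgebra ℝ 𝔸] (u : PowerSeries 𝔸) (n : ℕ) : 𝔸 :=
  ∑ k ∈ Finset.range n, ((-1 : ℝ) ^ k / ((k : ℝ) + 1)) • PowerSeries.coeff n ((u - 1) ^ (k + 1))

/-- `y` is the principal logarithm of `u`: `‖u - 1‖ < 1` and
`y = ∑ₙ (-1)ⁿ (u - 1)ⁿ⁺¹ / (n + 1)`. -/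
def IsLog {𝔸 : Type v} [NormedRing 𝔸] [NormedAlgebra ℝ 𝔸] (u y : 𝔸) : Prop :=
  ‖u - 1‖ < 1 ∧ HasSum (fun n : ℕ => ((-1 : ℝ) ^ n / ((n : ℝ) + 1)) • (u - 1) ^ (n + 1)) y

end OneDimBF

end

set_option linter.unusedSectionVars false

namespace OneDimBF

noncomputable section

open Finset.HasAntidiagonal (antidiagonal)

/-! ### Cauchy products of sequences and locally finite sums -/

section Cauchy

/-! The holonomy of a connection on `[0,1]` is unchanged under an infinitesimal gauge transformation
`d_A c` whose parameter `c` vanishes at both endpoints. The function `κ(A)` does vanish there, and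
`dκ(A) = A - ιπ(A)`. So the flow of `-H^cl` preserves the holonomy, while its linear part damps
everything except the constant forms. In the limit a constant form `x dt` remains, with holonomy
`exp(-x)`, and hence `x = -log P exp(-∫A)`.

The Lie algebra is not assumed to come from a group, so this argument is carried out on the Magnus
series itself, over formal series with coefficients in `𝔤`. The Magnus recursion says that `((e^{ad
Ω} - 1)/ad Ω) Ω' = ε a`. The Bernoulli numbers enter only through the inversion of this operator
(`dexp_dexpInv`, `ad_pow_linear`). The Maurer-Cartan identity (`dexpTermDeriv_sub`) turns the
linearization into `g' = ε V + [ε a, g]` for `g = ((e^{ad Ω} - 1)/ad Ω) δΩ`. Comparing coefficients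
gives gauge invariance order by order, `D Mₙ₊₁(A)[V] = -D Mₙ(A)[[A, ∫V]]` if `∫₀¹ V = 0`
(`fderiv_magnusLog_succ`). Everything about the flow and the perturbation series rests on this one
identity.

For the perturbation series, the identity makes the integrand of `K Q_int Mₙ₊₁` the derivative of
`Mₙ₊₂` along the path from `A` to `ιπA`, and `Mₙ₊₂` vanishes on constant forms
(`homotopyK_magnusLog`).

For the flow, Duhamel's formula solves the formal equation recursively. A quadratic majorant gives
uniform bounds and the decay `e^{-T/2}` of the part with zero integral (`flowTerm_bounds`). The
identity telescopes to the conservation of `∑ Mₙ` up to the last order, and comparing `T = 0` with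
`T = ∞` at order `ε^n` identifies the limits (`tendsto_proj_flowTerm_magnusLog`). The majorant is
summable for small `A`, so the formal statements can be summed at `ε = 1`.

In a representation, `(e^Ω)' = (((e^{ad Ω} - 1)/ad Ω) Ω') e^Ω` shows that the exponential of the
Magnus series is the series of iterated integrals. The formal logarithm then recovers the Magnus
terms (`rep_magnusLog`), and rearranging absolutely convergent double series gives the analytic
versions.

Smoothness is a bootstrap: the flow equation is linear in `A` once `κ(A)` and `ιπ(A)` are regarded
as given, and these are smoother along the interval than `A`. -/

theorem sum_range_sum_range {M : Type*} [AddCommMonoid M] {f : ℕ → ℕ → M} {N : ℕ}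
    (hf : ∀ i j, N ≤ i + j → f i j = 0) :
    ∑ i ∈ Finset.range N, ∑ j ∈ Finset.range N, f i j
      = ∑ k ∈ Finset.range N, ∑ q ∈ antidiagonal k, f q.1 q.2 := by
  rw [← Finset.sum_product']
  have h2 : ∀ i ∈ Finset.range N, ∑ q ∈ antidiagonal i, f q.1 q.2
      = ∑ q ∈ (Finset.range N ×ˢ Finset.range N) with q.1 + q.2 = i, f q.1 q.2 := by
    intro i hi
    refine Finset.sum_congr ?_ fun _ _ => rfl
    ext q
    simp only [Finset.HasAntidiagonal.mem_antidiagonal, Finset.mem_filter, Finset.mem_product,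
      Finset.mem_range] at hi ⊢
    omega
  rw [Finset.sum_congr rfl h2, Finset.sum_fiberwise_eq_sum_filter]
  refine (Finset.sum_subset (Finset.filter_subset _ _) fun q hq hq' => hf _ _ ?_).symm
  simpa [hq] using hq'

variable {X Y Z : Type*} [AddCommGroup X] [AddCommGroup Y] [AddCommGroup Z]

/-- The sum `∑ᵢ xᵢ` of formal series `xᵢ` of order at least `i`. -/
def tot (x : ℕ → ℕ → X) (n : ℕ) : X := ∑ i ∈ Finset.range (n + 1), x i n

theorem tot_eq_sum_range {x : ℕ → ℕ → X} (hx : ∀ i n, n < i → x i n = 0) {n N : ℕ} (h : n < N) :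
    tot x n = ∑ i ∈ Finset.range N, x i n := by
  refine Finset.sum_subset (Finset.range_subset_range.2 h) fun i _ hi => hx i n ?_
  simpa using hi

/-- A bilinear map commutes with locally finite sums of formal series. -/
theorem tot_antidiagonal (b : X →+ Y →+ Z) {x : ℕ → ℕ → X} {y : ℕ → ℕ → Y}
    (hx : ∀ i n, n < i → x i n = 0) (hy : ∀ i n, n < i → y i n = 0) (n : ℕ) :
    tot (fun k m => ∑ q ∈ antidiagonal k, ∑ p ∈ antidiagonal m, b (x q.1 p.1) (y q.2 p.2)) n
      = ∑ p ∈ antidiagonal n, b (tot x p.1) (tot y p.2) := by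
  have h1 : ∀ p ∈ antidiagonal n, b (tot x p.1) (tot y p.2)
      = ∑ i ∈ Finset.range (n + 1), ∑ j ∈ Finset.range (n + 1), b (x i p.1) (y j p.2) := by
    intro p hp
    have hp' := Finset.HasAntidiagonal.mem_antidiagonal.1 hp
    rw [tot_eq_sum_range hx (show p.1 < n + 1 by omega),
      tot_eq_sum_range hy (show p.2 < n + 1 by omega), map_sum]
    simp only [AddMonoidHom.finsetSum_apply, map_sum]
    exact Finset.sum_comm
  rw [Finset.sum_congr rfl h1, Finset.sum_comm, tot]
  simp only [Finset.sum_comm (s := antidiagonal n)]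
  -- Regrouping the square by `i + j` loses nothing: a product of series of orders at least `i` and
  -- `j` has no coefficient of degree `n < i + j`.
  rw [sum_range_sum_range]
  intro i j hij
  refine Finset.sum_eq_zero fun p hp => ?_
  have hp' := Finset.HasAntidiagonal.mem_antidiagonal.1 hp
  rcases lt_or_ge p.1 i with h | h
  · rw [hx _ _ h]; simp
  · rw [hy _ _ (show p.2 < j by omega)]; simp

end Cauchy

/-! ### Formal power series with coefficients in a Lie algebra -/

theorem sum_antidiagonal_assoc {X : Type*} [AddCommMonoid X] (f : ℕ → ℕ → ℕ → X) (n : ℕ) :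
    ∑ p ∈ antidiagonal n, ∑ q ∈ antidiagonal p.2, f p.1 q.1 q.2
      = ∑ p ∈ antidiagonal n, ∑ q ∈ antidiagonal p.1, f q.1 q.2 p.2 := by
  simp only [Finset.sum_sigma']
  refine Finset.sum_nbij' (fun x => ⟨(x.1.1 + x.2.1, x.2.2), (x.1.1, x.2.1)⟩)
    (fun x => ⟨(x.2.1, x.2.2 + x.1.2), (x.2.2, x.1.2)⟩) ?_ ?_ ?_ ?_ ?_
  all_goals
    rintro ⟨⟨i, j⟩, ⟨k, l⟩⟩ h
    simp only [Finset.mem_sigma, Finset.HasAntidiagonal.mem_antidiagonal] at h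
    obtain ⟨h1, h2⟩ := h
    subst h1 h2
    first | rfl | simp [add_assoc]

/-- Formal power series with coefficients in `L`, the coefficients being the values. -/
def LieSeries (L : Type*) := ℕ → L

namespace LieSeries

variable {L : Type*} [LieRing L]

instance : AddCommGroup (LieSeries L) := inferInstanceAs (AddCommGroup (ℕ → L))

@[simp] theorem add_apply (x y : LieSeries L) (n : ℕ) : (x + y) n = x n + y n := rfl

@[simp] theorem sub_apply (x y : LieSeries L) (n : ℕ) : (x - y) n = x n - y n := rfl

@[simp] theorem zero_apply (n : ℕ) : (0 : LieSeries L) n = 0 := rfl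

@[simp] theorem sum_apply {ι : Type*} (s : Finset ι) (x : ι → LieSeries L) (n : ℕ) :
    (∑ i ∈ s, x i) n = ∑ i ∈ s, x i n :=
  Finset.sum_apply n s x

instance : Bracket (LieSeries L) (LieSeries L) where
  bracket x y n := ∑ p ∈ antidiagonal n, ⁅x p.1, y p.2⁆

theorem lie_apply (x y : LieSeries L) (n : ℕ) :
    ⁅x, y⁆ n = ∑ p ∈ antidiagonal n, ⁅x p.1, y p.2⁆ := rfl

variable [LieAlgebra ℝ L]

instance : Module ℝ (LieSeries L) := inferInstanceAs (Module ℝ (ℕ → L))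

@[simp] theorem smul_apply (c : ℝ) (x : LieSeries L) (n : ℕ) : (c • x) n = c • x n := rfl

theorem lie_eq_sum_triple (x y z : LieSeries L) (n : ℕ) :
    ⁅x, ⁅y, z⁆⁆ n = ∑ p ∈ antidiagonal n, ∑ q ∈ antidiagonal p.1, ⁅x q.1, ⁅y q.2, z p.2⁆⁆ := by
  simp only [lie_apply, lie_sum]
  exact sum_antidiagonal_assoc (fun i j k => ⁅x i, ⁅y j, z k⁆⁆) n

/-- The Cauchy bracket; torsion-freeness of `L` enters through `⁅x, x⁆ = -⁅x, x⁆`. -/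
instance : LieRing (LieSeries L) where
  add_lie x y z := by
    funext n; simp [lie_apply, Finset.sum_add_distrib]
  lie_add x y z := by
    funext n; simp [lie_apply, Finset.sum_add_distrib]
  lie_self x := by
    funext n
    have h : ⁅x, x⁆ n = -⁅x, x⁆ n := by
      conv_lhs => rw [lie_apply, ← Finset.Nat.sum_antidiagonal_swap]
      rw [lie_apply, ← Finset.sum_neg_distrib]
      exact Finset.sum_congr rfl fun p _ => (lie_skew _ _).symm
    have h2 : (2 : ℝ) • ⁅x, x⁆ n = 0 := by
      rw [two_smul]
      nth_rewrite 2 [h]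
      exact add_neg_cancel _
    exact (smul_eq_zero.1 h2).resolve_left two_ne_zero
  leibniz_lie x y z := by
    funext n
    rw [add_apply, lie_eq_sum_triple, lie_eq_sum_triple, lie_apply, ← Finset.sum_add_distrib]
    refine Finset.sum_congr rfl fun p _ => ?_
    rw [lie_apply, sum_lie, ← Finset.Nat.sum_antidiagonal_swap
      (f := fun q => ⁅y q.1, ⁅x q.2, z p.2⁆⁆), ← Finset.sum_add_distrib]
    exact Finset.sum_congr rfl fun q _ => leibniz_lie _ _ _

instance : LieAlgebra ℝ (LieSeries L) where
  lie_smul c x y := by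
    funext n; simp [lie_apply, Finset.smul_sum]

theorem lie_eq_zero_of_lt {x y : LieSeries L} {i j n : ℕ} (hx : ∀ n, n < i → x n = 0)
    (hy : ∀ n, n < j → y n = 0) (h : n < i + j) : ⁅x, y⁆ n = 0 := by
  refine Finset.sum_eq_zero fun p hp => ?_
  have hp' := Finset.HasAntidiagonal.mem_antidiagonal.1 hp
  rcases lt_or_ge p.1 i with h' | h'
  · rw [hx _ h', zero_lie]
  · rw [hy _ (by omega), lie_zero]

end LieSeries

/-! ### The derivative of the exponential map -/

section ExpDeriv

variable {L : Type*} [LieRing L] [LieAlgebra ℝ L]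

/-- The term `ad_Ω^{k-1} v / k!` of degree `k` of `((e^{ad Ω} - 1) / ad Ω) v`. -/
def dexpTerm (Ω v : L) : ℕ → L
  | 0 => 0
  | k + 1 => ((k : ℝ) + 1)⁻¹ • ((if k = 0 then v else 0) + ⁅Ω, dexpTerm Ω v k⁆)

/-- The derivative of `dexpTerm Ω v k` with respect to `Ω` in the direction `w`. -/
def dexpTermDeriv (Ω v w : L) : ℕ → L
  | 0 => 0
  | k + 1 => ((k : ℝ) + 1)⁻¹ • (⁅w, dexpTerm Ω v k⁆ + ⁅Ω, dexpTermDeriv Ω v w k⁆)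

/-- This is the recursion in Euler form: for `F(s) = ∑ s^k dexpTerm Ω v k` it reads `F' = v + [Ω,
F]`. Multiplication by the degree replaces differentiation in `s` and removes the inverse
factorials. -/
theorem natCast_smul_dexpTerm (Ω v : L) (k : ℕ) :
    (k : ℝ) • dexpTerm Ω v k
      = if k = 0 then 0 else (if k = 1 then v else 0) + ⁅Ω, dexpTerm Ω v (k - 1)⁆ := by
  cases k with
  | zero => simp
  | succ k =>
    have : (k : ℝ) + 1 ≠ 0 := by positivity
    simp [dexpTerm, smul_smul, this]

/-- The product rule for the Euler operator "multiply by the degree". -/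
theorem sum_antidiagonal_natCast_smul {M : Type*} [AddCommGroup M] [Module ℝ M]
    (f : ℕ → ℕ → M) (k : ℕ) :
    (k : ℝ) • ∑ q ∈ antidiagonal k, f q.1 q.2
      = ∑ q ∈ antidiagonal k, (q.1 : ℝ) • f q.1 q.2
        + ∑ q ∈ antidiagonal k, (q.2 : ℝ) • f q.1 q.2 := by
  rw [Finset.smul_sum, ← Finset.sum_add_distrib]
  refine Finset.sum_congr rfl fun q hq => ?_
  rw [← add_smul, ← Finset.HasAntidiagonal.mem_antidiagonal.1 hq]
  push_cast; rfl

/-- The Maurer-Cartan equation for `((e^{ad Ω} - 1) / ad Ω) dΩ`, degree by degree. -/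
theorem dexpTermDeriv_sub (Ω v w : L) (k : ℕ) :
    dexpTermDeriv Ω v w k - dexpTermDeriv Ω w v k
      = ∑ q ∈ antidiagonal k, ⁅dexpTerm Ω w q.1, dexpTerm Ω v q.2⁆ := by
  induction k with
  | zero => simp [dexpTermDeriv, dexpTerm]
  | succ k ih =>
    have hk : (k : ℝ) + 1 ≠ 0 := by positivity
    -- After multiplication by `k + 1` both sides obey the same recursion. With generating functions
    -- `F` for `v` and `G` for `w`, the left side satisfies `D' = [w, F] - [v, G] + [Ω, D]`. By the
    -- Jacobi identity, `[G, F]' = [w + [Ω, G], F] + [G, v + [Ω, F]]` has the same form.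
    have hL : ((k : ℝ) + 1) • (dexpTermDeriv Ω v w (k + 1) - dexpTermDeriv Ω w v (k + 1))
        = ⁅w, dexpTerm Ω v k⁆ - ⁅v, dexpTerm Ω w k⁆
          + ⁅Ω, dexpTermDeriv Ω v w k - dexpTermDeriv Ω w v k⁆ := by
      simp only [dexpTermDeriv, smul_sub, smul_smul, mul_inv_cancel₀ hk, one_smul, lie_sub]
      abel
    have hR := sum_antidiagonal_natCast_smul
      (fun i j => ⁅dexpTerm Ω w i, dexpTerm Ω v j⁆) (k + 1)
    have h1 : ∑ q ∈ antidiagonal (k + 1), (q.1 : ℝ) • ⁅dexpTerm Ω w q.1, dexpTerm Ω v q.2⁆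
        = ⁅w, dexpTerm Ω v k⁆
          + ∑ q ∈ antidiagonal k, ⁅⁅Ω, dexpTerm Ω w q.1⁆, dexpTerm Ω v q.2⁆ := by
      rw [Finset.Nat.sum_antidiagonal_succ]
      simp only [Nat.cast_zero, zero_smul, zero_add]
      simp only [← smul_lie, natCast_smul_dexpTerm, Nat.add_eq_zero_iff, one_ne_zero, and_false,
        if_false, Nat.add_sub_cancel, add_lie, Finset.sum_add_distrib, Nat.add_eq_right]
      congr 1
      rw [Finset.sum_eq_single (0, k)]
      · simp
      · rintro ⟨i, j⟩ hq hne
        have : i ≠ 0 := fun h0 => hne (by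
          have := Finset.HasAntidiagonal.mem_antidiagonal.1 hq
          simp only [h0, zero_add] at this ⊢
          rw [this])
        simp [this]
      · intro h; simp at h
    have h2 : ∑ q ∈ antidiagonal (k + 1), (q.2 : ℝ) • ⁅dexpTerm Ω w q.1, dexpTerm Ω v q.2⁆
        = ⁅dexpTerm Ω w k, v⁆
          + ∑ q ∈ antidiagonal k, ⁅dexpTerm Ω w q.1, ⁅Ω, dexpTerm Ω v q.2⁆⁆ := by
      rw [Finset.Nat.sum_antidiagonal_succ']
      simp only [Nat.cast_zero, zero_smul, zero_add]
      simp only [← lie_smul, natCast_smul_dexpTerm, Nat.add_eq_zero_iff, one_ne_zero, and_false,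
        if_false, Nat.add_sub_cancel, lie_add, Finset.sum_add_distrib, Nat.add_eq_right]
      congr 1
      rw [Finset.sum_eq_single (k, 0)]
      · simp
      · rintro ⟨i, j⟩ hq hne
        have : j ≠ 0 := fun h0 => hne (by
          have := Finset.HasAntidiagonal.mem_antidiagonal.1 hq
          simp only [h0, add_zero] at this ⊢
          rw [this])
        simp [this]
      · intro h; simp at h
    push_cast at hR
    rw [h1, h2] at hR
    refine smul_right_injective L hk ?_
    simp only
    rw [hL, hR, ih, lie_sum, ← lie_skew (dexpTerm Ω w k) v]
    simp only [leibniz_lie Ω, Finset.sum_add_distrib]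
    abel

attribute [local instance] LieRing.ofAssociativeRing LieAlgebra.ofAssociativeAlgebra

variable {R : Type*} [Ring R] [Algebra ℝ R]

/-- The term `Ω^k / k!` of the exponential series. -/
def expTerm (Ω : R) : ℕ → R
  | 0 => 1
  | k + 1 => ((k : ℝ) + 1)⁻¹ • (Ω * expTerm Ω k)

/-- The derivative of `expTerm Ω k` with respect to `Ω` in the direction `v`. -/
def expTermDeriv (Ω v : R) : ℕ → R
  | 0 => 0
  | k + 1 => ((k : ℝ) + 1)⁻¹ • (v * expTerm Ω k + Ω * expTermDeriv Ω v k)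

theorem expTerm_eq (Ω : R) (k : ℕ) : expTerm Ω k = ((k.factorial : ℝ))⁻¹ • Ω ^ k := by
  induction k with
  | zero => simp [expTerm]
  | succ k ih =>
    rw [expTerm, ih, mul_smul_comm, smul_smul, ← pow_succ', Nat.factorial_succ]
    congr 1
    push_cast
    rw [mul_inv]

theorem natCast_smul_expTerm (Ω : R) (k : ℕ) :
    (k : ℝ) • expTerm Ω k = if k = 0 then 0 else Ω * expTerm Ω (k - 1) := by
  cases k with
  | zero => simp
  | succ k =>
    have : (k : ℝ) + 1 ≠ 0 := by positivity
    simp [expTerm, smul_smul, this]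

/-- `d e^Ω = (((e^{ad Ω} - 1) / ad Ω) dΩ) e^Ω`, degree by degree. -/
theorem expTermDeriv_eq (Ω v : R) (k : ℕ) :
    expTermDeriv Ω v k = ∑ q ∈ antidiagonal k, dexpTerm Ω v q.1 * expTerm Ω q.2 := by
  induction k with
  | zero => simp [expTermDeriv, dexpTerm]
  | succ k ih =>
    have hk : (k : ℝ) + 1 ≠ 0 := by positivity
    -- The Euler form again: multiplied by `k + 1`, both sides satisfy one recursion because `[Ω, x]
    -- y + x (Ω y) = Ω (x y)`.
    have hR := sum_antidiagonal_natCast_smul (fun i j => dexpTerm Ω v i * expTerm Ω j) (k + 1)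
    have h1 : ∑ q ∈ antidiagonal (k + 1), (q.1 : ℝ) • (dexpTerm Ω v q.1 * expTerm Ω q.2)
        = v * expTerm Ω k
          + ∑ q ∈ antidiagonal k, ⁅Ω, dexpTerm Ω v q.1⁆ * expTerm Ω q.2 := by
      rw [Finset.Nat.sum_antidiagonal_succ]
      simp only [Nat.cast_zero, zero_smul, zero_add]
      simp only [← smul_mul_assoc, natCast_smul_dexpTerm, Nat.add_eq_zero_iff, one_ne_zero, and_false,
        if_false, Nat.add_sub_cancel, add_mul, Finset.sum_add_distrib, Nat.add_eq_right]
      congr 1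
      rw [Finset.sum_eq_single (0, k)]
      · simp
      · rintro ⟨i, j⟩ hq hne
        have : i ≠ 0 := fun h0 => hne (by
          have := Finset.HasAntidiagonal.mem_antidiagonal.1 hq
          simp only [h0, zero_add] at this ⊢
          rw [this])
        simp [this]
      · intro h; simp at h
    have h2 : ∑ q ∈ antidiagonal (k + 1), (q.2 : ℝ) • (dexpTerm Ω v q.1 * expTerm Ω q.2)
        = ∑ q ∈ antidiagonal k, dexpTerm Ω v q.1 * (Ω * expTerm Ω q.2) := by
      rw [Finset.Nat.sum_antidiagonal_succ']
      simp only [Nat.cast_zero, zero_smul, zero_add]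
      simp only [← mul_smul_comm, natCast_smul_expTerm,
        Nat.add_eq_zero_iff, one_ne_zero, and_false, if_false, Nat.add_sub_cancel]
    push_cast at hR
    rw [h1, h2] at hR
    refine smul_right_injective R hk ?_
    simp only
    rw [hR, expTermDeriv, smul_smul, mul_inv_cancel₀ hk, one_smul, ih, Finset.mul_sum, add_assoc,
      ← Finset.sum_add_distrib]
    congr 1
    refine Finset.sum_congr rfl fun q _ => ?_
    rw [Ring.lie_def]
    noncomm_ring

end ExpDeriv

/-! ### Inverting `(e^{ad Ω} - 1) / ad Ω` on formal series -/

/-- The coefficients of `z / (e^z - 1)`. -/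
def bernCoeff (j : ℕ) : ℝ := (bernoulli j : ℝ) / (j.factorial : ℝ)

/-- The coefficient of `z^{m+1}` in `(z / (e^z - 1)) (e^z - 1) = z`. The shift by one comes from the
vanishing constant term of `e^z - 1`. -/
theorem sum_bernCoeff (m : ℕ) :
    ∑ q ∈ antidiagonal m, (((q.1 + 1).factorial : ℝ))⁻¹ * bernCoeff q.2
      = if m = 0 then 1 else 0 := by
  have h := congrArg (PowerSeries.coeff (m + 1)) (bernoulliPowerSeries_mul_exp_sub_one ℝ)
  rw [mul_comm, PowerSeries.coeff_mul, Finset.Nat.sum_antidiagonal_succ, PowerSeries.coeff_X] at h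
  simp only [bernoulliPowerSeries, PowerSeries.exp, map_sub, PowerSeries.coeff_mk,
    PowerSeries.coeff_one] at h
  simp only [Nat.factorial_zero, Nat.cast_one, div_one, map_one, if_true, sub_self, zero_mul,
    zero_add, Nat.add_eq_zero_iff, one_ne_zero, and_false, if_false, sub_zero, Nat.add_eq_right] at h
  rw [← h]
  refine Finset.sum_congr rfl fun q _ => ?_
  simp [bernCoeff]

namespace LieSeries

variable {L : Type*} [LieRing L] [LieAlgebra ℝ L]

/-- As `Ω` has no constant term, each bracket with it raises the order by at least one. This makes
every power series in `ad Ω` locally finite. -/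
theorem ad_pow_apply_eq_zero {Ω v : LieSeries L} (hΩ : Ω 0 = 0) {N : ℕ}
    (hv : ∀ m, m < N → v m = 0) (k : ℕ) :
    ∀ m, m < N + k → ((LieAlgebra.ad ℝ (LieSeries L) Ω ^ k) v) m = 0 := by
  induction k with
  | zero => simpa using hv
  | succ k ih =>
    intro m hm
    rw [pow_succ', Module.End.mul_apply, LieAlgebra.ad_apply]
    exact lie_eq_zero_of_lt (i := 1) (by intro n hn; rwa [Nat.lt_one_iff.1 hn]) ih (by omega)

theorem ad_pow_congr {Ω v w : LieSeries L} (hΩ : Ω 0 = 0) {n : ℕ} (h : ∀ m, m ≤ n → v m = w m)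
    (k : ℕ) : ((LieAlgebra.ad ℝ (LieSeries L) Ω ^ k) v) n
      = ((LieAlgebra.ad ℝ (LieSeries L) Ω ^ k) w) n := by
  rw [← sub_eq_zero, ← sub_apply, ← map_sub]
  refine ad_pow_apply_eq_zero hΩ (N := n + 1) (fun m hm => ?_) k n (by omega)
  rw [sub_apply, h m (by omega), sub_self]

theorem dexpTerm_succ_eq {L : Type*} [LieRing L] [LieAlgebra ℝ L] (Ω v : L) (k : ℕ) :
    dexpTerm Ω v (k + 1) = (((k + 1).factorial : ℝ))⁻¹ • (LieAlgebra.ad ℝ L Ω ^ k) v := by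
  induction k with
  | zero => simp [dexpTerm]
  | succ k ih =>
    rw [dexpTerm, ih, pow_succ', Module.End.mul_apply, LieAlgebra.ad_apply, lie_smul,
      if_neg (Nat.succ_ne_zero k), zero_add, smul_smul, Nat.factorial_succ (k + 1)]
    congr 1
    push_cast
    rw [mul_inv]

/-- The term of index `i` contains only `i - 1` brackets, hence the bound `m + 1 < N + i`. -/
theorem dexpTerm_apply_eq_zero {Ω v : LieSeries L} (hΩ : Ω 0 = 0) {N : ℕ}
    (hv : ∀ m, m < N → v m = 0) {i m : ℕ} (h : m + 1 < N + i) : dexpTerm Ω v i m = 0 := by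
  cases i with
  | zero => rfl
  | succ k =>
    rw [dexpTerm_succ_eq, smul_apply, ad_pow_apply_eq_zero hΩ hv k m (by omega), smul_zero]

theorem dexpTerm_order {Ω v : LieSeries L} (hΩ : Ω 0 = 0) (hv : v 0 = 0) (i n : ℕ) (h : n < i) :
    dexpTerm Ω v i n = 0 :=
  dexpTerm_apply_eq_zero hΩ (N := 1) (fun m hm => by rwa [Nat.lt_one_iff.1 hm]) (by omega)

/-- The series `((e^{ad Ω} - 1) / ad Ω) v`. -/
def dexp (Ω v : LieSeries L) : LieSeries L :=
  tot (X := L) (dexpTerm (L := LieSeries L) Ω v)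

theorem dexp_apply (Ω v : LieSeries L) (n : ℕ) :
    dexp Ω v n = ∑ i ∈ Finset.range (n + 1), dexpTerm Ω v i n := rfl

theorem dexp_zero (Ω v : LieSeries L) : dexp Ω v 0 = 0 := by
  simp [dexp, tot, dexpTerm]

/-- `(e^{ad Ω} - 1) / ad Ω` is injective. -/
theorem eq_zero_of_dexp_eq_zero {Ω v : LieSeries L} (hΩ : Ω 0 = 0) (hv : v 0 = 0)
    (h : ∀ n, dexp Ω v n = 0) (n : ℕ) : v n = 0 := by
  induction n using Nat.strong_induction_on with
  | _ n ih =>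
    have h1 := h n
    rcases Nat.eq_zero_or_pos n with h0 | h0
    · rw [h0, hv]
    -- By induction `v` has order at least `n`, so in degree `n` only the bracket-free term `i = 1`,
    -- which is `v` itself, can survive.
    rw [dexp_apply, Finset.sum_eq_single 1] at h1
    · simpa [dexpTerm] using h1
    · intro i _ hi
      rcases Nat.eq_zero_or_pos i with hi0 | hi0
      · rw [hi0]; rfl
      · exact dexpTerm_apply_eq_zero hΩ ih (by omega)
    · intro hn; simp at hn; omega

/-- The series `(ad Ω / (e^{ad Ω} - 1)) v`. -/
def dexpInv (Ω v : LieSeries L) : LieSeries L :=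
  tot (X := L) fun j => bernCoeff j • (LieAlgebra.ad ℝ (LieSeries L) Ω ^ j) v

theorem dexpInv_apply (Ω v : LieSeries L) (n : ℕ) :
    dexpInv Ω v n = ∑ j ∈ Finset.range (n + 1),
      (bernCoeff j • (LieAlgebra.ad ℝ (LieSeries L) Ω ^ j) v) n := rfl

/-- Two power series in `ad Ω` compose by convolution of their coefficients, and `sum_bernCoeff`
leaves only the zeroth power. -/
theorem dexp_dexpInv {Ω v : LieSeries L} (hΩ : Ω 0 = 0) (hv : v 0 = 0) (n : ℕ) :
    dexp Ω (dexpInv Ω v) n = v n := by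
  have hv1 : ∀ m, m < 1 → v m = 0 := fun m hm => by rwa [Nat.lt_one_iff.1 hm]
  have hord := ad_pow_apply_eq_zero hΩ hv1
  have hy : ∀ j m, m < j → (bernCoeff j • (LieAlgebra.ad ℝ (LieSeries L) Ω ^ j) v) m = 0 := by
    intro j m h
    rw [smul_apply, hord j m (by omega), smul_zero]
  have h0 : dexpInv Ω v 0 = 0 := by simp [dexpInv, tot, hv]
  -- The range is enlarged to `n + 2`, so that after removal of the zero term of index `0` both
  -- summations run over `range (n + 1)`.
  rw [dexp, tot_eq_sum_range (dexpTerm_order hΩ h0) (show n < n + 2 by omega),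
    Finset.sum_range_succ']
  have hk : ∀ k ∈ Finset.range (n + 1), dexpTerm Ω (dexpInv Ω v) (k + 1) n
      = ∑ j ∈ Finset.range (n + 1), ((((k + 1).factorial : ℝ))⁻¹ * bernCoeff j) •
        ((LieAlgebra.ad ℝ (LieSeries L) Ω ^ (k + j)) v) n := by
    intro k _
    have hc : ∀ m, m ≤ n → dexpInv Ω v m = (∑ j ∈ Finset.range (n + 1),
        bernCoeff j • (LieAlgebra.ad ℝ (LieSeries L) Ω ^ j) v) m := by
      intro m hm
      rw [dexpInv, tot_eq_sum_range hy (show m < n + 1 by omega), sum_apply]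
    rw [dexpTerm_succ_eq, smul_apply, ad_pow_congr hΩ hc, map_sum, sum_apply, Finset.smul_sum]
    refine Finset.sum_congr rfl fun j _ => ?_
    rw [map_smul, smul_apply, smul_smul, pow_add, Module.End.mul_apply]
  rw [Finset.sum_congr rfl hk, sum_range_sum_range (fun i j hij => by
    rw [hord (i + j) n (by omega), smul_zero])]
  rw [Finset.sum_eq_single 0]
  · have := sum_bernCoeff 0
    simp only [Finset.Nat.antidiagonal_zero, Finset.sum_singleton, if_true] at this ⊢
    rw [this, one_smul, add_zero, pow_zero, Module.End.one_apply]
    exact add_zero _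
  · intro m _ hm
    have : ∀ q ∈ antidiagonal m, ((((q.1 + 1).factorial : ℝ))⁻¹ * bernCoeff q.2) •
        ((LieAlgebra.ad ℝ (LieSeries L) Ω ^ (q.1 + q.2)) v) n
        = ((((q.1 + 1).factorial : ℝ))⁻¹ * bernCoeff q.2) •
        ((LieAlgebra.ad ℝ (LieSeries L) Ω ^ m) v) n := by
      intro q hq
      rw [Finset.HasAntidiagonal.mem_antidiagonal.1 hq]
    rw [Finset.sum_congr rfl this, ← Finset.sum_smul, sum_bernCoeff, if_neg hm, zero_smul]
  · simp

/-- The series `ε a`. -/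
def linear (a : L) : LieSeries L := fun n => if n = 1 then a else 0

/-- The nested bracket `[Ω_{k₁}, [⋯, [Ω_{kⱼ}, a]⋯]]`. -/
def nested (Ω : ℕ → L) (a : L) (l : List ℕ) : L := l.foldr (fun k y => ⁅Ω k, y⁆) a

/-- Expanding the nested Cauchy brackets distributes the degree `n` over the `j` factors `Ω`. Since
`Ω 0 = 0`, only positive parts count, and these form a composition of `n` into `j` blocks. The
induction peels off the outermost bracket as the first block. -/
theorem ad_pow_linear {Ω : LieSeries L} (hΩ : Ω 0 = 0) (a : L) (j n : ℕ) :
    ((LieAlgebra.ad ℝ (LieSeries L) Ω ^ j) (linear a)) (n + 1)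
      = ∑ c : Composition n with c.length = j, nested Ω a c.blocks := by
  induction j generalizing n with
  | zero =>
    rcases Nat.eq_zero_or_pos n with rfl | hn
    · have : (Finset.univ.filter fun c : Composition 0 => c.length = 0) = Finset.univ := by
        ext c; simp
      rw [this]
      rw [Fintype.sum_eq_single (Composition.ones 0) fun c hc => absurd (Composition.ext (by simp)) hc]
      simp [linear, nested]
    · rw [Finset.filter_false_of_mem]
      · simp [linear, hn.ne']
      · intro c _ hc
        exact hn.ne' ((Composition.length_eq_zero c).1 hc)
  | succ j ih =>
    rw [pow_succ', Module.End.mul_apply, LieAlgebra.ad_apply, lie_apply,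
      Finset.Nat.sum_antidiagonal_succ']
    have h0 : ((LieAlgebra.ad ℝ (LieSeries L) Ω ^ j) (linear a)) 0 = 0 :=
      ad_pow_apply_eq_zero hΩ (N := 1) (fun m hm => by simp [linear]; omega) j 0 (by omega)
    rw [h0, lie_zero, zero_add]
    simp only [ih, lie_sum]
    have hp : ∀ p ∈ antidiagonal n, (¬ p.1 ≠ 0 → ∑ c : Composition p.2 with c.length = j,
        ⁅Ω p.1, nested Ω a c.blocks⁆ = 0) := by
      intro p _ h
      simp [not_not.1 h, hΩ]
    rw [← Finset.sum_filter_of_ne (p := fun p : ℕ × ℕ => p.1 ≠ 0)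
      (fun p hp' h => fun h' => h (hp p hp' (not_not.2 h'))), Finset.sum_sigma']
    refine Finset.sum_bij
      (fun x hx => (⟨x.1.1 :: x.2.blocks, ?_, ?_⟩ : Composition n)) ?_ ?_ ?_ ?_
    · simp only [Finset.mem_sigma, Finset.mem_filter] at hx
      intro i hi
      rcases List.mem_cons.1 hi with rfl | hi
      · exact Nat.pos_of_ne_zero hx.1.2
      · exact x.2.blocks_pos hi
    · simp only [Finset.mem_sigma, Finset.mem_filter,
        Finset.HasAntidiagonal.mem_antidiagonal] at hx
      rw [List.sum_cons, x.2.blocks_sum, hx.1.1]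
    · intro x hx
      simp only [Finset.mem_sigma, Finset.mem_filter] at hx
      simp [Composition.length, ← hx.2.2]
    · rintro ⟨⟨i, m⟩, c⟩ hx ⟨⟨i', m'⟩, c'⟩ hx' h
      simp only [Composition.mk.injEq, List.cons.injEq] at h
      obtain ⟨rfl, h⟩ := h
      have : m = m' := by
        have h1 := c.blocks_sum; have h2 := c'.blocks_sum
        simp only at h1 h2
        rw [← h1, ← h2, h]
      subst this
      have : c = c' := Composition.ext h
      rw [this]
    · intro c hc
      simp only [Finset.mem_filter, Finset.mem_univ, true_and] at hc
      rcases hb : c.blocks with _ | ⟨i, l⟩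
      · simp [Composition.length, hb] at hc
      · have hs := c.blocks_sum
        have hpos : ∀ k ∈ i :: l, 0 < k := fun k hk => c.blocks_pos (hb ▸ hk)
        rw [hb, List.sum_cons] at hs
        refine ⟨⟨(i, l.sum), ⟨l, fun hk => hpos _ (List.mem_cons_of_mem _ hk), rfl⟩⟩, ?_, ?_⟩
        · simp only [Finset.mem_sigma, Finset.mem_filter, Finset.mem_univ, true_and,
            Finset.HasAntidiagonal.mem_antidiagonal]
          refine ⟨⟨hs, (hpos i (List.mem_cons_self)).ne'⟩, ?_⟩
          simpa [Composition.length, hb] using hc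
        · exact Composition.ext hb.symm
    · intro x _
      rfl

/-- The Magnus recursion in terms of formal series. -/
theorem dexpInv_linear {Ω : LieSeries L} (hΩ : Ω 0 = 0) (a : L) (n : ℕ) :
    dexpInv Ω (linear a) (n + 1)
      = ∑ c : Composition n, bernCoeff c.length • nested Ω a c.blocks := by
  have hv1 : ∀ m, m < 1 → linear a m = 0 := fun m hm => by simp [linear]; omega
  have hmaps : ∀ c ∈ (Finset.univ : Finset (Composition n)), c.length ∈ Finset.range (n + 1) :=
    fun c _ => Finset.mem_range.2 (Nat.lt_succ_of_le c.length_le)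
  rw [dexpInv_apply, Finset.sum_range_succ, smul_apply,
    ad_pow_apply_eq_zero hΩ hv1 (n + 1) (n + 1) (by omega), smul_zero, add_zero,
    ← Finset.sum_fiberwise_of_maps_to hmaps]
  refine Finset.sum_congr rfl fun j _ => ?_
  rw [smul_apply, ad_pow_linear hΩ, Finset.smul_sum]
  refine Finset.sum_congr rfl fun c hc => ?_
  rw [(Finset.mem_filter.1 hc).2]

end LieSeries

/-! ### The operators on the Banach space of connections -/

section Operators

variable {𝔤 : Type u} [NormedLieRing 𝔤] [NormedRealLieAlgebra 𝔤] [FiniteDimensional ℝ 𝔤]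

instance : CompleteSpace 𝔤 := FiniteDimensional.complete ℝ 𝔤

variable (𝔤) in
/-- The Lie bracket as a continuous bilinear map. -/
def lieL : 𝔤 →L[ℝ] 𝔤 →L[ℝ] 𝔤 :=
  LinearMap.toContinuousLinearMap
    ((LinearMap.toContinuousLinearMap : (𝔤 →ₗ[ℝ] 𝔤) ≃ₗ[ℝ] 𝔤 →L[ℝ] 𝔤).toLinearMap ∘ₗ
      (LieAlgebra.ad ℝ 𝔤 : 𝔤 →ₗ[ℝ] Module.End ℝ 𝔤))

theorem norm_lie_le_lieL (x y : 𝔤) : ‖⁅x, y⁆‖ ≤ ‖lieL 𝔤‖ * ‖x‖ * ‖y‖ := (lieL 𝔤).le_opNorm₂ x y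

variable (𝔤) in
/-- The pointwise bracket of continuous `𝔤`-valued functions. -/
def brL : Form1 𝔤 →L[ℝ] Form1 𝔤 →L[ℝ] Form1 𝔤 :=
  LinearMap.mkContinuous₂
    (LinearMap.mk₂ ℝ
      (fun A B : Form1 𝔤 => (⟨fun t => ⁅A t, B t⁆, continuous_lie A.continuous B.continuous⟩ :
        Form1 𝔤))
      (fun A A' B => by ext t; exact add_lie _ _ _) (fun c A B => by ext t; exact smul_lie _ _ _)
      (fun A B B' => by ext t; exact lie_add _ _ _) (fun c A B => by ext t; exact lie_smul _ _ _))
    ‖lieL 𝔤‖ fun A B => by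
      refine (ContinuousMap.norm_le _ (by positivity)).2 fun t => ?_
      refine (norm_lie_le_lieL _ _).trans ?_
      gcongr
      exacts [A.norm_coe_le_norm t, B.norm_coe_le_norm t]

@[simp] theorem brL_apply (A B : Form1 𝔤) (t : unitInterval) : brL 𝔤 A B t = ⁅A t, B t⁆ := rfl

theorem norm_brL_le (A B : Form1 𝔤) : ‖brL 𝔤 A B‖ ≤ ‖lieL 𝔤‖ * ‖A‖ * ‖B‖ := by
  refine (ContinuousMap.norm_le _ (by positivity)).2 fun t => ?_
  refine (norm_lie_le_lieL _ _).trans ?_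
  gcongr
  exacts [A.norm_coe_le_norm t, B.norm_coe_le_norm t]

theorem norm_ext_le (A : Form1 𝔤) (t : ℝ) : ‖ext A t‖ ≤ ‖A‖ := A.norm_coe_le_norm _

theorem ext_add (A B : Form1 𝔤) (t : ℝ) : ext (A + B) t = ext A t + ext B t := rfl

theorem ext_smul (c : ℝ) (A : Form1 𝔤) (t : ℝ) : ext (c • A) t = c • ext A t := rfl

theorem ext_neg (A : Form1 𝔤) (t : ℝ) : ext (-A) t = -ext A t := rfl

theorem ext_brL (A B : Form1 𝔤) (t : ℝ) : ext (brL 𝔤 A B) t = ⁅ext A t, ext B t⁆ := rfl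

theorem ext_incl (x : 𝔤) (t : ℝ) : ext (incl x) t = x := rfl

theorem intervalIntegrable_ext (A : Form1 𝔤) (a b : ℝ) :
    IntervalIntegrable (ext A) volume a b := (continuous_ext A).intervalIntegrable _ _

theorem hasDerivAt_primitive (A : Form1 𝔤) (t : ℝ) :
    HasDerivAt (fun t : ℝ => ∫ s in (0 : ℝ)..t, ext A s) (ext A t) t :=
  intervalIntegral.integral_hasDerivAt_right (intervalIntegrable_ext A _ _)
    ((continuous_ext A).stronglyMeasurableAtFilter _ _) (continuous_ext A).continuousAt

variable (𝔤) in
/-- The primitive `V ↦ ∫₀ᵗ V`. -/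
def primL : Form1 𝔤 →L[ℝ] Form1 𝔤 :=
  LinearMap.mkContinuous
    { toFun := fun A => ⟨fun t => ∫ s in (0 : ℝ)..t, ext A s,
        (continuous_iff_continuousAt.2 fun t => (hasDerivAt_primitive A t).continuousAt).comp
          continuous_subtype_val⟩
      map_add' := fun A B => by
        ext t
        exact intervalIntegral.integral_add (intervalIntegrable_ext A _ _)
          (intervalIntegrable_ext B _ _)
      map_smul' := fun c A => by
        ext t
        exact intervalIntegral.integral_smul _ _ }
    1 fun A => by
      refine (ContinuousMap.norm_le _ (by positivity)).2 fun t => ?_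
      refine (intervalIntegral.norm_integral_le_of_norm_le_const (C := ‖A‖)
        fun s _ => norm_ext_le A s).trans ?_
      rw [sub_zero, abs_of_nonneg t.2.1, one_mul]
      exact mul_le_of_le_one_right (norm_nonneg _) t.2.2

theorem primL_apply (A : Form1 𝔤) (t : unitInterval) :
    primL 𝔤 A t = ∫ s in (0 : ℝ)..t, ext A s := rfl

theorem ext_primL (A : Form1 𝔤) {t : ℝ} (ht : t ∈ Icc (0 : ℝ) 1) :
    ext (primL 𝔤 A) t = ∫ s in (0 : ℝ)..t, ext A s :=
  ext_coe (primL 𝔤 A) ⟨t, ht⟩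

theorem hasDerivWithinAt_ext_primL (A : Form1 𝔤) {t : ℝ} (ht : t ∈ Icc (0 : ℝ) 1) :
    HasDerivWithinAt (ext (primL 𝔤 A)) (ext A t) (Icc 0 1) t :=
  (hasDerivAt_primitive A t).hasDerivWithinAt.congr (fun _ hs => ext_primL A hs) (ext_primL A ht)

theorem norm_primL_le (A : Form1 𝔤) : ‖primL 𝔤 A‖ ≤ ‖A‖ := by
  refine ((primL 𝔤).le_opNorm A).trans ?_
  exact mul_le_of_le_one_left (norm_nonneg _) (LinearMap.mkContinuous_norm_le _ zero_le_one _)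

variable (𝔤) in
/-- The projection `π` as a continuous linear map. -/
def projL : Form1 𝔤 →L[ℝ] 𝔤 := (ContinuousMap.evalCLM ℝ (1 : unitInterval)).comp (primL 𝔤)

@[simp] theorem projL_apply (A : Form1 𝔤) : projL 𝔤 A = proj A := rfl

theorem norm_proj_le (A : Form1 𝔤) : ‖proj A‖ ≤ ‖A‖ :=
  ((primL 𝔤 A).norm_coe_le_norm 1).trans (norm_primL_le A)

variable (𝔤) in
/-- The inclusion `ι` as a continuous linear map. -/
def inclL : 𝔤 →L[ℝ] Form1 𝔤 :=
  LinearMap.mkContinuous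
    { toFun := incl
      map_add' := fun _ _ => rfl
      map_smul' := fun _ _ => rfl } 1 fun x => by
      rw [one_mul]
      exact (ContinuousMap.norm_le _ (norm_nonneg _)).2 fun t => le_rfl

@[simp] theorem inclL_apply (x : 𝔤) : inclL 𝔤 x = incl x := rfl

theorem norm_incl_le (x : 𝔤) : ‖incl x‖ ≤ ‖x‖ :=
  (ContinuousMap.norm_le _ (norm_nonneg _)).2 fun _ => le_rfl

@[simp] theorem proj_incl (x : 𝔤) : proj (incl x) = x := by
  simp [proj, ext_incl]

variable (𝔤) in
/-- The projection `1 - ι π` to the connections with vanishing integral. -/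
def perpL : Form1 𝔤 →L[ℝ] Form1 𝔤 := ContinuousLinearMap.id ℝ _ - (inclL 𝔤).comp (projL 𝔤)

theorem perpL_apply (A : Form1 𝔤) : perpL 𝔤 A = A - incl (proj A) := rfl

@[simp] theorem proj_perpL (A : Form1 𝔤) : proj (perpL 𝔤 A) = 0 := by
  rw [perpL_apply, ← projL_apply, map_sub, projL_apply, projL_apply, proj_incl, sub_self]

@[simp] theorem perpL_incl (x : 𝔤) : perpL 𝔤 (incl x) = 0 := by
  rw [perpL_apply, proj_incl, sub_self]

@[simp] theorem perpL_perpL (A : Form1 𝔤) : perpL 𝔤 (perpL 𝔤 A) = perpL 𝔤 A := by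
  rw [perpL_apply, proj_perpL]
  exact sub_zero _

theorem norm_perpL_le (A : Form1 𝔤) : ‖perpL 𝔤 A‖ ≤ 2 * ‖A‖ := by
  rw [perpL_apply, two_mul]
  exact (norm_sub_le _ _).trans (add_le_add_right ((norm_incl_le _).trans (norm_proj_le A)) _)

variable (𝔤) in
/-- The Dupont homotopy as a continuous linear map to functions. -/
def kappaL : Form1 𝔤 →L[ℝ] Form1 𝔤 := (primL 𝔤).comp (perpL 𝔤)

theorem kappaL_apply (A : Form1 𝔤) : kappaL 𝔤 A = primL 𝔤 (perpL 𝔤 A) := rfl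

/-- The bound uses only the part of `A` with zero integral. That part decays along the flow, which
makes the quadratic term of the flow equation integrable in `T`. -/
theorem norm_kappaL_le (A : Form1 𝔤) : ‖kappaL 𝔤 A‖ ≤ ‖perpL 𝔤 A‖ := norm_primL_le _

theorem kappa_toMap (A : Form1 𝔤) : (kappa A).toMap = kappaL 𝔤 A := by
  ext t
  refine (kappaFun_eq A t.2).trans ?_
  rw [kappaL_apply, perpL_apply, map_sub, ContinuousMap.sub_apply, primL_apply, primL_apply]
  simp [ext_incl]

theorem bracket_eq (A : Form1 𝔤) (c : Form0 𝔤) : bracket A c = brL 𝔤 A c.toMap := rfl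

theorem bracket_kappa (A B : Form1 𝔤) : bracket A (kappa B) = brL 𝔤 A (kappaL 𝔤 B) := by
  rw [bracket_eq, kappa_toMap]

/-- The homotopy identity `dκ = 1 - ιπ` of the Dupont contraction on 1-forms. -/
theorem extD_kappa (A : Form1 𝔤) : extD (kappa A) = perpL 𝔤 A := by
  ext t
  change derivWithin (ext (kappa A).toMap) (Icc 0 1) t = _
  rw [kappa_toMap, kappaL_apply,
    (hasDerivWithinAt_ext_primL _ t.2).derivWithin (uniqueDiffOn_Icc zero_lt_one t t.2), ext_coe]

/-- The linear part is a projection: the linearized flow of `-H^cl` fixes the constant forms and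
contracts the complement at rate `e^{-T}`. -/
theorem hamField_eq (A : Form1 𝔤) : hamField A = perpL 𝔤 A + brL 𝔤 A (kappaL 𝔤 A) := by
  rw [hamField, covD, extD_kappa, bracket_kappa]

/-- A function on `[0,1]` is determined by its derivative and its value at `0`. -/
theorem eqOn_of_hasDerivWithinAt {F : Type*} [NormedAddCommGroup F] [NormedSpace ℝ F]
    {f g f' : ℝ → F}
    (hf : ∀ t ∈ Icc (0 : ℝ) 1, HasDerivWithinAt f (f' t) (Icc 0 1) t)
    (hg : ∀ t ∈ Icc (0 : ℝ) 1, HasDerivWithinAt g (f' t) (Icc 0 1) t)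
    (h0 : f 0 = g 0) : EqOn f g (Icc 0 1) := by
  have h : ∀ t ∈ Icc (0 : ℝ) 1, HasDerivWithinAt (f - g) 0 (Icc 0 1) t := fun t ht => by
    simpa using (hf t ht).sub (hg t ht)
  intro t ht
  have := constant_of_derivWithin_zero (fun s hs => (h s hs).differentiableWithinAt)
    (fun s hs => (h s (Ico_subset_Icc_self hs)).derivWithin
      (uniqueDiffOn_Icc zero_lt_one s (Ico_subset_Icc_self hs))) t ht
  simp only [Pi.sub_apply, h0, sub_self] at this
  exact sub_eq_zero.1 this

end Operators

/-! ### The Magnus expansion in the space of connections -/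

section Magnus

variable {𝔤 : Type u} [NormedLieRing 𝔤] [NormedRealLieAlgebra 𝔤] [FiniteDimensional ℝ 𝔤]

/-- `Ωₙ` as a continuous function on `[0,1]`. -/
def magnusC (a : Form1 𝔤) : ℕ → Form1 𝔤
  | 0 => 0
  | n + 1 => primL 𝔤 (∑ k : Composition n, bernCoeff k.length •
      (List.ofFn fun i : Fin k.length => magnusC a (k.blocksFun i)).foldr
        (fun x y => brL 𝔤 x y) a)
  termination_by n => n
  decreasing_by exact Nat.lt_succ_of_le (k.blocksFun_le i)

/-- The nested pointwise bracket. -/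
def nestedC (Ω : ℕ → Form1 𝔤) (a : Form1 𝔤) (l : List ℕ) : Form1 𝔤 :=
  l.foldr (fun k y => brL 𝔤 (Ω k) y) a

/-- The derivative of `Ωₙ`. -/
def magnusCDeriv (a : Form1 𝔤) : ℕ → Form1 𝔤
  | 0 => 0
  | n + 1 => ∑ k : Composition n, bernCoeff k.length • nestedC (magnusC a) a k.blocks

theorem ofFn_blocksFun_foldr {M N : Type*} {n : ℕ} (k : Composition n) (f : ℕ → M)
    (g : M → N → N) (b : N) :
    (List.ofFn fun i : Fin k.length => f (k.blocksFun i)).foldr g b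
      = k.blocks.foldr (fun i y => g (f i) y) b := by
  have : (List.ofFn fun i : Fin k.length => f (k.blocksFun i)) = k.blocks.map f := by
    rw [← k.ofFn_blocksFun, List.map_ofFn]
    rfl
  rw [this, List.foldr_map]

theorem magnusC_zero (a : Form1 𝔤) : magnusC a 0 = 0 := by rw [magnusC]

theorem magnusC_eq (a : Form1 𝔤) (n : ℕ) : magnusC a n = primL 𝔤 (magnusCDeriv a n) := by
  cases n with
  | zero => rw [magnusC, magnusCDeriv, map_zero]
  | succ n =>
    rw [magnusC, magnusCDeriv]
    congr 1
    refine Finset.sum_congr rfl fun k _ => ?_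
    rw [ofFn_blocksFun_foldr, nestedC]

theorem ext_nestedC (Ω : ℕ → Form1 𝔤) (a : Form1 𝔤) (l : List ℕ) (t : ℝ) :
    ext (nestedC Ω a l) t = LieSeries.nested (fun k => ext (Ω k) t) (ext a t) l := by
  induction l with
  | nil => rfl
  | cons k l ih =>
    change ⁅ext (Ω k) t, ext (nestedC Ω a l) t⁆ = _
    rw [ih]; rfl

theorem ext_sum {ι : Type*} (s : Finset ι) (f : ι → Form1 𝔤) (t : ℝ) :
    ext (∑ i ∈ s, f i) t = ∑ i ∈ s, ext (f i) t := by
  change (∑ i ∈ s, f i) _ = _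
  rw [ContinuousMap.sum_apply]; rfl

/-- Moves the Magnus terms into the Banach space of connections, where they can be differentiated
with respect to `a`. The agreement is claimed only on `[0,1]`, since `ext` is constant outside. -/
theorem magnus_eq_magnusC (a : Form1 𝔤) (n : ℕ) {t : ℝ} (ht : t ∈ Icc (0 : ℝ) 1) :
    magnus a n t = ext (magnusC a n) t := by
  induction n using Nat.strong_induction_on generalizing t with
  | _ n ih =>
    cases n with
    | zero => rw [magnus, magnusC_zero]; rfl
    | succ n =>
      rw [magnus, magnusC_eq, ext_primL _ ht, magnusCDeriv]
      simp only [ext_sum, ext_smul]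
      rw [intervalIntegral.integral_finsetSum
        fun k _ => ((continuous_ext (nestedC (magnusC a) a k.blocks)).const_smul
          (bernCoeff k.length)).intervalIntegrable _ _]
      refine Finset.sum_congr rfl fun k _ => ?_
      rw [intervalIntegral.integral_smul]
      congr 1
      refine intervalIntegral.integral_congr fun s hs => ?_
      rw [uIcc_of_le ht.1] at hs
      have hs' : s ∈ Icc (0 : ℝ) 1 := ⟨hs.1, hs.2.trans ht.2⟩
      change _ = ext (nestedC (magnusC a) a k.blocks) s
      rw [ext_nestedC, LieSeries.nested, ← ofFn_blocksFun_foldr k (fun k => ext (magnusC a k) s)]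
      congr 2
      funext i
      exact ih _ (Nat.lt_succ_of_le (k.blocksFun_le i)) hs'

theorem contDiff_nestedC {Ω : Form1 𝔤 → ℕ → Form1 𝔤} (l : List ℕ)
    (h : ∀ k ∈ l, ContDiff ℝ 1 fun a => Ω a k) : ContDiff ℝ 1 fun a => nestedC (Ω a) a l := by
  induction l with
  | nil => exact contDiff_id
  | cons k l ih =>
    exact ((brL 𝔤).contDiff.comp (h k (by simp))).clm_apply
      (ih fun i hi => h i (List.mem_cons_of_mem _ hi))

theorem contDiff_magnusCDeriv_of_lt (n : ℕ)
    (h : ∀ k < n, ContDiff ℝ 1 fun a : Form1 𝔤 => magnusC a k) :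
    ContDiff ℝ 1 fun a : Form1 𝔤 => magnusCDeriv a n := by
  cases n with
  | zero => exact contDiff_const
  | succ n =>
    exact ContDiff.sum fun k _ => (contDiff_nestedC k.blocks fun i hi =>
      h i (Nat.lt_succ_of_le (k.blocks_le hi))).const_smul _

theorem contDiff_magnusC (n : ℕ) : ContDiff ℝ 1 fun a : Form1 𝔤 => magnusC a n := by
  induction n using Nat.strong_induction_on with
  | _ n ih =>
    simp only [magnusC_eq]
    exact (primL 𝔤).contDiff.comp (contDiff_magnusCDeriv_of_lt n ih)

theorem contDiff_magnusCDeriv (n : ℕ) : ContDiff ℝ 1 fun a : Form1 𝔤 => magnusCDeriv a n :=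
  contDiff_magnusCDeriv_of_lt n fun k _ => contDiff_magnusC k

/-- The formal series `∑ εⁿ Ωₙ(t)`. -/
def magnusSeries (a : Form1 𝔤) (t : ℝ) : LieSeries 𝔤 := fun n => ext (magnusC a n) t

/-- The formal series `∑ εⁿ Ωₙ'(t)`. -/
def magnusSeriesDeriv (a : Form1 𝔤) (t : ℝ) : LieSeries 𝔤 := fun n => ext (magnusCDeriv a n) t

theorem magnusSeries_zero (a : Form1 𝔤) (t : ℝ) : magnusSeries a t 0 = 0 := by
  rw [magnusSeries, magnusC_zero]; rfl

theorem magnusSeriesDeriv_zero (a : Form1 𝔤) (t : ℝ) : magnusSeriesDeriv a t 0 = 0 := rfl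

theorem magnusSeriesDeriv_eq (a : Form1 𝔤) (t : ℝ) :
    magnusSeriesDeriv a t
      = LieSeries.dexpInv (magnusSeries a t) (LieSeries.linear (ext a t)) := by
  funext n
  cases n with
  | zero =>
    rw [magnusSeriesDeriv_zero, LieSeries.dexpInv_apply]
    simp [LieSeries.linear]
  | succ n =>
    rw [LieSeries.dexpInv_linear (magnusSeries_zero a t)]
    change ext (∑ k : Composition n, _) t = _
    simp only [ext_sum, ext_smul, ext_nestedC]
    rfl

/-- The Magnus expansion solves `((e^{ad Ω} - 1) / ad Ω) Ω' = ε a`. -/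
theorem dexp_magnusSeriesDeriv (a : Form1 𝔤) (t : ℝ) (n : ℕ) :
    LieSeries.dexp (magnusSeries a t) (magnusSeriesDeriv a t) n
      = LieSeries.linear (ext a t) n := by
  rw [magnusSeriesDeriv_eq,
    LieSeries.dexp_dexpInv (magnusSeries_zero a t) (by simp [LieSeries.linear])]

end Magnus

/-! ### Derivatives of formal series -/

section SeriesDeriv

variable {𝔤 : Type u} [NormedLieRing 𝔤] [NormedRealLieAlgebra 𝔤] [FiniteDimensional ℝ 𝔤]

open LieSeries

theorem dexpTerm_succ {L : Type*} [LieRing L] [LieAlgebra ℝ L] (Ω v : L) (k : ℕ) :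
    dexpTerm Ω v (k + 1)
      = ((k : ℝ) + 1)⁻¹ • ((if k = 0 then v else 0) + ⁅Ω, dexpTerm Ω v k⁆) := rfl

theorem dexpTermDeriv_succ {L : Type*} [LieRing L] [LieAlgebra ℝ L] (Ω v w : L) (k : ℕ) :
    dexpTermDeriv Ω v w (k + 1)
      = ((k : ℝ) + 1)⁻¹ • (⁅w, dexpTerm Ω v k⁆ + ⁅Ω, dexpTermDeriv Ω v w k⁆) := rfl

/-- Coefficientwise derivative of a curve of formal series. -/
def SeriesHasDeriv (x : ℝ → LieSeries 𝔤) (x' : LieSeries 𝔤) (s : Set ℝ) (t : ℝ) : Prop :=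
  ∀ n, HasDerivWithinAt (fun τ => x τ n) (x' n) s t

variable {x y : ℝ → LieSeries 𝔤} {x' y' : LieSeries 𝔤} {s : Set ℝ} {t : ℝ}

theorem SeriesHasDeriv.lie (hx : SeriesHasDeriv x x' s t) (hy : SeriesHasDeriv y y' s t) :
    SeriesHasDeriv (fun τ => ⁅x τ, y τ⁆) (⁅x', y t⁆ + ⁅x t, y'⁆) s t := by
  intro n
  simp only [LieSeries.add_apply, lie_apply, ← Finset.sum_add_distrib]
  refine HasDerivWithinAt.fun_sum fun p _ => ?_
  rw [add_comm]
  exact (lieL 𝔤).hasDerivWithinAt_of_bilinear (hx p.1) (hy p.2)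

theorem SeriesHasDeriv.add (hx : SeriesHasDeriv x x' s t) (hy : SeriesHasDeriv y y' s t) :
    SeriesHasDeriv (fun τ => x τ + y τ) (x' + y') s t := fun n => (hx n).add (hy n)

theorem SeriesHasDeriv.smul (c : ℝ) (hx : SeriesHasDeriv x x' s t) :
    SeriesHasDeriv (fun τ => c • x τ) (c • x') s t := fun n => (hx n).const_smul c

theorem SeriesHasDeriv.dexpTerm (hx : SeriesHasDeriv x x' s t) (hy : SeriesHasDeriv y y' s t)
    (k : ℕ) : SeriesHasDeriv (fun τ => dexpTerm (x τ) (y τ) k)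
      (dexpTermDeriv (x t) (y t) x' k + OneDimBF.dexpTerm (x t) y' k) s t := by
  induction k with
  | zero =>
    intro n
    exact (hasDerivWithinAt_const t s (0 : 𝔤)).congr_deriv (add_zero (0 : 𝔤)).symm
  | succ k ih =>
    have h1 : SeriesHasDeriv (fun τ => if k = 0 then y τ else 0) (if k = 0 then y' else 0) s t := by
      split_ifs
      · exact hy
      · exact fun n => hasDerivWithinAt_const _ _ _
    have := ((h1.add (hx.lie ih)).smul ((k : ℝ) + 1)⁻¹)
    have e : dexpTermDeriv (x t) (y t) x' (k + 1) + OneDimBF.dexpTerm (x t) y' (k + 1)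
        = ((k : ℝ) + 1)⁻¹ • ((if k = 0 then y' else 0) + (⁅x', OneDimBF.dexpTerm (x t) (y t) k⁆
          + ⁅x t, dexpTermDeriv (x t) (y t) x' k + OneDimBF.dexpTerm (x t) y' k⁆)) := by
      rw [dexpTermDeriv_succ, dexpTerm_succ, lie_add, ← smul_add]
      congr 1
      abel
    rw [e]
    exact this

/-- The derivative of `dexp Ω v` with respect to `Ω` in the direction `w`. -/
def dexpDeriv (Ω v w : LieSeries 𝔤) : LieSeries 𝔤 :=
  tot (X := 𝔤) (dexpTermDeriv (L := LieSeries 𝔤) Ω v w)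

theorem dexpDeriv_apply (Ω v w : LieSeries 𝔤) (n : ℕ) :
    dexpDeriv Ω v w n = ∑ i ∈ Finset.range (n + 1), dexpTermDeriv Ω v w i n := rfl

theorem SeriesHasDeriv.dexp (hx : SeriesHasDeriv x x' s t) (hy : SeriesHasDeriv y y' s t) :
    SeriesHasDeriv (fun τ => dexp (x τ) (y τ))
      (dexpDeriv (x t) (y t) x' + LieSeries.dexp (x t) y') s t := by
  intro n
  simp only [LieSeries.add_apply, dexp_apply, dexpDeriv_apply, ← Finset.sum_add_distrib]
  exact HasDerivWithinAt.fun_sum fun i _ => (hx.dexpTerm hy i) n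

/-- The Maurer-Cartan equation. -/
theorem dexpDeriv_eq {Ω v w : LieSeries 𝔤} (hΩ : Ω 0 = 0) (hv : v 0 = 0) (hw : w 0 = 0) (n : ℕ) :
    dexpDeriv Ω v w n = dexpDeriv Ω w v n + ⁅dexp Ω w, dexp Ω v⁆ n := by
  rw [← sub_eq_iff_eq_add', dexpDeriv_apply, dexpDeriv_apply, ← Finset.sum_sub_distrib]
  have h := tot_antidiagonal
    (AddMonoidHom.mk' (fun x : 𝔤 => AddMonoidHom.mk' (fun y : 𝔤 => ⁅x, y⁆) (lie_add x))
      fun x y => by ext z; exact add_lie x y z)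
    (x := OneDimBF.dexpTerm (L := LieSeries 𝔤) Ω w)
    (y := OneDimBF.dexpTerm (L := LieSeries 𝔤) Ω v)
    (dexpTerm_order hΩ hw) (dexpTerm_order hΩ hv) n
  refine Eq.trans (Finset.sum_congr rfl fun i _ => ?_) h
  rw [← LieSeries.sub_apply, dexpTermDeriv_sub, LieSeries.sum_apply]
  rfl

/-- Multiplication of a formal series by `ε`. -/
def shift (x : LieSeries 𝔤) : LieSeries 𝔤
  | 0 => 0
  | n + 1 => x n

theorem lie_shift (x y : LieSeries 𝔤) : ⁅x, shift y⁆ = shift ⁅x, y⁆ := by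
  funext n
  cases n with
  | zero => simp [lie_apply, shift]
  | succ n =>
    rw [lie_apply, Finset.Nat.sum_antidiagonal_succ']
    simp [lie_apply, shift]

theorem dexpTerm_shift (Ω v : LieSeries 𝔤) (k n : ℕ) :
    OneDimBF.dexpTerm Ω (shift v) k n = shift (OneDimBF.dexpTerm Ω v k) n := by
  induction k generalizing n with
  | zero => cases n <;> rfl
  | succ k ih =>
    have h : OneDimBF.dexpTerm Ω (shift v) k = shift (OneDimBF.dexpTerm Ω v k) := funext ih
    rw [OneDimBF.dexpTerm, OneDimBF.dexpTerm, h, lie_shift]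
    cases n with
    | zero => by_cases hk : k = 0 <;> simp [hk, shift]
    | succ n => by_cases hk : k = 0 <;> simp [hk, shift]

theorem dexp_shift {Ω v : LieSeries 𝔤} (hΩ : Ω 0 = 0) (hv : v 0 = 0) (n : ℕ) :
    dexp Ω (shift v) (n + 1) = dexp Ω v n := by
  rw [dexp_apply, Finset.sum_congr rfl fun k _ => dexpTerm_shift Ω v k (n + 1)]
  change ∑ k ∈ Finset.range (n + 1 + 1), OneDimBF.dexpTerm Ω v k n = _
  rw [Finset.sum_range_succ, dexpTerm_order hΩ hv _ _ (Nat.lt_succ_self n), add_zero, dexp_apply]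

theorem dexp_sub (Ω v w : LieSeries 𝔤) (n : ℕ) :
    dexp Ω (v - w) n = dexp Ω v n - dexp Ω w n := by
  rw [dexp_apply, dexp_apply, dexp_apply, ← Finset.sum_sub_distrib]
  refine Finset.sum_congr rfl fun i _ => ?_
  cases i with
  | zero => exact (sub_zero (0 : 𝔤)).symm
  | succ k =>
    rw [dexpTerm_succ_eq, dexpTerm_succ_eq, dexpTerm_succ_eq, map_sub, smul_sub, LieSeries.sub_apply]

end SeriesDeriv

/-! ### Gauge invariance of the Magnus expansion -/

section Gauge

variable {𝔤 : Type u} [NormedLieRing 𝔤] [NormedRealLieAlgebra 𝔤] [FiniteDimensional ℝ 𝔤]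

open LieSeries

/-- The derivative of `∑ εⁿ Ωₙ(t)` in the direction `V`. -/
def varSeries (a V : Form1 𝔤) (t : ℝ) : LieSeries 𝔤 :=
  fun n => ext (fderiv ℝ (fun b => magnusC b n) a V) t

/-- The derivative of `∑ εⁿ Ωₙ'(t)` in the direction `V`. -/
def varSeriesDeriv (a V : Form1 𝔤) (t : ℝ) : LieSeries 𝔤 :=
  fun n => ext (fderiv ℝ (fun b => magnusCDeriv b n) a V) t

theorem fderiv_magnusC (a V : Form1 𝔤) (n : ℕ) :
    fderiv ℝ (fun b => magnusC b n) a V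
      = primL 𝔤 (fderiv ℝ (fun b => magnusCDeriv b n) a V) := by
  simp only [magnusC_eq]
  have h := (contDiff_magnusCDeriv (𝔤 := 𝔤) n).differentiable one_ne_zero a
  exact congrArg (fun T : Form1 𝔤 →L[ℝ] Form1 𝔤 => T V)
    ((primL 𝔤).hasFDerivAt.comp a h.hasFDerivAt).fderiv

theorem varSeries_zero (a V : Form1 𝔤) (t : ℝ) : varSeries a V t 0 = 0 := by
  simp only [varSeries, magnusC_zero]
  rw [fderiv_const_apply]; rfl

theorem varSeries_at_zero (a V : Form1 𝔤) (n : ℕ) : varSeries a V 0 n = 0 := by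
  rw [varSeries, fderiv_magnusC, ext_primL _ (left_mem_Icc.2 zero_le_one),
    intervalIntegral.integral_same]

theorem hasDerivAt_ext_line {f : Form1 𝔤 → Form1 𝔤} (hf : Differentiable ℝ f) (a V : Form1 𝔤)
    (t : ℝ) : HasDerivWithinAt (fun τ : ℝ => ext (f (a + τ • V)) t) (ext (fderiv ℝ f a V) t)
      univ 0 := by
  have h1 : HasDerivAt (fun τ : ℝ => a + τ • V) V 0 := by
    simpa using ((hasDerivAt_id (0 : ℝ)).smul_const V).const_add a
  have h2 : HasFDerivAt f (fderiv ℝ f a) (a + (0 : ℝ) • V) := by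
    simpa using (hf a).hasFDerivAt
  have h3 := ((ContinuousMap.evalCLM ℝ (projIcc (0 : ℝ) 1 zero_le_one t) :
    Form1 𝔤 →L[ℝ] 𝔤).hasFDerivAt.comp_hasDerivAt (0 : ℝ) (h2.comp_hasDerivAt (0 : ℝ) h1))
  exact h3.hasDerivWithinAt

/-- The linearization of `dexp_magnusSeriesDeriv`. -/
theorem linearized_dexp (a V : Form1 𝔤) (t : ℝ) (n : ℕ) :
    dexpDeriv (magnusSeries a t) (magnusSeriesDeriv a t) (varSeries a V t) n
      + dexp (magnusSeries a t) (varSeriesDeriv a V t) n = linear (ext V t) n := by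
  have h1 : SeriesHasDeriv (fun τ => magnusSeries (a + τ • V) t) (varSeries a V t) univ 0 :=
    fun n => hasDerivAt_ext_line ((contDiff_magnusC n).differentiable one_ne_zero) a V t
  have h2 : SeriesHasDeriv (fun τ => magnusSeriesDeriv (a + τ • V) t) (varSeriesDeriv a V t)
      univ 0 :=
    fun n => hasDerivAt_ext_line ((contDiff_magnusCDeriv n).differentiable one_ne_zero) a V t
  have h3 := h1.dexp h2 n
  have h4 : HasDerivWithinAt (fun τ : ℝ => linear (ext (a + τ • V) t) n) (linear (ext V t) n)
      univ 0 := by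
    by_cases hn : n = 1
    · simp only [linear, if_pos hn]
      have := hasDerivAt_ext_line (f := id) differentiable_id a V t
      simpa using this
    · simp only [linear, if_neg hn]
      exact hasDerivWithinAt_const _ _ _
  simp only [dexp_magnusSeriesDeriv] at h3
  have := (uniqueDiffWithinAt_univ (𝕜 := ℝ)).eq_deriv _ h3 h4
  simpa using this

/-- The variation `(δ e^Ω) e^{-Ω}` of the holonomy as a formal series. -/
def gaugeSeries (a V : Form1 𝔤) (t : ℝ) : LieSeries 𝔤 :=
  dexp (magnusSeries a t) (varSeries a V t)

theorem hasDeriv_magnusSeries (a : Form1 𝔤) {t : ℝ} (ht : t ∈ Icc (0 : ℝ) 1) :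
    SeriesHasDeriv (magnusSeries a) (magnusSeriesDeriv a t) (Icc 0 1) t := by
  intro n
  simp only [magnusSeries, magnusC_eq]
  exact hasDerivWithinAt_ext_primL _ ht

theorem hasDeriv_varSeries (a V : Form1 𝔤) {t : ℝ} (ht : t ∈ Icc (0 : ℝ) 1) :
    SeriesHasDeriv (varSeries a V) (varSeriesDeriv a V t) (Icc 0 1) t := by
  intro n
  simp only [varSeries, fderiv_magnusC]
  exact hasDerivWithinAt_ext_primL _ ht

theorem lie_linear_left (x : 𝔤) (y : LieSeries 𝔤) (n : ℕ) :
    ⁅linear x, y⁆ (n + 1) = ⁅x, y n⁆ := by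
  rw [lie_apply, Finset.sum_eq_single (1, n)]
  · simp [linear]
  · rintro ⟨i, j⟩ hp hne
    have hi : i ≠ 1 := by
      rintro rfl
      have := Finset.HasAntidiagonal.mem_antidiagonal.1 hp
      exact hne (by congr 1; simp only at this; omega)
    simp [linear, hi]
  · intro h
    exact absurd (Finset.HasAntidiagonal.mem_antidiagonal.2 (Nat.add_comm 1 n)) h

/-- In closed form, `g' = ε V + [ε a, g]`. Differentiating `g = dexp Ω δΩ` in `t` gives a derivative
in the direction `Ω'`. Maurer-Cartan exchanges the roles of `Ω'` and `δΩ` at the cost of `[dexp Ω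
Ω', g] = [ε a, g]`, and what remains is the linearized Magnus equation. -/
theorem hasDerivWithinAt_gaugeSeries (a V : Form1 𝔤) (n : ℕ) {t : ℝ} (ht : t ∈ Icc (0 : ℝ) 1) :
    HasDerivWithinAt (fun t => gaugeSeries a V t (n + 1))
      ((if n = 0 then ext V t else 0) + ⁅ext a t, gaugeSeries a V t n⁆) (Icc 0 1) t := by
  have h := (hasDeriv_magnusSeries a ht).dexp (hasDeriv_varSeries a V ht) (n + 1)
  refine h.congr_deriv ?_
  rw [LieSeries.add_apply, dexpDeriv_eq (magnusSeries_zero a t) (varSeries_zero a V t)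
    (magnusSeriesDeriv_zero a t), add_right_comm, linearized_dexp]
  congr 1
  · simp [linear]
  · rw [show dexp (magnusSeries a t) (magnusSeriesDeriv a t) = linear (ext a t) from
      funext (dexp_magnusSeriesDeriv a t), lie_linear_left]
    rfl

theorem gaugeSeries_at_zero (a V : Form1 𝔤) (n : ℕ) : gaugeSeries a V 0 n = 0 := by
  have : varSeries a V 0 = 0 := funext (varSeries_at_zero a V)
  have h := dexp_sub (magnusSeries a 0) (0 : LieSeries 𝔤) 0 n
  rw [sub_self, sub_self] at h
  rw [gaugeSeries, this, h]

theorem gaugeSeries_one (a V : Form1 𝔤) {t : ℝ} (ht : t ∈ Icc (0 : ℝ) 1) :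
    gaugeSeries a V t 1 = ext (primL 𝔤 V) t := by
  refine eqOn_of_hasDerivWithinAt (fun s hs => hasDerivWithinAt_gaugeSeries a V 0 hs)
    (fun s hs => ?_) ?_ ht
  · refine (hasDerivWithinAt_ext_primL V hs).congr_deriv ?_
    rw [if_pos rfl, gaugeSeries, dexp_zero, lie_zero, add_zero]
  · rw [gaugeSeries_at_zero, ext_primL _ (left_mem_Icc.2 zero_le_one),
      intervalIntegral.integral_same]

/-- Both sides solve the same initial value problem: the coefficient of degree one is `∫V`, so `[a,
∫V]` acts as the source of degree two for `V`, as it does in degree one for the new variation. The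
recursion is the same in higher degrees. -/
theorem gaugeSeries_bracket (a V : Form1 𝔤) (n : ℕ) {t : ℝ} (ht : t ∈ Icc (0 : ℝ) 1) :
    gaugeSeries a V t (n + 2) = gaugeSeries a (brL 𝔤 a (primL 𝔤 V)) t (n + 1) := by
  induction n generalizing t with
  | zero =>
    refine eqOn_of_hasDerivWithinAt (fun s hs => hasDerivWithinAt_gaugeSeries a V 1 hs)
      (fun s hs => (hasDerivWithinAt_gaugeSeries a _ 0 hs).congr_deriv ?_) ?_ ht
    · rw [if_pos rfl, gaugeSeries_one _ _ hs, gaugeSeries, dexp_zero, lie_zero, add_zero, ext_brL,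
        if_neg one_ne_zero, zero_add]
    · rw [gaugeSeries_at_zero, gaugeSeries_at_zero]
  | succ n ih =>
    refine eqOn_of_hasDerivWithinAt (fun s hs => hasDerivWithinAt_gaugeSeries a V (n + 2) hs)
      (fun s hs => (hasDerivWithinAt_gaugeSeries a _ (n + 1) hs).congr_deriv ?_) ?_ ht
    · rw [if_neg (Nat.succ_ne_zero _), if_neg (Nat.succ_ne_zero _), ih hs]
    · rw [gaugeSeries_at_zero, gaugeSeries_at_zero]

/-- Gauge invariance of the Magnus expansion, order by order: `δa = V + [a, ∫V]` with
`∫₀¹ V = 0` does not change `Ω(1)`. -/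
theorem fderiv_magnusC_succ {a V : Form1 𝔤} (hV : proj V = 0) (n : ℕ) :
    ext (fderiv ℝ (fun b => magnusC b (n + 1)) a V) 1
      = ext (fderiv ℝ (fun b => magnusC b n) a (brL 𝔤 a (primL 𝔤 V))) 1 := by
  have h1 : (1 : ℝ) ∈ Icc (0 : ℝ) 1 := right_mem_Icc.2 zero_le_one
  set W := brL 𝔤 a (primL 𝔤 V)
  have hΩ := magnusSeries_zero a 1
  have hW := varSeries_zero a W 1
  -- By injectivity of `dexp` it suffices to compare images. They agree from degree two on by
  -- `gaugeSeries_bracket`. The only obstruction, in degree one, is `∫₀¹ V`, which is zero.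
  have key : ∀ m, dexp (magnusSeries a 1) (varSeries a V 1 - shift (varSeries a W 1)) m = 0 := by
    intro m
    rw [dexp_sub]
    cases m with
    | zero => rw [dexp_zero, dexp_zero, sub_zero]
    | succ m =>
      rw [dexp_shift hΩ hW, sub_eq_zero]
      cases m with
      | zero =>
        rw [dexp_zero]
        refine (gaugeSeries_one a V h1).trans ?_
        rw [ext_primL _ h1]
        exact hV
      | succ m => exact gaugeSeries_bracket a V m h1
  have := eq_zero_of_dexp_eq_zero hΩ
    (by rw [LieSeries.sub_apply, varSeries_zero]; exact sub_zero _) key (n + 1)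
  exact sub_eq_zero.1 this

end Gauge

/-! ### The terms of the Magnus expansion of `-log P exp(-∫ A)` -/

section MagnusLog

variable {𝔤 : Type u} [NormedLieRing 𝔤] [NormedRealLieAlgebra 𝔤] [FiniteDimensional ℝ 𝔤]

variable (𝔤) in
/-- Evaluation at the endpoint `t = 1`. -/
def evalOne : Form1 𝔤 →L[ℝ] 𝔤 := ContinuousMap.evalCLM ℝ (1 : unitInterval)

theorem evalOne_apply (A : Form1 𝔤) : evalOne 𝔤 A = ext A 1 :=
  (ext_coe A 1).symm

theorem evalOne_primL (A : Form1 𝔤) : evalOne 𝔤 (primL 𝔤 A) = proj A := rfl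

theorem magnusLog_eq (A : Form1 𝔤) (n : ℕ) :
    magnusLog A n = -evalOne 𝔤 (magnusC (-A) n) := by
  rw [magnusLog, magnus_eq_magnusC _ _ (right_mem_Icc.2 zero_le_one), evalOne_apply]

theorem contDiff_magnusLog (n : ℕ) : ContDiff ℝ 1 fun A : Form1 𝔤 => magnusLog A n := by
  simp only [magnusLog_eq]
  exact ((evalOne 𝔤).contDiff.comp ((contDiff_magnusC n).comp contDiff_neg)).neg

theorem fderiv_magnusLog (A V : Form1 𝔤) (n : ℕ) :
    fderiv ℝ (fun A : Form1 𝔤 => magnusLog A n) A V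
      = evalOne 𝔤 (fderiv ℝ (fun b => magnusC b n) (-A) V) := by
  simp only [magnusLog_eq]
  have h := ((contDiff_magnusC (𝔤 := 𝔤) n).differentiable one_ne_zero (-A)).hasFDerivAt
  have h1 := ((evalOne 𝔤).hasFDerivAt.comp A
    (h.comp A (hasFDerivAt_id A).neg)).neg
  refine (congrArg (fun T : Form1 𝔤 →L[ℝ] 𝔤 => T V) h1.fderiv).trans ?_
  simp

/-- Gauge invariance: `D Mₙ₊₁(A)[V] + D Mₙ(A)[[A, ∫ V]] = 0` if `∫₀¹ V = 0`. -/
theorem fderiv_magnusLog_succ {A V : Form1 𝔤} (hV : proj V = 0) (n : ℕ) :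
    fderiv ℝ (fun A : Form1 𝔤 => magnusLog A (n + 1)) A V
      = -fderiv ℝ (fun A : Form1 𝔤 => magnusLog A n) A (brL 𝔤 A (primL 𝔤 V)) := by
  rw [fderiv_magnusLog, fderiv_magnusLog, evalOne_apply, evalOne_apply, fderiv_magnusC_succ hV,
    map_neg, neg_apply, map_neg, ext_neg]

theorem magnusLog_zero (A : Form1 𝔤) : magnusLog A 0 = 0 := by
  rw [magnusLog_eq, magnusC_zero, map_zero, neg_zero]

theorem composition_zero_eq (c : Composition 0) : c = Composition.ones 0 :=
  Composition.ext (by simp)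

theorem composition_one_eq (c : Composition 1) : c = Composition.single 1 one_pos :=
  (Composition.eq_single_iff_length one_pos).2
    (le_antisymm c.length_le (Nat.one_le_iff_ne_zero.2 fun h =>
      one_ne_zero ((Composition.length_eq_zero c).1 h)))

theorem magnusC_one (a : Form1 𝔤) : magnusC a 1 = primL 𝔤 a := by
  rw [magnusC_eq, magnusCDeriv,
    Fintype.sum_eq_single (Composition.ones 0) fun c hc => absurd (composition_zero_eq c) hc]
  simp [bernCoeff, nestedC]

theorem magnusC_two (a : Form1 𝔤) :
    magnusC a 2 = primL 𝔤 ((-1 / 2 : ℝ) • brL 𝔤 (primL 𝔤 a) a) := by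
  rw [magnusC_eq, magnusCDeriv,
    Fintype.sum_eq_single (Composition.single 1 one_pos)
      fun c hc => absurd (composition_one_eq c) hc]
  simp [bernCoeff, nestedC, magnusC_one]

theorem magnusLog_one (A : Form1 𝔤) : magnusLog A 1 = proj A := by
  rw [magnusLog_eq, magnusC_one, map_neg, map_neg, neg_neg, evalOne_primL]

theorem magnusLog_two (A : Form1 𝔤) :
    magnusLog A 2 =
      -((1 / 2 : ℝ) • ∫ t in (0 : ℝ)..1, ∫ t' in (0 : ℝ)..t, ⁅ext A t, ext A t'⁆) := by
  have h : ∀ t ∈ Icc (0 : ℝ) 1, (∫ t' in (0 : ℝ)..t, ⁅ext A t, ext A t'⁆)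
      = -ext (brL 𝔤 (primL 𝔤 A) A) t := by
    intro t ht
    rw [ext_brL, lie_skew, ext_primL A ht]
    exact (lieL 𝔤 (ext A t)).intervalIntegral_comp_comm (intervalIntegrable_ext A _ _)
  have e : brL 𝔤 (primL 𝔤 (-A)) (-A) = brL 𝔤 (primL 𝔤 A) A := by
    ext t
    rw [map_neg (primL 𝔤) A, brL_apply, brL_apply]
    exact (neg_lie _ _).trans ((congrArg _ (lie_neg _ _)).trans (neg_neg _))
  rw [magnusLog_eq, magnusC_two, evalOne_primL, e, ← projL_apply, map_smul, projL_apply]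
  have h2 : (∫ t in (0 : ℝ)..1, ∫ t' in (0 : ℝ)..t, ⁅ext A t, ext A t'⁆)
      = -proj (brL 𝔤 (primL 𝔤 A) A) := by
    rw [proj, ← intervalIntegral.integral_neg]
    refine intervalIntegral.integral_congr fun t ht => h t ?_
    rwa [uIcc_of_le zero_le_one] at ht
  rw [h2, smul_neg, neg_neg, ← neg_smul]
  norm_num

theorem nestedC_incl {Ω : ℕ → Form1 𝔤} {x : 𝔤} {l : List ℕ} (hl : l ≠ [])
    (h : ∀ k ∈ l, brL 𝔤 (Ω k) (incl x) = 0) : nestedC Ω (incl x) l = 0 := by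
  induction l with
  | nil => exact absurd rfl hl
  | cons k l ih =>
    change brL 𝔤 (Ω k) (nestedC Ω (incl x) l) = 0
    rcases l with _ | ⟨k', l'⟩
    · exact h k (by simp)
    · rw [ih (by simp) fun i hi => h i (List.mem_cons_of_mem _ hi), map_zero]

/-- For a constant form `Ω₁ = t x` commutes with `x`, so the innermost bracket of every higher term
vanishes. The commutation is part of the statement so that the induction closes. -/
theorem magnusC_incl (x : 𝔤) (n : ℕ) :
    brL 𝔤 (magnusC (incl x) n) (incl x) = 0 ∧ (2 ≤ n → magnusC (incl x) n = 0) := by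
  induction n using Nat.strong_induction_on with
  | _ n ih =>
    have h2 : 2 ≤ n → magnusC (incl x) n = 0 := by
      intro hn
      obtain ⟨m, rfl⟩ : ∃ m, n = m + 2 := ⟨n - 2, by omega⟩
      rw [magnusC_eq, magnusCDeriv, Finset.sum_eq_zero, map_zero]
      intro c _
      rw [nestedC_incl, smul_zero]
      · intro h
        exact Nat.succ_ne_zero m ((Composition.blocks_eq_nil c).1 h)
      · exact fun k hk => (ih k (Nat.lt_succ_of_le (c.blocks_le hk))).1
    refine ⟨?_, h2⟩
    rcases Nat.lt_or_ge n 2 with hn | hn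
    · interval_cases n
      · rw [magnusC_zero, map_zero, zero_apply]
      · ext t
        rw [magnusC_one, brL_apply, primL_apply]
        simp only [ext_incl, intervalIntegral.integral_const]
        change ⁅_, x⁆ = (0 : 𝔤)
        rw [smul_lie, lie_self, smul_zero]
    · rw [h2 hn, map_zero, zero_apply]

theorem magnusLog_incl (x : 𝔤) (n : ℕ) : magnusLog (incl x) n = if n = 1 then x else 0 := by
  rcases Nat.lt_trichotomy n 1 with h | rfl | h
  · rw [Nat.lt_one_iff.1 h, magnusLog_zero, if_neg zero_ne_one]
  · rw [magnusLog_one, proj_incl, if_pos rfl]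
  · have : -incl x = incl (-x) := rfl
    rw [magnusLog_eq, this, (magnusC_incl (-x) n).2 h, map_zero, neg_zero, if_neg h.ne']

end MagnusLog

/-! ### The homological perturbation series -/

section Perturbation

variable {𝔤 : Type u} [NormedLieRing 𝔤] [NormedRealLieAlgebra 𝔤] [FiniteDimensional ℝ 𝔤]

/-- Along `s ↦ e^{-s} A + (1 - e^{-s}) ιπA` the velocity is `-e^{-s} (A - ιπA)`. Gauge invariance
with `V = A - ιπA`, whose primitive is `κA`, turns the integrand into the derivative of `ξ(Mₙ₊₂)`
along this path. The integral is therefore the value at `ιπA`, which is zero, minus the value at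
`A`. -/
theorem homotopyK_magnusLog (ξ : Module.Dual ℝ 𝔤) (n : ℕ) (A : Form1 𝔤) :
    homotopyK (diffQint fun A => ξ (magnusLog A (n + 1))) A = -ξ (magnusLog A (n + 2)) := by
  set ξL : 𝔤 →L[ℝ] ℝ := LinearMap.toContinuousLinearMap ξ
  set path : ℝ → Form1 𝔤 := fun s => Real.exp (-s) • A + (1 - Real.exp (-s)) • incl (proj A)
    with hpath
  set f : Form1 𝔤 → 𝔤 := fun A => magnusLog A (n + 2) with hf
  set φ : ℝ → ℝ := fun x => ξL (fderiv ℝ f (x • A + (1 - x) • incl (proj A)) (perpL 𝔤 A)) with hφ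
  have hcd : ContDiff ℝ 1 f := contDiff_magnusLog (n + 2)
  have hexp : ∀ s : ℝ, HasDerivAt (fun s : ℝ => Real.exp (-s)) (-Real.exp (-s)) s := by
    intro s
    simpa using (hasDerivAt_neg s).exp
  have hpathd : ∀ s, HasDerivAt path (-Real.exp (-s) • perpL 𝔤 A) s := by
    intro s
    have h := ((hexp s).smul_const A).add
      (((hexp s).const_sub 1).smul_const (incl (proj A)))
    refine h.congr_deriv ?_
    rw [perpL_apply, smul_sub, neg_neg, neg_smul, neg_smul, sub_neg_eq_add]
  have hint : ∀ s, Real.exp (-s) * diffQint (fun A => ξ (magnusLog A (n + 1))) (path s) (kappa A)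
      = -Real.exp (-s) * φ (Real.exp (-s)) := by
    intro s
    have h1 : fderiv ℝ (fun A => ξ (magnusLog A (n + 1))) (path s)
        = ξL.comp (fderiv ℝ (fun A : Form1 𝔤 => magnusLog A (n + 1)) (path s)) :=
      (ξL.hasFDerivAt.comp (path s)
        ((contDiff_magnusLog (𝔤 := 𝔤) (n + 1)).differentiable one_ne_zero _).hasFDerivAt).fderiv
    -- The base point moves with `s`, but the variation `perpL 𝔤 A` stays fixed, in accordance with
    -- the fixed argument `κA` in the definition of `K`.
    have h2 := fderiv_magnusLog_succ (A := path s) (proj_perpL A) (n + 1)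
    rw [diffQint, h1, bracket_eq, kappa_toMap, ContinuousLinearMap.comp_apply, kappaL_apply,
      ← neg_neg (fderiv ℝ (fun A : Form1 𝔤 => magnusLog A (n + 1)) (path s) _), ← h2, map_neg]
    rw [mul_neg, neg_mul]
  have hG : ∀ s, HasDerivAt (fun s => ξL (f (path s)))
      (-Real.exp (-s) * φ (Real.exp (-s))) s := by
    intro s
    have h := ξL.hasFDerivAt.comp_hasDerivAt s
      ((hcd.differentiable one_ne_zero (path s)).hasFDerivAt.comp_hasDerivAt s (hpathd s))
    refine h.congr_deriv ?_
    rw [map_smul, map_smul, smul_eq_mul]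
  have hφc : Continuous φ := by
    have h1 : Continuous fun x : ℝ => x • A + (1 - x) • incl (proj A) := by fun_prop
    exact ξL.continuous.comp
      (((hcd.continuous_fderiv one_ne_zero).comp h1).clm_apply continuous_const)
  -- For `s ≥ 0` the variable `e^{-s}` stays in `[0,1]`, so `φ` is bounded there and the factor
  -- `e^{-s}` gives integrability.
  obtain ⟨C, hC⟩ := isCompact_Icc.exists_bound_of_continuousOn (s := Icc (0 : ℝ) 1)
    hφc.continuousOn
  have hI : IntegrableOn (fun s : ℝ => -Real.exp (-s) * φ (Real.exp (-s))) (Ioi 0) := by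
    have h1 : IntegrableOn (fun s : ℝ => Real.exp (-s) * C) (Ioi 0) :=
      (integrableOn_exp_neg_Ioi 0).mul_const C
    refine h1.mono' (by fun_prop) ?_
    refine (ae_restrict_mem measurableSet_Ioi).mono fun s hs => ?_
    rw [norm_mul, norm_neg, Real.norm_of_nonneg (Real.exp_pos _).le]
    refine mul_le_mul_of_nonneg_left (hC _ ⟨(Real.exp_pos _).le, ?_⟩) (Real.exp_pos _).le
    exact Real.exp_le_one_iff.2 (neg_nonpos.2 (le_of_lt hs))
  have hexp0 : Tendsto (fun s : ℝ => Real.exp (-s)) atTop (𝓝 0) :=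
    Real.tendsto_exp_neg_atTop_nhds_zero
  have hlim : Tendsto (fun s => ξL (f (path s))) atTop (𝓝 0) := by
    have hp : Tendsto path atTop (𝓝 (incl (proj A))) := by
      have := (hexp0.smul_const A).add ((hexp0.const_sub 1).smul_const (incl (proj A)))
      simpa using this
    have h := (ξL.continuous.tendsto _).comp ((hcd.continuous.tendsto _).comp hp)
    have h0 : f (incl (proj A)) = 0 := by
      rw [hf]
      simp only
      rw [magnusLog_incl, if_neg (by omega)]
    rwa [h0, map_zero] at h
  have := integral_Ioi_of_hasDerivAt_of_tendsto (a := 0)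
    (hG 0).continuousAt.continuousWithinAt (fun s _ => hG s) hI hlim
  rw [homotopyK]
  change (∫ s in Ioi (0 : ℝ), Real.exp (-s)
    * diffQint (fun A => ξ (magnusLog A (n + 1))) (path s) (kappa A)) = _
  simp only [hint]
  rw [this, zero_sub]
  have hp0 : path 0 = A := by simp [hpath]
  rw [hp0]
  rfl

theorem hplTerm_eq (ξ : Module.Dual ℝ 𝔤) (n : ℕ) :
    hplTerm ξ n = fun A : Form1 𝔤 => ξ (magnusLog A (n + 1)) := by
  induction n with
  | zero => funext A; rw [hplTerm, magnusLog_one]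
  | succ n ih =>
    funext A
    rw [hplTerm, ih]
    exact (congrArg _ (homotopyK_magnusLog ξ n A)).trans (neg_neg _)

end Perturbation

/-! ### Representations: the Magnus expansion is the logarithm of the holonomy -/

section Formal

attribute [local instance] LieRing.ofAssociativeRing LieAlgebra.ofAssociativeAlgebra

variable {R : Type*} [Ring R]

theorem coeff_pow_eq_zero {x : PowerSeries R} (hx : PowerSeries.coeff 0 x = 0) (k : ℕ) :
    ∀ n, n < k → PowerSeries.coeff n (x ^ k) = 0 := by
  induction k with
  | zero => intro n hn; omega
  | succ k ih =>
    intro n hn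
    rw [pow_succ', PowerSeries.coeff_mul]
    refine Finset.sum_eq_zero fun p hp => ?_
    have hp' := Finset.HasAntidiagonal.mem_antidiagonal.1 hp
    rcases Nat.eq_zero_or_pos p.1 with h | h
    · rw [h, hx, zero_mul]
    · rw [ih _ (by omega), mul_zero]

theorem coeff_pow_congr {x y : PowerSeries R} {n : ℕ}
    (h : ∀ m ≤ n, PowerSeries.coeff m x = PowerSeries.coeff m y) (k : ℕ) :
    ∀ m ≤ n, PowerSeries.coeff m (x ^ k) = PowerSeries.coeff m (y ^ k) := by
  induction k with
  | zero => simp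
  | succ k ih =>
    intro m hm
    rw [pow_succ', pow_succ', PowerSeries.coeff_mul, PowerSeries.coeff_mul]
    refine Finset.sum_congr rfl fun p hp => ?_
    have hp' := Finset.HasAntidiagonal.mem_antidiagonal.1 hp
    rw [h _ (by omega), ih _ (by omega)]

/-- The Taylor polynomial of degree `N` of the exponential. -/
def expPoly (N : ℕ) : Polynomial ℝ :=
  ∑ k ∈ Finset.range (N + 1), Polynomial.C ((k.factorial : ℝ)⁻¹) * Polynomial.X ^ k

/-- The partial sum of degree `n` of `log e_N`, with `e_N` the Taylor polynomial of `exp`. -/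
def logExpPoly (n N : ℕ) : Polynomial ℝ :=
  ∑ k ∈ Finset.range n, Polynomial.C ((-1 : ℝ) ^ k / ((k : ℝ) + 1)) * (expPoly N - 1) ^ (k + 1)

open Polynomial in
theorem derivative_expPoly (N : ℕ) :
    derivative (expPoly N) = expPoly N - C ((N.factorial : ℝ)⁻¹) * X ^ N := by
  induction N with
  | zero => simp [expPoly]
  | succ N ih =>
    have h : expPoly (N + 1) = expPoly N + C (((N + 1).factorial : ℝ)⁻¹) * X ^ (N + 1) :=
      Finset.sum_range_succ _ _
    have hN : (((N + 1).factorial : ℝ)⁻¹) * ((N : ℝ) + 1) = (N.factorial : ℝ)⁻¹ := by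
      rw [Nat.factorial_succ]
      push_cast
      field_simp
    rw [h, derivative_add, ih, derivative_C_mul_X_pow, Nat.add_sub_cancel]
    push_cast
    rw [hN]
    ring

open Polynomial in
theorem X_dvd_expPoly_sub_one (N : ℕ) : X ∣ expPoly N - 1 := by
  rw [X_dvd_iff, expPoly, Finset.sum_range_succ']
  simp

open Polynomial in
/-- `log (exp X) = X` up to order `n`. -/
theorem X_pow_dvd_logExpPoly_sub (n : ℕ) : X ^ (n + 1) ∣ logExpPoly n n - X := by
  -- With `e` the Taylor polynomial, differentiation turns the truncated logarithm into `∑ (1 - e)^k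
  -- e'`. Since `e' = e - X^n / n!`, the geometric sum gives `1 - (1 - e)^n` up to a multiple of
  -- `X^n`, and `X` divides `1 - e`.
  have hd : X ^ n ∣ derivative (logExpPoly n n - X) := by
    have h1 : derivative (logExpPoly n n)
        = (∑ k ∈ Finset.range n, (-(expPoly n - 1)) ^ k) * derivative (expPoly n) := by
      rw [logExpPoly, derivative_sum, Finset.sum_mul]
      refine Finset.sum_congr rfl fun k _ => ?_
      have hk : (-1 : ℝ) ^ k / ((k : ℝ) + 1) * ((k : ℝ) + 1) = (-1) ^ k := by
        field_simp
      rw [derivative_C_mul, derivative_pow_succ, derivative_sub, derivative_one, sub_zero,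
        ← mul_assoc, ← mul_assoc]
      congr 1
      rw [← C_mul, hk, neg_pow (expPoly n - 1) k]
      simp
    have h2 : derivative (logExpPoly n n - X) = -(-(expPoly n - 1)) ^ n
        - (∑ k ∈ Finset.range n, (-(expPoly n - 1)) ^ k) * (C ((n.factorial : ℝ)⁻¹) * X ^ n) := by
      have hg := mul_neg_geom_sum (-(expPoly n - 1)) n
      rw [derivative_sub, derivative_X, h1, derivative_expPoly]
      linear_combination hg
    rw [h2]
    refine dvd_sub ?_ ?_
    · exact (dvd_neg.2 (pow_dvd_pow_of_dvd (dvd_neg.2 (X_dvd_expPoly_sub_one n)) n))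
    · exact Dvd.dvd.mul_left (Dvd.dvd.mul_left dvd_rfl _) _
  rw [X_pow_dvd_iff] at hd ⊢
  intro m hm
  cases m with
  | zero =>
    have h0 : X ∣ logExpPoly n n :=
      Finset.dvd_sum fun k _ => ((X_dvd_expPoly_sub_one n).trans
        (dvd_pow_self _ (Nat.succ_ne_zero k))).mul_left _
    exact X_dvd_iff.1 (dvd_sub h0 dvd_rfl)
  | succ m =>
    have := hd m (by omega)
    rw [coeff_derivative] at this
    exact (mul_eq_zero.1 this).resolve_right (by positivity)

variable [Algebra ℝ R]

theorem coeff_expTerm_eq_zero {x : PowerSeries R} (hx : PowerSeries.coeff 0 x = 0) (k n : ℕ)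
    (h : n < k) : PowerSeries.coeff n (expTerm x k) = 0 := by
  rw [expTerm_eq, PowerSeries.coeff_smul, coeff_pow_eq_zero hx k n h, smul_zero]

/-- The formal logarithm inverts the formal exponential. -/
theorem sum_log_eq_of_exp {x u : PowerSeries R} (hx : PowerSeries.coeff 0 x = 0)
    (hu : ∀ n, PowerSeries.coeff n u = tot (fun k m => PowerSeries.coeff m (expTerm x k)) n)
    (n : ℕ) :
    ∑ k ∈ Finset.range n,
      ((-1 : ℝ) ^ k / ((k : ℝ) + 1)) • PowerSeries.coeff n ((u - 1) ^ (k + 1))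
      = PowerSeries.coeff n x := by
  -- As `x` has no constant term, `x^k` does not reach degree `n` for `k > n`, so `exp` may be
  -- replaced by a polynomial. Only powers of the single element `x` occur, so the commutative
  -- polynomial identity applies although `R` need not be commutative.
  have h1 : Polynomial.aeval x (expPoly n) = ∑ k ∈ Finset.range (n + 1), expTerm x k := by
    rw [expPoly, map_sum]
    refine Finset.sum_congr rfl fun k _ => ?_
    rw [expTerm_eq, map_mul, Polynomial.aeval_C, map_pow, Polynomial.aeval_X, ← Algebra.smul_def]
  have h2 : ∀ m ≤ n, PowerSeries.coeff m (u - 1)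
      = PowerSeries.coeff m (Polynomial.aeval x (expPoly n - 1)) := by
    intro m hm
    rw [map_sub (Polynomial.aeval (R := ℝ) x), map_one, h1, map_sub, map_sub, hu,
      tot_eq_sum_range (coeff_expTerm_eq_zero hx) (show m < n + 1 by omega), map_sum]
  have h3 : PowerSeries.coeff n (Polynomial.aeval x (logExpPoly n n - Polynomial.X)) = 0 := by
    obtain ⟨q, hq⟩ := X_pow_dvd_logExpPoly_sub n
    rw [hq, mul_comm, map_mul, map_pow, Polynomial.aeval_X, PowerSeries.coeff_mul]
    refine Finset.sum_eq_zero fun p hp => ?_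
    have hp' := Finset.HasAntidiagonal.mem_antidiagonal.1 hp
    rw [coeff_pow_eq_zero hx _ _ (show p.2 < n + 1 by omega), mul_zero]
  rw [map_sub, Polynomial.aeval_X, map_sub, sub_eq_zero] at h3
  rw [← h3, logExpPoly, map_sum, map_sum]
  refine Finset.sum_congr rfl fun k _ => ?_
  rw [map_mul, Polynomial.aeval_C, ← Algebra.smul_def, PowerSeries.coeff_smul,
    map_pow (Polynomial.aeval (R := ℝ) x), coeff_pow_congr h2 (k + 1) n le_rfl]

end Formal

/-! ### The formal holonomy as the exponential of the Magnus series -/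

section Holonomy

attribute [local instance] LieRing.ofAssociativeRing LieAlgebra.ofAssociativeAlgebra

variable {𝔤 : Type u} [NormedLieRing 𝔤] [NormedRealLieAlgebra 𝔤] [FiniteDimensional ℝ 𝔤]
variable {𝔸 : Type v} [NormedRing 𝔸] [NormedAlgebra ℝ 𝔸] {ρ : 𝔤 →ₗ[ℝ] 𝔸}

/-- The action of a representation on formal series. -/
def repSeries (ρ : 𝔤 →ₗ[ℝ] 𝔸) (x : LieSeries 𝔤) : PowerSeries 𝔸 := PowerSeries.mk fun n => ρ (x n)

@[simp] theorem coeff_repSeries (x : LieSeries 𝔤) (n : ℕ) :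
    PowerSeries.coeff n (repSeries ρ x) = ρ (x n) := PowerSeries.coeff_mk _ _

theorem repSeries_lie (hρ : IsLieRep ρ) (x y : LieSeries 𝔤) :
    repSeries ρ ⁅x, y⁆ = ⁅repSeries ρ x, repSeries ρ y⁆ := by
  ext n
  rw [Ring.lie_def, map_sub, PowerSeries.coeff_mul, PowerSeries.coeff_mul,
    ← Finset.Nat.sum_antidiagonal_swap (f := fun p =>
      PowerSeries.coeff p.1 (repSeries ρ y) * PowerSeries.coeff p.2 (repSeries ρ x)),
    ← Finset.sum_sub_distrib, coeff_repSeries, LieSeries.lie_apply, map_sum]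
  refine Finset.sum_congr rfl fun p _ => ?_
  simp only [coeff_repSeries, Prod.fst_swap, Prod.snd_swap]
  exact hρ _ _

theorem repSeries_dexpTerm (hρ : IsLieRep ρ) (Ω v : LieSeries 𝔤) (k : ℕ) :
    repSeries ρ (dexpTerm Ω v k) = dexpTerm (repSeries ρ Ω) (repSeries ρ v) k := by
  induction k with
  | zero => ext n; exact map_zero ρ
  | succ k ih =>
    rw [dexpTerm_succ, dexpTerm_succ, ← ih, ← repSeries_lie hρ]
    ext n
    rw [coeff_repSeries, LieSeries.smul_apply, map_smul, PowerSeries.coeff_smul,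
      LieSeries.add_apply, map_add, map_add, coeff_repSeries]
    congr 2
    split_ifs
    · rw [coeff_repSeries]
    · rw [LieSeries.zero_apply, map_zero, map_zero]

/-- Coefficientwise derivative of a curve of power series. -/
def CoeffHasDeriv (x : ℝ → PowerSeries 𝔸) (x' : PowerSeries 𝔸) (s : Set ℝ) (t : ℝ) : Prop :=
  ∀ n, HasDerivWithinAt (fun τ => PowerSeries.coeff n (x τ)) (PowerSeries.coeff n x') s t

theorem CoeffHasDeriv.expTerm {x : ℝ → PowerSeries 𝔸} {x' : PowerSeries 𝔸} {s : Set ℝ} {t : ℝ}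
    (hx : CoeffHasDeriv x x' s t) (k : ℕ) :
    CoeffHasDeriv (fun τ => expTerm (x τ) k) (expTermDeriv (x t) x' k) s t := by
  induction k with
  | zero => exact fun n => (hasDerivWithinAt_const _ _ _).congr_deriv (map_zero _).symm
  | succ k ih =>
    intro n
    simp only [OneDimBF.expTerm, expTermDeriv, PowerSeries.coeff_smul, map_add,
      PowerSeries.coeff_mul, ← Finset.sum_add_distrib]
    exact (HasDerivWithinAt.fun_sum fun p _ => (hx p.1).mul (ih p.2)).const_smul _

/-- The coefficients of `exp (∑ εⁿ ρ(Ωₙ(t)))`. -/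
def expMagnus (ρ : 𝔤 →ₗ[ℝ] 𝔸) (a : Form1 𝔤) (n : ℕ) (t : ℝ) : 𝔸 :=
  tot (fun k m => PowerSeries.coeff m (expTerm (repSeries ρ (magnusSeries a t)) k)) n

/-- The coefficients of `(e^Ω)' = (dexp Ω Ω') e^Ω = ε a e^Ω`. The factor `ε` lowers the index by
one. -/
theorem hasDeriv_expMagnus (hρ : IsLieRep ρ) (a : Form1 𝔤) (n : ℕ) {t : ℝ}
    (ht : t ∈ Icc (0 : ℝ) 1) :
    HasDerivWithinAt (expMagnus ρ a (n + 1)) (ρ (ext a t) * expMagnus ρ a n t) (Icc 0 1) t := by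
  set Ω := repSeries ρ (magnusSeries a t)
  set Ω' := repSeries ρ (magnusSeriesDeriv a t)
  have hΩ0 : PowerSeries.coeff 0 Ω = 0 := by
    rw [coeff_repSeries, magnusSeries_zero, map_zero]
  have h1 : CoeffHasDeriv (fun t => repSeries ρ (magnusSeries a t)) Ω' (Icc 0 1) t := by
    intro m
    simp only [Ω', coeff_repSeries]
    exact (LinearMap.toContinuousLinearMap ρ).hasFDerivAt.comp_hasDerivWithinAt t
      (hasDeriv_magnusSeries a ht m)
  have h2 : HasDerivWithinAt (expMagnus ρ a (n + 1))
      (∑ k ∈ Finset.range (n + 1 + 1), PowerSeries.coeff (n + 1) (expTermDeriv Ω Ω' k))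
      (Icc 0 1) t :=
    HasDerivWithinAt.fun_sum (u := Finset.range (n + 1 + 1)) fun k _ => h1.expTerm k (n + 1)
  refine h2.congr_deriv ?_
  have hd : ∀ i m, m < i → PowerSeries.coeff m (dexpTerm Ω Ω' i) = 0 := by
    intro i m h
    rw [← repSeries_dexpTerm hρ, coeff_repSeries,
      LieSeries.dexpTerm_order (magnusSeries_zero a t) (magnusSeriesDeriv_zero a t) i m h, map_zero]
  have hdexp : ∀ m, tot (fun k m => PowerSeries.coeff m (dexpTerm Ω Ω' k)) m
      = ρ (LieSeries.linear (ext a t) m) := by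
    intro m
    rw [← dexp_magnusSeriesDeriv, LieSeries.dexp_apply, map_sum, tot]
    refine Finset.sum_congr rfl fun i _ => ?_
    rw [← repSeries_dexpTerm hρ, coeff_repSeries]
  have h3 := tot_antidiagonal (AddMonoidHom.mul (R := 𝔸)) hd (coeff_expTerm_eq_zero hΩ0) (n + 1)
  simp only [AddMonoidHom.mul_apply, hdexp] at h3
  refine Eq.trans (Finset.sum_congr rfl fun k _ => ?_) (h3.trans ?_)
  · rw [expTermDeriv_eq, map_sum]
    exact Finset.sum_congr rfl fun q _ => PowerSeries.coeff_mul _ _ _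
  · rw [Finset.sum_eq_single (1, n)]
    · simp [LieSeries.linear, expMagnus, Ω]
    · rintro ⟨i, j⟩ hp hne
      have hi : i ≠ 1 := by
        rintro rfl
        have := Finset.HasAntidiagonal.mem_antidiagonal.1 hp
        exact hne (by congr 1; simp only at this; omega)
      simp [LieSeries.linear, hi]
    · intro h
      exact absurd (Finset.HasAntidiagonal.mem_antidiagonal.2 (Nat.add_comm 1 n)) h

theorem expMagnus_zero_left (a : Form1 𝔤) (t : ℝ) : expMagnus ρ a 0 t = 1 := by
  simp [expMagnus, tot, expTerm]

theorem expMagnus_at_zero (a : Form1 𝔤) (n : ℕ) : expMagnus ρ a (n + 1) 0 = 0 := by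
  have h0 : repSeries ρ (magnusSeries a 0) = 0 := by
    ext m
    rw [coeff_repSeries, magnusSeries, magnusC_eq, ext_primL _ (left_mem_Icc.2 zero_le_one),
      intervalIntegral.integral_same, map_zero, map_zero]
  rw [expMagnus, h0]
  refine Finset.sum_eq_zero fun k _ => ?_
  cases k with
  | zero => simp [expTerm, PowerSeries.coeff_one]
  | succ k => simp [expTerm]

theorem continuous_rep_ext (ρ : 𝔤 →ₗ[ℝ] 𝔸) (A : Form1 𝔤) : Continuous fun t => ρ (ext A t) :=
  (LinearMap.toContinuousLinearMap ρ).continuous.comp (continuous_ext A)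

variable [CompleteSpace 𝔸]

theorem hasDerivAt_holTerm (ρ : 𝔤 →ₗ[ℝ] 𝔸) (A : Form1 𝔤) (n : ℕ) :
    Continuous (holTerm ρ A n) ∧
      ∀ t, HasDerivAt (holTerm ρ A (n + 1)) (-(ρ (ext A t) * holTerm ρ A n t)) t := by
  have step : ∀ n, Continuous (holTerm ρ A n) →
      ∀ t, HasDerivAt (holTerm ρ A (n + 1)) (-(ρ (ext A t) * holTerm ρ A n t)) t := by
    intro n h t
    have hc := (continuous_rep_ext ρ A).mul h
    exact (intervalIntegral.integral_hasDerivAt_right (hc.intervalIntegrable _ _)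
      (hc.stronglyMeasurableAtFilter _ _) hc.continuousAt).neg
  have hcont : Continuous (holTerm ρ A n) := by
    induction n with
    | zero => exact continuous_const
    | succ n ih => exact continuous_iff_continuousAt.2 fun t => (step n ih t).continuousAt
  exact ⟨hcont, step n hcont⟩

/-- Both sequences start with `1`, satisfy `u' = -ρ(A) u` with a shift of index, and vanish at `t =
0` in positive degree. -/
theorem holTerm_eq_expMagnus (hρ : IsLieRep ρ) (A : Form1 𝔤) (n : ℕ) {t : ℝ}
    (ht : t ∈ Icc (0 : ℝ) 1) : holTerm ρ A n t = expMagnus ρ (-A) n t := by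
  induction n generalizing t with
  | zero => rw [expMagnus_zero_left]; rfl
  | succ n ih =>
    refine eqOn_of_hasDerivWithinAt
      (fun s _ => ((hasDerivAt_holTerm ρ A n).2 s).hasDerivWithinAt)
      (fun s hs => (hasDeriv_expMagnus hρ (-A) n hs).congr_deriv ?_) ?_ ht
    · rw [ext_neg, map_neg, neg_mul, ih hs]
    · rw [expMagnus_at_zero]
      exact neg_eq_zero.2 intervalIntegral.integral_same

/-- The formal series `-∑ εⁿ ρ(Mₙ(A))`. -/
def logSeries (ρ : 𝔤 →ₗ[ℝ] 𝔸) (A : Form1 𝔤) : PowerSeries 𝔸 :=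
  PowerSeries.mk fun n => -ρ (magnusLog A n)

theorem repSeries_magnusSeries_one (A : Form1 𝔤) :
    repSeries ρ (magnusSeries (-A) 1) = logSeries ρ A := by
  ext n
  rw [coeff_repSeries, logSeries, PowerSeries.coeff_mk, magnusLog_eq, map_neg, neg_neg,
    evalOne_apply, magnusSeries]

theorem coeff_zero_logSeries (A : Form1 𝔤) : PowerSeries.coeff 0 (logSeries ρ A) = 0 := by
  rw [logSeries, PowerSeries.coeff_mk, magnusLog_zero, map_zero, neg_zero]

/-- The holonomy is the exponential of the Magnus series. -/
theorem holTerm_one_eq (hρ : IsLieRep ρ) (A : Form1 𝔤) (n : ℕ) :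
    holTerm ρ A n 1 = tot (fun k m => PowerSeries.coeff m (expTerm (logSeries ρ A) k)) n := by
  rw [holTerm_eq_expMagnus hρ A n (right_mem_Icc.2 zero_le_one), expMagnus,
    repSeries_magnusSeries_one]

theorem rep_magnusLog (hρ : IsLieRep ρ) (A : Form1 𝔤) (n : ℕ) :
    ρ (magnusLog A n) = -logCoeff (holSeries ρ A) n := by
  rw [logCoeff, sum_log_eq_of_exp (u := holSeries ρ A) (coeff_zero_logSeries A)
    (fun m => (PowerSeries.coeff_mk _ _).trans (holTerm_one_eq hρ A m)), logSeries,
    PowerSeries.coeff_mk, neg_neg]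

end Holonomy

/-! ### The formal flow -/

section ODE

variable {F : Type*} [NormedAddCommGroup F] [NormedSpace ℝ F]

/-- Uniqueness for ordinary differential equations on `[0, ∞)` whose right-hand side is Lipschitz
on bounded sets. -/
theorem eqOn_Ici_of_ode {v : ℝ → F → F} {f g : ℝ → F}
    (hv : ∀ T R : ℝ, ∃ K : NNReal, ∀ t ∈ Icc 0 T, LipschitzOnWith K (v t) (Metric.closedBall 0 R))
    (hf : ∀ t, 0 ≤ t → HasDerivWithinAt f (v t (f t)) (Ici 0) t)
    (hg : ∀ t, 0 ≤ t → HasDerivWithinAt g (v t (g t)) (Ici 0) t) (h0 : f 0 = g 0) :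
    EqOn f g (Ici 0) := by
  intro T hT
  have hcf : ContinuousOn f (Icc 0 T) := fun t ht =>
    (hf t ht.1).continuousWithinAt.mono Icc_subset_Ici_self
  have hcg : ContinuousOn g (Icc 0 T) := fun t ht =>
    (hg t ht.1).continuousWithinAt.mono Icc_subset_Ici_self
  obtain ⟨R₁, h₁⟩ := isCompact_Icc.exists_bound_of_continuousOn hcf
  obtain ⟨R₂, h₂⟩ := isCompact_Icc.exists_bound_of_continuousOn hcg
  obtain ⟨K, hK⟩ := hv T (max R₁ R₂)
  refine ODE_solution_unique_of_mem_Icc_right (v := v) (K := K)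
    (s := fun _ => Metric.closedBall 0 (max R₁ R₂)) (fun t ht => hK t (Ico_subset_Icc_self ht))
    hcf (fun t ht => (hf t ht.1).mono (Ici_subset_Ici.2 ht.1)) ?_
    hcg (fun t ht => (hg t ht.1).mono (Ici_subset_Ici.2 ht.1)) ?_ h0 ⟨hT, le_rfl⟩
  · intro t ht
    rw [mem_closedBall_zero_iff]
    exact (h₁ t (Ico_subset_Icc_self ht)).trans (le_max_left _ _)
  · intro t ht
    rw [mem_closedBall_zero_iff]
    exact (h₂ t (Ico_subset_Icc_self ht)).trans (le_max_right _ _)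

end ODE

/-! ### Duhamel's formula for the linearized flow -/

section Duhamel

variable {𝔤 : Type u} [NormedLieRing 𝔤] [NormedRealLieAlgebra 𝔤] [FiniteDimensional ℝ 𝔤]

/-- The solution of `x' = -(1 - ιπ) x - S` with initial value `x₀`. -/
def duhamel (x₀ : Form1 𝔤) (S : ℝ → Form1 𝔤) (T : ℝ) : Form1 𝔤 :=
  Real.exp (-T) • (perpL 𝔤 x₀ - ∫ s in (0 : ℝ)..T, Real.exp s • perpL 𝔤 (S s))
    + (incl (proj x₀) - ∫ s in (0 : ℝ)..T, incl (proj (S s)))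

variable {x₀ : Form1 𝔤} {S : ℝ → Form1 𝔤}

theorem duhamel_zero (x₀ : Form1 𝔤) (S : ℝ → Form1 𝔤) : duhamel x₀ S 0 = x₀ := by
  simp [duhamel, perpL_apply]

theorem continuous_exp_smul_perp (hS : Continuous S) :
    Continuous fun s => Real.exp s • perpL 𝔤 (S s) :=
  Real.continuous_exp.smul ((perpL 𝔤).continuous.comp hS)

theorem continuous_incl_proj (hS : Continuous S) : Continuous fun s => incl (proj (S s)) :=
  (inclL 𝔤).continuous.comp ((projL 𝔤).continuous.comp hS)

theorem perpL_duhamel (hS : Continuous S) (T : ℝ) :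
    perpL 𝔤 (duhamel x₀ S T)
      = Real.exp (-T) • (perpL 𝔤 x₀ - ∫ s in (0 : ℝ)..T, Real.exp s • perpL 𝔤 (S s)) := by
  have h1 := (perpL 𝔤).intervalIntegral_comp_comm
    ((continuous_exp_smul_perp hS).intervalIntegrable (μ := volume) 0 T)
  have h2 := (perpL 𝔤).intervalIntegral_comp_comm
    ((continuous_incl_proj hS).intervalIntegrable (μ := volume) 0 T)
  simp only [map_smul, perpL_perpL] at h1
  simp only [perpL_incl, intervalIntegral.integral_zero] at h2
  rw [duhamel, map_add, map_smul, map_sub, map_sub, perpL_perpL, perpL_incl, ← h1, ← h2, sub_zero,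
    add_zero]

theorem proj_duhamel (hS : Continuous S) (T : ℝ) :
    proj (duhamel x₀ S T) = proj x₀ - ∫ s in (0 : ℝ)..T, proj (S s) := by
  have h1 := (projL 𝔤).intervalIntegral_comp_comm
    ((continuous_exp_smul_perp hS).intervalIntegrable (μ := volume) 0 T)
  have h2 := (projL 𝔤).intervalIntegral_comp_comm
    ((continuous_incl_proj hS).intervalIntegrable (μ := volume) 0 T)
  simp only [map_smul, projL_apply, proj_perpL, smul_zero, intervalIntegral.integral_zero] at h1
  simp only [projL_apply, proj_incl] at h2
  rw [← projL_apply, duhamel, map_add, map_smul, map_sub, map_sub]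
  simp only [projL_apply]
  rw [← h1, ← h2, proj_perpL, proj_incl, sub_zero, smul_zero, zero_add]

theorem hasDerivAt_duhamel (hS : Continuous S) (T : ℝ) :
    HasDerivAt (duhamel x₀ S) (-(perpL 𝔤 (duhamel x₀ S T) + S T)) T := by
  have c1 := continuous_exp_smul_perp hS
  have c2 := continuous_incl_proj hS
  have h1 := intervalIntegral.integral_hasDerivAt_right (c1.intervalIntegrable (μ := volume) 0 T)
    (c1.stronglyMeasurableAtFilter _ _) c1.continuousAt
  have h2 := intervalIntegral.integral_hasDerivAt_right (c2.intervalIntegrable (μ := volume) 0 T)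
    (c2.stronglyMeasurableAtFilter _ _) c2.continuousAt
  have hexp : HasDerivAt (fun s : ℝ => Real.exp (-s)) (-Real.exp (-T)) T := by
    simpa using (hasDerivAt_neg T).exp
  have h := (hexp.smul (h1.const_sub (perpL 𝔤 x₀))).add (h2.const_sub (incl (proj x₀)))
  refine h.congr_deriv ?_
  rw [perpL_duhamel hS, smul_neg, smul_smul, ← Real.exp_add, neg_add_cancel, Real.exp_zero,
    one_smul, perpL_apply (S T), neg_smul]
  abel

theorem continuous_duhamel (hS : Continuous S) : Continuous (duhamel x₀ S) :=
  continuous_iff_continuousAt.2 fun T => (hasDerivAt_duhamel hS T).continuousAt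

theorem integral_exp_half (T : ℝ) :
    ∫ s in (0 : ℝ)..T, Real.exp (s / 2) = 2 * (Real.exp (T / 2) - 1) := by
  have h : ∀ s ∈ uIcc 0 T, HasDerivAt (fun s : ℝ => 2 * Real.exp (s / 2)) (Real.exp (s / 2)) s := by
    intro s _
    have := (((hasDerivAt_id s).div_const 2).exp).const_mul 2
    refine this.congr_deriv ?_
    simp only [id_eq]
    ring
  rw [intervalIntegral.integral_eq_sub_of_hasDerivAt h
    ((by fun_prop : Continuous fun s : ℝ => Real.exp (s / 2)).intervalIntegrable _ _)]
  simp
  ring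

theorem integral_exp_neg_half (T : ℝ) :
    ∫ s in (0 : ℝ)..T, Real.exp (-(s / 2)) = 2 * (1 - Real.exp (-(T / 2))) := by
  have h : ∀ s ∈ uIcc 0 T,
      HasDerivAt (fun s : ℝ => -2 * Real.exp (-(s / 2))) (Real.exp (-(s / 2))) s := by
    intro s _
    have := ((((hasDerivAt_id s).div_const 2).fun_neg).exp).const_mul (-2)
    refine this.congr_deriv ?_
    simp only [id_eq]
    ring
  rw [intervalIntegral.integral_eq_sub_of_hasDerivAt h
    ((by fun_prop : Continuous fun s : ℝ => Real.exp (-(s / 2))).intervalIntegrable _ _)]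
  simp
  ring

variable {B : ℝ}

/-- The rate `1/2` reproduces itself: convolving `e^{-s/2}` with `e^{-(T-s)}` gives a multiple of
`e^{-T/2}`, whereas rate `1` would produce a factor `T`. The constant `4` is the bound `2` for
`perpL` times the `2` from integrating `e^{s/2}`. -/
theorem norm_perpL_duhamel_le (hS : Continuous S) (hB : 0 ≤ B)
    (h : ∀ s, 0 ≤ s → ‖S s‖ ≤ B * Real.exp (-(s / 2))) {T : ℝ} (hT : 0 ≤ T) :
    ‖perpL 𝔤 (duhamel x₀ S T)‖ ≤ (2 * ‖x₀‖ + 4 * B) * Real.exp (-(T / 2)) := by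
  have h1 : ‖∫ s in (0 : ℝ)..T, Real.exp s • perpL 𝔤 (S s)‖
      ≤ ∫ s in (0 : ℝ)..T, 2 * B * Real.exp (s / 2) := by
    refine intervalIntegral.norm_integral_le_of_norm_le hT (ae_of_all _ fun s hs => ?_)
      ((by fun_prop : Continuous fun s : ℝ => 2 * B * Real.exp (s / 2)).intervalIntegrable _ _)
    rw [norm_smul, Real.norm_of_nonneg (Real.exp_pos _).le]
    calc Real.exp s * ‖perpL 𝔤 (S s)‖
        ≤ Real.exp s * (2 * (B * Real.exp (-(s / 2)))) := by
          gcongr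
          exact (norm_perpL_le _).trans (by linarith [h s hs.1.le])
      _ = 2 * B * (Real.exp s * Real.exp (-(s / 2))) := by ring
      _ = 2 * B * Real.exp (s / 2) := by
          rw [← Real.exp_add]; congr 2; ring
  rw [intervalIntegral.integral_const_mul, integral_exp_half] at h1
  rw [perpL_duhamel hS, norm_smul, Real.norm_of_nonneg (Real.exp_pos _).le]
  have hx := norm_perpL_le x₀
  have hE : Real.exp (-T) * Real.exp (T / 2) = Real.exp (-(T / 2)) := by
    rw [← Real.exp_add]; congr 1; ring
  have hE1 : 1 ≤ Real.exp (T / 2) := Real.one_le_exp (by linarith)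
  calc Real.exp (-T) * ‖perpL 𝔤 x₀ - ∫ s in (0 : ℝ)..T, Real.exp s • perpL 𝔤 (S s)‖
      ≤ Real.exp (-T) * ((2 * ‖x₀‖ + 4 * B) * Real.exp (T / 2)) := by
        gcongr
        refine (norm_sub_le _ _).trans ?_
        nlinarith [norm_nonneg x₀]
    _ = (2 * ‖x₀‖ + 4 * B) * Real.exp (-(T / 2)) := by rw [← hE]; ring

/-- The part with zero integral contributes `2‖x₀‖ + 4B` and the constant part `‖x₀‖ + 2B`. -/
theorem norm_duhamel_le (hS : Continuous S) (hB : 0 ≤ B)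
    (h : ∀ s, 0 ≤ s → ‖S s‖ ≤ B * Real.exp (-(s / 2))) {T : ℝ} (hT : 0 ≤ T) :
    ‖duhamel x₀ S T‖ ≤ 3 * ‖x₀‖ + 6 * B := by
  have h1 : ‖∫ s in (0 : ℝ)..T, proj (S s)‖ ≤ ∫ s in (0 : ℝ)..T, B * Real.exp (-(s / 2)) := by
    refine intervalIntegral.norm_integral_le_of_norm_le hT (ae_of_all _ fun s hs => ?_)
      ((by fun_prop : Continuous fun s : ℝ => B * Real.exp (-(s / 2))).intervalIntegrable _ _)
    exact (norm_proj_le _).trans (h s hs.1.le)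
  rw [intervalIntegral.integral_const_mul, integral_exp_neg_half] at h1
  have h2 : duhamel x₀ S T = perpL 𝔤 (duhamel x₀ S T) + incl (proj (duhamel x₀ S T)) := by
    rw [perpL_apply, sub_add_cancel]
  have h3 := norm_perpL_duhamel_le (x₀ := x₀) hS hB h hT
  have h4 : ‖incl (proj (duhamel x₀ S T))‖ ≤ ‖x₀‖ + 2 * B := by
    refine (norm_incl_le _).trans ?_
    rw [proj_duhamel hS]
    refine (norm_sub_le _ _).trans ?_
    have := Real.exp_pos (-(T / 2))
    nlinarith [norm_proj_le x₀]
  have h5 : Real.exp (-(T / 2)) ≤ 1 := Real.exp_le_one_iff.2 (by linarith)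
  rw [h2]
  refine (norm_add_le _ _).trans ?_
  nlinarith [norm_nonneg x₀]

theorem tendsto_proj_duhamel (hS : Continuous S)
    (h : ∀ s, 0 ≤ s → ‖S s‖ ≤ B * Real.exp (-(s / 2))) :
    ∃ L, Tendsto (fun T => proj (duhamel x₀ S T)) atTop (𝓝 L) := by
  have hI : IntegrableOn (fun s => proj (S s)) (Ioi 0) := by
    have h1 : IntegrableOn (fun s : ℝ => B * Real.exp (-(s / 2))) (Ioi 0) := by
      have := (integrableOn_exp_mul_Ioi (a := -(1 / 2)) (by norm_num) 0).const_mul B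
      refine IntegrableOn.congr_fun this (fun s _ => ?_) measurableSet_Ioi
      congr 2
      ring
    refine Integrable.mono' h1 ((projL 𝔤).continuous.comp hS).aestronglyMeasurable ?_
    refine (ae_restrict_mem measurableSet_Ioi).mono fun s hs => ?_
    exact (norm_proj_le _).trans (h s (le_of_lt hs))
  refine ⟨proj x₀ - ∫ s in Ioi 0, proj (S s), ?_⟩
  simp only [proj_duhamel hS]
  exact (intervalIntegral_tendsto_integral_Ioi 0 hI tendsto_id).const_sub _

end Duhamel

/-! ### Existence, uniqueness and bounds for the formal flow -/

section FormalFlow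

variable {𝔤 : Type u} [NormedLieRing 𝔤] [NormedRealLieAlgebra 𝔤] [FiniteDimensional ℝ 𝔤]

/-- The coefficients of the formal flow. -/
def flowTerm (A : Form1 𝔤) (n : ℕ) : ℝ → Form1 𝔤 :=
  duhamel (if n = 1 then A else 0) fun s => ∑ i : Fin n, ∑ j : Fin n,
    if (i : ℕ) + j = n then brL 𝔤 (flowTerm A i s) (kappaL 𝔤 (flowTerm A j s)) else 0
  termination_by n

/-- The quadratic source term in the equation for `flowTerm A n`. -/
def flowSource (A : Form1 𝔤) (n : ℕ) (s : ℝ) : Form1 𝔤 :=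
  ∑ i ∈ Finset.range n, ∑ j ∈ Finset.range n,
    if i + j = n then brL 𝔤 (flowTerm A i s) (kappaL 𝔤 (flowTerm A j s)) else 0

theorem flowTerm_eq (A : Form1 𝔤) (n : ℕ) :
    flowTerm A n = duhamel (if n = 1 then A else 0) (flowSource A n) := by
  rw [flowTerm]
  congr 1
  funext s
  simp only [flowSource, Finset.sum_range]

theorem continuous_brL_kappaL {a b : ℝ → Form1 𝔤} (ha : Continuous a) (hb : Continuous b) :
    Continuous fun s => brL 𝔤 (a s) (kappaL 𝔤 (b s)) :=
  ((brL 𝔤).continuous.comp ha).clm_apply ((kappaL 𝔤).continuous.comp hb)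

theorem continuous_flowSource_of_lt (A : Form1 𝔤) (n : ℕ)
    (h : ∀ k < n, Continuous (flowTerm A k)) : Continuous (flowSource A n) := by
  refine continuous_finsetSum _ fun i hi => continuous_finsetSum _ fun j hj => ?_
  split_ifs
  · exact continuous_brL_kappaL (h i (Finset.mem_range.1 hi)) (h j (Finset.mem_range.1 hj))
  · exact continuous_const

theorem continuous_flowTerm (A : Form1 𝔤) (n : ℕ) : Continuous (flowTerm A n) := by
  induction n using Nat.strong_induction_on with
  | _ n ih =>
    rw [flowTerm_eq]
    exact continuous_duhamel (continuous_flowSource_of_lt A n ih)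

theorem continuous_flowSource (A : Form1 𝔤) (n : ℕ) : Continuous (flowSource A n) :=
  continuous_flowSource_of_lt A n fun k _ => continuous_flowTerm A k

theorem hasDerivAt_flowTerm (A : Form1 𝔤) (n : ℕ) (T : ℝ) :
    HasDerivAt (flowTerm A n) (-(perpL 𝔤 (flowTerm A n T) + flowSource A n T)) T := by
  have := hasDerivAt_duhamel (x₀ := if n = 1 then A else 0) (continuous_flowSource A n) T
  rwa [← flowTerm_eq] at this

theorem flowTerm_at_zero (A : Form1 𝔤) (n : ℕ) : flowTerm A n 0 = if n = 1 then A else 0 := by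
  rw [flowTerm_eq, duhamel_zero]

theorem flowTerm_zero (A : Form1 𝔤) (T : ℝ) : flowTerm A 0 T = 0 := by
  have h : proj (0 : Form1 𝔤) = 0 := map_zero (projL 𝔤)
  have h' : incl (0 : 𝔤) = 0 := rfl
  rw [flowTerm_eq]
  simp [duhamel, flowSource, h, h']

/-- Applied with vanishing zeroth coefficient, this removes the pairs `(0, n)` and `(n, 0)`. The
quadratic term of order `n` then involves only lower orders, and the recursion for the flow is well
founded. -/
theorem sum_antidiagonal_eq_sum_range {M : Type*} [AddCommMonoid M] {f : ℕ → ℕ → M} {n : ℕ}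
    (h1 : f 0 n = 0) (h2 : f n 0 = 0) :
    ∑ p ∈ antidiagonal n, f p.1 p.2
      = ∑ i ∈ Finset.range n, ∑ j ∈ Finset.range n, if i + j = n then f i j else 0 := by
  rw [← Finset.sum_product', ← Finset.sum_filter]
  refine (Finset.sum_subset (fun p hp => ?_) fun p hp hp' => ?_).symm
  · simp only [Finset.mem_filter] at hp
    exact Finset.HasAntidiagonal.mem_antidiagonal.2 hp.2
  · have hp1 := Finset.HasAntidiagonal.mem_antidiagonal.1 hp
    simp only [Finset.mem_filter, Finset.mem_product, Finset.mem_range] at hp'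
    obtain ⟨i, j⟩ := p
    simp only at hp1 hp' ⊢
    rcases Nat.eq_zero_or_pos i with h | h
    · obtain rfl : j = n := by omega
      rw [h, h1]
    · obtain rfl : j = 0 := by omega
      obtain rfl : i = n := by omega
      exact h2

theorem sum_bracket_kappa_eq {a : ℕ → ℝ → Form1 𝔤} {n : ℕ} {T : ℝ} (h0 : a 0 T = 0) :
    ∑ p ∈ antidiagonal n, bracket (a p.1 T) (kappa (a p.2 T))
      = ∑ i ∈ Finset.range n, ∑ j ∈ Finset.range n,
        if i + j = n then brL 𝔤 (a i T) (kappaL 𝔤 (a j T)) else 0 := by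
  simp only [bracket_kappa]
  refine sum_antidiagonal_eq_sum_range (f := fun i j => brL 𝔤 (a i T) (kappaL 𝔤 (a j T))) ?_ ?_
  · simp only [h0]
    rw [map_zero, zero_apply]
  · simp only [h0, map_zero]

theorem isFormalFlow_flowTerm (A : Form1 𝔤) : IsFormalFlow A (flowTerm A) where
  init := flowTerm_at_zero A
  flow n T _ := by
    rw [sum_bracket_kappa_eq (flowTerm_zero A T), extD_kappa]
    exact (hasDerivAt_flowTerm A n T).hasDerivWithinAt

theorem lipschitzOnWith_hamField (R : ℝ) :
    ∃ K : NNReal, LipschitzOnWith K (fun x : Form1 𝔤 => -hamField x) (Metric.closedBall 0 R) := by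
  refine ⟨Real.toNNReal (2 + 4 * ‖lieL 𝔤‖ * R), LipschitzOnWith.of_dist_le_mul fun x hx y hy => ?_⟩
  rw [mem_closedBall_zero_iff] at hx hy
  have hR : 0 ≤ R := (norm_nonneg _).trans hx
  rw [Real.coe_toNNReal _ (by positivity), dist_eq_norm, dist_eq_norm, hamField_eq, hamField_eq]
  have e : -(perpL 𝔤 x + brL 𝔤 x (kappaL 𝔤 x)) - -(perpL 𝔤 y + brL 𝔤 y (kappaL 𝔤 y))
      = -(perpL 𝔤 (x - y) + (brL 𝔤 (x - y) (kappaL 𝔤 x) + brL 𝔤 y (kappaL 𝔤 (x - y)))) := by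
    rw [map_sub (perpL 𝔤), map_sub (brL 𝔤), map_sub (kappaL 𝔤), map_sub (brL 𝔤 y), sub_apply]
    abel
  have hk : ∀ z : Form1 𝔤, ‖kappaL 𝔤 z‖ ≤ 2 * ‖z‖ := fun z =>
    (norm_kappaL_le z).trans (norm_perpL_le z)
  have h1 := norm_brL_le (x - y) (kappaL 𝔤 x)
  have h2 := norm_brL_le y (kappaL 𝔤 (x - y))
  have h3 : ‖lieL 𝔤‖ * ‖x - y‖ * ‖kappaL 𝔤 x‖ ≤ ‖lieL 𝔤‖ * ‖x - y‖ * (2 * R) := by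
    gcongr; exact (hk x).trans (by linarith)
  have h4 : ‖lieL 𝔤‖ * ‖y‖ * ‖kappaL 𝔤 (x - y)‖ ≤ ‖lieL 𝔤‖ * R * (2 * ‖x - y‖) := by
    gcongr; exact hk _
  rw [e, norm_neg]
  refine (norm_add_le _ _).trans ?_
  refine (add_le_add (norm_perpL_le _) (norm_add_le _ _)).trans ?_
  nlinarith

/-- Uniqueness of the flow. -/
theorem IsFlow.eqOn {A : Form1 𝔤} {a b : ℝ → Form1 𝔤} (ha : IsFlow A a) (hb : IsFlow A b) :
    EqOn b a (Ici 0) :=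
  eqOn_Ici_of_ode (v := fun _ x => -hamField x)
    (fun _ R => let ⟨K, hK⟩ := lipschitzOnWith_hamField R; ⟨K, fun _ _ => hK⟩)
    hb.flow ha.flow (hb.init.trans ha.init.symm)

/-- Uniqueness of the formal flow. -/
theorem IsFormalFlow.eqOn {A : Form1 𝔤} {b : ℕ → ℝ → Form1 𝔤} (hb : IsFormalFlow A b) (n : ℕ) :
    EqOn (b n) (flowTerm A n) (Ici 0) := by
  -- The zeroth order is an honest flow line starting at `0`, so nonlinear uniqueness applies. Once
  -- it is known to vanish, each higher order solves a linear equation with a source of lower order.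
  have hb0 : EqOn (b 0) (flowTerm A 0) (Ici 0) := by
    have h : ∀ a : ℕ → ℝ → Form1 𝔤, IsFormalFlow A a → IsFlow 0 (a 0) := by
      intro a ha
      refine ⟨by simpa using ha.init 0, fun T hT => ?_⟩
      have := ha.flow 0 T hT
      rwa [Finset.Nat.antidiagonal_zero, Finset.sum_singleton] at this
    exact (h _ (isFormalFlow_flowTerm A)).eqOn (h _ hb)
  induction n using Nat.strong_induction_on with
  | _ n ih =>
    rcases Nat.eq_zero_or_pos n with rfl | hn
    · exact hb0
    refine eqOn_Ici_of_ode (v := fun T x => -(perpL 𝔤 x + flowSource A n T)) (fun T R => ⟨2, ?_⟩)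
      (fun T hT => ?_) (fun T _ => (hasDerivAt_flowTerm A n T).hasDerivWithinAt) ?_
    · intro t _
      refine LipschitzOnWith.of_dist_le_mul fun x _ y _ => ?_
      rw [dist_eq_norm, dist_eq_norm]
      have e : -(perpL 𝔤 x + flowSource A n t) - -(perpL 𝔤 y + flowSource A n t)
          = -perpL 𝔤 (x - y) := by
        rw [map_sub]; abel
      rw [e, norm_neg]
      exact norm_perpL_le _
    · refine (hb.flow n T hT).congr_deriv ?_
      have h0 : b 0 T = 0 := (hb0 hT).trans (flowTerm_zero A T)
      rw [sum_bracket_kappa_eq h0, extD_kappa, flowSource]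
      congr 2
      refine Finset.sum_congr rfl fun i hi => Finset.sum_congr rfl fun j hj => ?_
      rw [ih i (Finset.mem_range.1 hi) hT, ih j (Finset.mem_range.1 hj) hT]
    · rw [hb.init, flowTerm_at_zero]

/-! ### Bounds on the formal flow -/

/-- The majorant of the formal flow: `mₙ = 3 x δₙ₁ + 6 b ∑_{i+j=n} mᵢ mⱼ`. -/
def flowMaj (b x : ℝ) (n : ℕ) : ℝ :=
  3 * (if n = 1 then x else 0) + 6 * (b * ∑ i : Fin n, ∑ j : Fin n,
    if (i : ℕ) + j = n then flowMaj b x i * flowMaj b x j else 0)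
  termination_by n

variable {b x : ℝ}

theorem flowMaj_eq (b x : ℝ) (n : ℕ) :
    flowMaj b x n = 3 * (if n = 1 then x else 0)
      + 6 * (b * ∑ i ∈ Finset.range n, ∑ j ∈ Finset.range n,
        if i + j = n then flowMaj b x i * flowMaj b x j else 0) := by
  rw [flowMaj]
  simp only [Finset.sum_range]

theorem flowMaj_nonneg (hb : 0 ≤ b) (hx : 0 ≤ x) (n : ℕ) : 0 ≤ flowMaj b x n := by
  induction n using Nat.strong_induction_on with
  | _ n ih =>
    rw [flowMaj_eq]
    have h1 : (0 : ℝ) ≤ if n = 1 then x else 0 := by split_ifs <;> simp [hx]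
    have h2 : 0 ≤ ∑ i ∈ Finset.range n, ∑ j ∈ Finset.range n,
        if i + j = n then flowMaj b x i * flowMaj b x j else 0 := by
      refine Finset.sum_nonneg fun i hi => Finset.sum_nonneg fun j hj => ?_
      split_ifs
      · exact mul_nonneg (ih i (Finset.mem_range.1 hi)) (ih j (Finset.mem_range.1 hj))
      · exact le_rfl
    positivity

/-- The contribution of the quadratic terms to the partial sums of the majorant. -/
theorem sum_flowMaj_le (hb : 0 ≤ b) (hx : 0 ≤ x) (N : ℕ) :
    ∑ n ∈ Finset.range (N + 1), |flowMaj b x n - 3 * (if n = 1 then x else 0)|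
      ≤ 6 * (b * (∑ n ∈ Finset.range N, flowMaj b x n) ^ 2) := by
  have hm := flowMaj_nonneg hb hx
  have h0 : ∀ n, |flowMaj b x n - 3 * (if n = 1 then x else 0)|
      = 6 * (b * ∑ i ∈ Finset.range n, ∑ j ∈ Finset.range n,
        if i + j = n then flowMaj b x i * flowMaj b x j else 0) := by
    intro n
    rw [flowMaj_eq b x n, add_sub_cancel_left, abs_of_nonneg]
    refine mul_nonneg (by norm_num) (mul_nonneg hb ?_)
    refine Finset.sum_nonneg fun i _ => Finset.sum_nonneg fun j _ => ?_
    split_ifs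
    · exact mul_nonneg (hm i) (hm j)
    · exact le_rfl
  simp only [h0]
  rw [← Finset.mul_sum, ← Finset.mul_sum]
  gcongr
  have hnn : ∀ n i j, (0 : ℝ) ≤ if i + j = n then flowMaj b x i * flowMaj b x j else 0 := by
    intro n i j
    split_ifs
    · exact mul_nonneg (hm i) (hm j)
    · exact le_rfl
  -- Indices `i, j < n ≤ N` lie in `range N`, and each pair `(i, j)` occurs for at most one `n`, so
  -- the total is at most the full square.
  calc ∑ n ∈ Finset.range (N + 1), ∑ i ∈ Finset.range n, ∑ j ∈ Finset.range n,
        (if i + j = n then flowMaj b x i * flowMaj b x j else 0)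
      ≤ ∑ n ∈ Finset.range (N + 1), ∑ i ∈ Finset.range N, ∑ j ∈ Finset.range N,
        (if i + j = n then flowMaj b x i * flowMaj b x j else 0) := by
        refine Finset.sum_le_sum fun n hn => ?_
        have hs : Finset.range n ⊆ Finset.range N :=
          Finset.range_subset_range.2 (Nat.lt_succ_iff.1 (Finset.mem_range.1 hn))
        refine (Finset.sum_le_sum fun i _ => Finset.sum_le_sum_of_subset_of_nonneg hs
          fun j _ _ => hnn n i j).trans ?_
        exact Finset.sum_le_sum_of_subset_of_nonneg hs
          fun i _ _ => Finset.sum_nonneg fun j _ => hnn n i j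
    _ = ∑ i ∈ Finset.range N, ∑ j ∈ Finset.range N, ∑ n ∈ Finset.range (N + 1),
        (if i + j = n then flowMaj b x i * flowMaj b x j else 0) := by
        rw [Finset.sum_comm]
        exact Finset.sum_congr rfl fun i _ => Finset.sum_comm
    _ ≤ ∑ i ∈ Finset.range N, ∑ j ∈ Finset.range N, flowMaj b x i * flowMaj b x j := by
        refine Finset.sum_le_sum fun i _ => Finset.sum_le_sum fun j _ => ?_
        rw [Finset.sum_ite_eq]
        split_ifs
        · exact le_rfl
        · exact mul_nonneg (hm i) (hm j)
    _ = (∑ n ∈ Finset.range N, flowMaj b x n) ^ 2 := by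
        rw [sq, Finset.sum_mul_sum]

/-- The partial sums satisfy `s_{N+1} ≤ 3x + 6 b s_N²`. The bound `s ≤ 6x` is preserved when `6 b
(6x)² ≤ 3x`, which follows from `72 b x ≤ 1`. -/
theorem sum_flowMaj_le_of_small (hb : 0 ≤ b) (hx : 0 ≤ x) (h : 72 * b * x ≤ 1) (N : ℕ) :
    ∑ n ∈ Finset.range N, flowMaj b x n ≤ 6 * x := by
  induction N with
  | zero => simpa using hx
  | succ N ih =>
    have h1 := sum_flowMaj_le hb hx N
    have h2 : ∑ n ∈ Finset.range (N + 1), flowMaj b x n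
        ≤ ∑ n ∈ Finset.range (N + 1), |flowMaj b x n - 3 * (if n = 1 then x else 0)|
          + ∑ n ∈ Finset.range (N + 1), 3 * (if n = 1 then x else 0) := by
      rw [← Finset.sum_add_distrib]
      refine Finset.sum_le_sum fun n _ => ?_
      linarith [le_abs_self (flowMaj b x n - 3 * (if n = 1 then x else 0))]
    have h3 : ∑ n ∈ Finset.range (N + 1), 3 * (if n = 1 then x else 0) ≤ 3 * x := by
      rw [← Finset.mul_sum, Finset.sum_ite_eq']
      split_ifs <;> linarith
    have h4 : 0 ≤ ∑ n ∈ Finset.range N, flowMaj b x n :=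
      Finset.sum_nonneg fun n _ => flowMaj_nonneg hb hx n
    have h5 : (∑ n ∈ Finset.range N, flowMaj b x n) ^ 2 ≤ (6 * x) ^ 2 :=
      pow_le_pow_left₀ h4 ih 2
    have h6 : b * (∑ n ∈ Finset.range N, flowMaj b x n) ^ 2 ≤ b * (6 * x) ^ 2 := by gcongr
    nlinarith

theorem summable_flowMaj (hb : 0 ≤ b) (hx : 0 ≤ x) (h : 72 * b * x ≤ 1) :
    Summable (flowMaj b x) :=
  summable_of_sum_range_le (flowMaj_nonneg hb hx) (sum_flowMaj_le_of_small hb hx h)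

/-- The induction step in the bounds for `flowTerm`. -/
theorem flowSource_bound (A : Form1 𝔤) (n : ℕ)
    (ih : ∀ k < n, ∀ T, 0 ≤ T → ‖flowTerm A k T‖ ≤ flowMaj ‖lieL 𝔤‖ ‖A‖ k
      ∧ ‖perpL 𝔤 (flowTerm A k T)‖ ≤ flowMaj ‖lieL 𝔤‖ ‖A‖ k * Real.exp (-(T / 2))) :
    ∃ B, 0 ≤ B ∧ flowMaj ‖lieL 𝔤‖ ‖A‖ n = 3 * ‖(if n = 1 then A else 0 : Form1 𝔤)‖ + 6 * B
      ∧ ∀ s, 0 ≤ s → ‖flowSource A n s‖ ≤ B * Real.exp (-(s / 2)) := by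
  have hm := flowMaj_nonneg (norm_nonneg (lieL 𝔤)) (norm_nonneg A)
  refine ⟨‖lieL 𝔤‖ * ∑ i ∈ Finset.range n, ∑ j ∈ Finset.range n, if i + j = n then
    flowMaj ‖lieL 𝔤‖ ‖A‖ i * flowMaj ‖lieL 𝔤‖ ‖A‖ j else 0, ?_, ?_, fun s hs => ?_⟩
  rotate_left
  · rw [flowMaj_eq]
    congr 2
    split_ifs <;> simp
  · rw [flowSource, mul_assoc, Finset.sum_mul, Finset.mul_sum]
    refine (norm_sum_le _ _).trans (Finset.sum_le_sum fun i hi => ?_)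
    rw [Finset.sum_mul, Finset.mul_sum]
    refine (norm_sum_le _ _).trans (Finset.sum_le_sum fun j hj => ?_)
    split_ifs
    · have hi' := ih i (Finset.mem_range.1 hi) s hs
      have hj' := ih j (Finset.mem_range.1 hj) s hs
      calc ‖brL 𝔤 (flowTerm A i s) (kappaL 𝔤 (flowTerm A j s))‖
          ≤ ‖lieL 𝔤‖ * ‖flowTerm A i s‖ * ‖kappaL 𝔤 (flowTerm A j s)‖ := norm_brL_le _ _
        _ ≤ ‖lieL 𝔤‖ * flowMaj ‖lieL 𝔤‖ ‖A‖ i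
            * (flowMaj ‖lieL 𝔤‖ ‖A‖ j * Real.exp (-(s / 2))) := by
            gcongr
            · exact mul_nonneg (norm_nonneg (lieL 𝔤)) (hm i)
            · exact hi'.1
            · exact (norm_kappaL_le _).trans hj'.2
        _ = _ := by ring
    · simp
  · refine mul_nonneg (norm_nonneg (lieL 𝔤)) ?_
    refine Finset.sum_nonneg fun i _ => Finset.sum_nonneg fun j _ => ?_
    split_ifs
    · exact mul_nonneg (hm i) (hm j)
    · exact le_rfl

/-- The two estimates must be carried together: the source is a bracket of a bounded factor with a
decaying one, and Duhamel's formula returns both bounds with the same majorant. -/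
theorem flowTerm_bounds (A : Form1 𝔤) (n : ℕ) {T : ℝ} (hT : 0 ≤ T) :
    ‖flowTerm A n T‖ ≤ flowMaj ‖lieL 𝔤‖ ‖A‖ n
      ∧ ‖perpL 𝔤 (flowTerm A n T)‖ ≤ flowMaj ‖lieL 𝔤‖ ‖A‖ n * Real.exp (-(T / 2)) := by
  induction n using Nat.strong_induction_on generalizing T with
  | _ n ih =>
    obtain ⟨B, hB, hmaj, hS⟩ := flowSource_bound A n fun k hk T hT => ih k hk hT
    rw [flowTerm_eq, hmaj]
    refine ⟨norm_duhamel_le (continuous_flowSource A n) hB hS hT, ?_⟩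
    refine (norm_perpL_duhamel_le (continuous_flowSource A n) hB hS hT).trans ?_
    gcongr <;> norm_num

theorem norm_flowSource_le (A : Form1 𝔤) (n : ℕ) {T : ℝ} (hT : 0 ≤ T) :
    ‖flowSource A n T‖ ≤ flowMaj ‖lieL 𝔤‖ ‖A‖ n * Real.exp (-(T / 2)) := by
  obtain ⟨B, hB, hmaj, hS⟩ := flowSource_bound A n fun k _ T hT => flowTerm_bounds A k hT
  refine (hS T hT).trans (mul_le_mul_of_nonneg_right ?_ (Real.exp_pos _).le)
  rw [hmaj]
  linarith [norm_nonneg (if n = 1 then A else 0 : Form1 𝔤)]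

theorem tendsto_proj_flowTerm (A : Form1 𝔤) (n : ℕ) :
    ∃ L, Tendsto (fun T => proj (flowTerm A n T)) atTop (𝓝 L) := by
  rw [flowTerm_eq]
  exact tendsto_proj_duhamel (continuous_flowSource A n) fun s hs => norm_flowSource_le A n hs

end FormalFlow

/-! ### The limit of the formal flow -/

section Homogeneous

variable {E F : Type*} [NormedAddCommGroup E] [NormedSpace ℝ E] [NormedAddCommGroup F]
  [NormedSpace ℝ F] {f : E → F} {n : ℕ}

theorem fderiv_smul_of_homogeneous (hf : Differentiable ℝ f)
    (hh : ∀ (c : ℝ) (x : E), f (c • x) = c ^ (n + 1) • f x) {c : ℝ} (hc : c ≠ 0) (x v : E) :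
    fderiv ℝ f (c • x) v = c ^ n • fderiv ℝ f x v := by
  have h1 : HasFDerivAt (fun x => f (c • x))
      ((fderiv ℝ f (c • x)).comp (c • ContinuousLinearMap.id ℝ E)) x :=
    (hf (c • x)).hasFDerivAt.comp x (c • ContinuousLinearMap.id ℝ E).hasFDerivAt
  have h2 : HasFDerivAt (fun x => f (c • x)) (c ^ (n + 1) • fderiv ℝ f x) x := by
    simp only [hh]
    exact (hf x).hasFDerivAt.const_smul (c ^ (n + 1))
  have h4 : c • fderiv ℝ f (c • x) v = c ^ (n + 1) • fderiv ℝ f x v := by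
    rw [← map_smul]
    exact DFunLike.congr_fun (h1.unique h2) v
  rw [pow_succ', mul_smul] at h4
  exact smul_right_injective _ hc h4

/-- The derivative of a homogeneous map of degree `n + 1` is of order `n` at zero. -/
theorem norm_fderiv_le_of_homogeneous (hf : ContDiff ℝ 1 f)
    (hh : ∀ (c : ℝ) (x : E), f (c • x) = c ^ (n + 1) • f x) (R : ℝ) :
    ∃ c, 0 ≤ c ∧ ∀ ε : ℝ, 0 < ε → ∀ x : E, ‖x‖ ≤ R → ∀ v,
      ‖fderiv ℝ f (ε • x) v‖ ≤ c * ε ^ n * ‖v‖ := by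
  have hcont : Continuous (fderiv ℝ f) := hf.continuous_fderiv one_ne_zero
  have hev : ∀ᶠ x in 𝓝 (0 : E), ‖fderiv ℝ f x‖ < ‖fderiv ℝ f 0‖ + 1 :=
    hcont.norm.continuousAt.eventually_lt continuousAt_const (lt_add_one _)
  obtain ⟨δ, hδ, hb⟩ := Metric.eventually_nhds_iff.1 hev
  -- The ball of radius `R` need not be compact. It is scaled by `σ` into a neighbourhood of zero
  -- where the derivative is bounded, and homogeneity transports the bound to `ε • x`.
  set σ := δ / (|R| + 1)
  have hσ : 0 < σ := by positivity
  refine ⟨(‖fderiv ℝ f 0‖ + 1) / σ ^ n, by positivity, fun ε hε x hxR v => ?_⟩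
  have hx : ‖fderiv ℝ f (σ • x)‖ < ‖fderiv ℝ f 0‖ + 1 := by
    refine hb ?_
    rw [dist_zero_right, norm_smul, Real.norm_of_nonneg hσ.le]
    calc σ * ‖x‖ < σ * (|R| + 1) := by
          gcongr; exact (hxR.trans (le_abs_self R)).trans_lt (lt_add_one _)
      _ = δ := by simp only [σ]; field_simp
  have e : ε • x = (ε / σ) • (σ • x) := by rw [smul_smul, div_mul_cancel₀ _ hσ.ne']
  rw [e, fderiv_smul_of_homogeneous (hf.differentiable one_ne_zero) hh (by positivity), norm_smul,
    norm_pow, Real.norm_of_nonneg (by positivity)]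
  calc (ε / σ) ^ n * ‖fderiv ℝ f (σ • x) v‖
      ≤ (ε / σ) ^ n * ((‖fderiv ℝ f 0‖ + 1) * ‖v‖) := by
        gcongr
        exact ((fderiv ℝ f (σ • x)).le_opNorm v).trans (by gcongr)
    _ = _ := by rw [div_pow]; ring

end Homogeneous

/-! ### Homogeneity and conservation of the Magnus series -/

section Limit

variable {𝔤 : Type u} [NormedLieRing 𝔤] [NormedRealLieAlgebra 𝔤] [FiniteDimensional ℝ 𝔤]

theorem nestedC_smul {Ω Ω' : ℕ → Form1 𝔤} (c : ℝ) (a : Form1 𝔤) (l : List ℕ)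
    (h : ∀ k ∈ l, Ω' k = c ^ k • Ω k) : nestedC Ω' (c • a) l = c ^ (l.sum + 1) • nestedC Ω a l := by
  induction l with
  | nil => simp [nestedC]
  | cons k l ih =>
    have h1 : nestedC Ω' (c • a) (k :: l) = brL 𝔤 (Ω' k) (nestedC Ω' (c • a) l) := rfl
    have h2 : nestedC Ω a (k :: l) = brL 𝔤 (Ω k) (nestedC Ω a l) := rfl
    rw [h1, h2, ih fun j hj => h j (List.mem_cons_of_mem _ hj), h k List.mem_cons_self, map_smul,
      map_smul, smul_apply, smul_smul, List.sum_cons]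
    congr 1
    ring

theorem magnusC_smul (c : ℝ) (a : Form1 𝔤) (n : ℕ) : magnusC (c • a) n = c ^ n • magnusC a n := by
  induction n using Nat.strong_induction_on with
  | _ n ih =>
    cases n with
    | zero => rw [magnusC_zero, magnusC_zero, smul_zero]
    | succ n =>
      rw [magnusC_eq, magnusC_eq, ← map_smul, magnusCDeriv, magnusCDeriv, Finset.smul_sum]
      congr 1
      refine Finset.sum_congr rfl fun k _ => ?_
      rw [nestedC_smul (Ω := magnusC a) c a k.blocks fun j hj => ih j
        (Nat.lt_succ_of_le (k.blocks_le hj)), k.blocks_sum, smul_comm]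

theorem magnusLog_smul (c : ℝ) (A : Form1 𝔤) (n : ℕ) :
    magnusLog (c • A) n = c ^ n • magnusLog A n := by
  rw [magnusLog_eq, magnusLog_eq, ← smul_neg, magnusC_smul, map_smul, smul_neg]

theorem differentiable_magnusLog (n : ℕ) : Differentiable ℝ fun A : Form1 𝔤 => magnusLog A n :=
  (contDiff_magnusLog n).differentiable one_ne_zero

theorem norm_fderiv_magnusLog_le (n : ℕ) (R : ℝ) :
    ∃ c, 0 ≤ c ∧ ∀ ε : ℝ, 0 < ε → ∀ b : Form1 𝔤, ‖b‖ ≤ R → ∀ V,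
      ‖fderiv ℝ (fun A : Form1 𝔤 => magnusLog A (n + 1)) (ε • b) V‖ ≤ c * ε ^ n * ‖V‖ :=
  norm_fderiv_le_of_homogeneous (contDiff_magnusLog (n + 1))
    (fun c A => magnusLog_smul c A (n + 1)) R

/-- The Magnus series is conserved along the flow of `-H^cl` up to the last order. -/
theorem sum_fderiv_magnusLog_hamField (B : Form1 𝔤) (N : ℕ) :
    ∑ m ∈ Finset.range (N + 1), fderiv ℝ (fun A : Form1 𝔤 => magnusLog A m) B
        (perpL 𝔤 B + brL 𝔤 B (kappaL 𝔤 B))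
      = fderiv ℝ (fun A : Form1 𝔤 => magnusLog A N) B (brL 𝔤 B (kappaL 𝔤 B)) := by
  have h0 : fderiv ℝ (fun A : Form1 𝔤 => magnusLog A 0) B = 0 := by
    simp only [magnusLog_zero]
    exact fderiv_const_apply 0
  induction N with
  | zero => simp [h0]
  | succ N ih =>
    -- The sum telescopes: gauge invariance with `V = perpL 𝔤 B` makes the new linear term cancel
    -- the quadratic term left over from order `N`.
    rw [Finset.sum_range_succ, ih, map_add, fderiv_magnusLog_succ (proj_perpL B), ← kappaL_apply]
    abel

end Limit

/-! ### Truncations of the formal flow and their defect -/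

section Limit

variable {𝔤 : Type u} [NormedLieRing 𝔤] [NormedRealLieAlgebra 𝔤] [FiniteDimensional ℝ 𝔤]

theorem sum_range_eq_sum_range_of_le {M : Type*} [AddCommMonoid M] {f : ℕ → ℕ → M} {n N : ℕ}
    (h1 : f 0 n = 0) (h2 : f n 0 = 0) (hN : n ≤ N) :
    (∑ i ∈ Finset.range n, ∑ j ∈ Finset.range n, if i + j = n then f i j else 0)
      = ∑ i ∈ Finset.range N, ∑ j ∈ Finset.range N, if i + j = n then f i j else 0 := by
  rw [← Finset.sum_product', ← Finset.sum_product', ← Finset.sum_filter, ← Finset.sum_filter]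
  refine Finset.sum_subset (fun p hp => ?_) fun p hp hp' => ?_
  · simp only [Finset.mem_filter, Finset.mem_product, Finset.mem_range] at hp ⊢
    omega
  · simp only [Finset.mem_filter, Finset.mem_product, Finset.mem_range] at hp hp'
    obtain ⟨i, j⟩ := p
    simp only at hp hp' ⊢
    rcases Nat.eq_zero_or_pos i with h | h
    · obtain rfl : j = n := by omega
      rw [h, h1]
    · obtain rfl : j = 0 := by omega
      obtain rfl : i = n := by omega
      exact h2

theorem flowSource_eq (A : Form1 𝔤) {n N : ℕ} (hN : n ≤ N) (T : ℝ) :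
    flowSource A n T = ∑ i ∈ Finset.range N, ∑ j ∈ Finset.range N,
      if i + j = n then brL 𝔤 (flowTerm A i T) (kappaL 𝔤 (flowTerm A j T)) else 0 := by
  refine sum_range_eq_sum_range_of_le
    (f := fun i j => brL 𝔤 (flowTerm A i T) (kappaL 𝔤 (flowTerm A j T))) ?_ ?_ hN
  · simp only [flowTerm_zero]
    rw [map_zero, zero_apply]
  · simp only [flowTerm_zero, map_zero]

/-- The truncation of the formal flow with initial value `ε A`, of order `< N`. -/
def flowSum (A : Form1 𝔤) (N : ℕ) (ε T : ℝ) : Form1 𝔤 :=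
  ∑ n ∈ Finset.range N, ε ^ n • flowTerm A n T

/-- The defect of `flowSum` in the flow equation. -/
def flowDefect (A : Form1 𝔤) (N : ℕ) (ε T : ℝ) : Form1 𝔤 :=
  ∑ i ∈ Finset.range N, ∑ j ∈ Finset.range N,
    if N ≤ i + j then ε ^ (i + j) • brL 𝔤 (flowTerm A i T) (kappaL 𝔤 (flowTerm A j T)) else 0

theorem hasDerivAt_flowSum (A : Form1 𝔤) (N : ℕ) (ε T : ℝ) :
    HasDerivAt (flowSum A N ε)
      (-(perpL 𝔤 (flowSum A N ε T) + brL 𝔤 (flowSum A N ε T) (kappaL 𝔤 (flowSum A N ε T)))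
        + flowDefect A N ε T) T := by
  have h : HasDerivAt (flowSum A N ε) _ T := HasDerivAt.fun_sum fun n _ =>
    (hasDerivAt_flowTerm A n T).const_smul (ε ^ n)
  refine h.congr_deriv ?_
  have h1 : brL 𝔤 (flowSum A N ε T) (kappaL 𝔤 (flowSum A N ε T))
      = ∑ i ∈ Finset.range N, ∑ j ∈ Finset.range N,
        ε ^ (i + j) • brL 𝔤 (flowTerm A i T) (kappaL 𝔤 (flowTerm A j T)) := by
    rw [flowSum, map_sum, map_sum, sum_apply]
    refine Finset.sum_congr rfl fun i _ => ?_
    rw [map_sum]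
    refine Finset.sum_congr rfl fun j _ => ?_
    rw [map_smul, map_smul, map_smul, smul_apply, smul_smul, ← pow_add, add_comm]
  have h2 : ∑ n ∈ Finset.range N, ε ^ n • flowSource A n T
      = ∑ i ∈ Finset.range N, ∑ j ∈ Finset.range N, if i + j < N then
        ε ^ (i + j) • brL 𝔤 (flowTerm A i T) (kappaL 𝔤 (flowTerm A j T)) else 0 := by
    rw [Finset.sum_congr rfl fun n hn => by
      rw [flowSource_eq A (Finset.mem_range.1 hn).le, Finset.smul_sum], Finset.sum_comm]
    refine Finset.sum_congr rfl fun i _ => ?_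
    simp only [Finset.smul_sum]
    rw [Finset.sum_comm]
    refine Finset.sum_congr rfl fun j _ => ?_
    simp only [smul_ite, smul_zero]
    rw [Finset.sum_ite_eq]
    simp only [Finset.mem_range]
  have h3 : brL 𝔤 (flowSum A N ε T) (kappaL 𝔤 (flowSum A N ε T))
      = ∑ n ∈ Finset.range N, ε ^ n • flowSource A n T + flowDefect A N ε T := by
    rw [h1, h2, flowDefect, ← Finset.sum_add_distrib]
    refine Finset.sum_congr rfl fun i _ => ?_
    rw [← Finset.sum_add_distrib]
    refine Finset.sum_congr rfl fun j _ => ?_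
    by_cases hij : i + j < N
    · rw [if_pos hij, if_neg (not_le.2 hij), add_zero]
    · rw [if_neg hij, if_pos (not_lt.1 hij), zero_add]
  rw [h3]
  simp only [smul_neg, smul_add, Finset.sum_neg_distrib, Finset.sum_add_distrib]
  rw [flowSum, map_sum]
  simp only [map_smul]
  abel

theorem norm_flowDefect_le (A : Form1 𝔤) (N : ℕ) :
    ∃ C, 0 ≤ C ∧ ∀ ε : ℝ, 0 < ε → ε ≤ 1 → ∀ T, 0 ≤ T →
      ‖flowDefect A N ε T‖ ≤ C * ε ^ N * Real.exp (-(T / 2)) := by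
  have hm := flowMaj_nonneg (norm_nonneg (lieL 𝔤)) (norm_nonneg A)
  have hl := norm_nonneg (lieL 𝔤)
  refine ⟨∑ i ∈ Finset.range N, ∑ j ∈ Finset.range N,
    ‖lieL 𝔤‖ * flowMaj ‖lieL 𝔤‖ ‖A‖ i * flowMaj ‖lieL 𝔤‖ ‖A‖ j,
    Finset.sum_nonneg fun i _ => Finset.sum_nonneg fun j _ =>
      mul_nonneg (mul_nonneg hl (hm i)) (hm j), fun ε hε hε1 T hT => ?_⟩
  rw [flowDefect, mul_assoc, Finset.sum_mul]
  refine (norm_sum_le _ _).trans (Finset.sum_le_sum fun i _ => ?_)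
  rw [Finset.sum_mul]
  refine (norm_sum_le _ _).trans (Finset.sum_le_sum fun j _ => ?_)
  have hij : 0 ≤ ‖lieL 𝔤‖ * flowMaj ‖lieL 𝔤‖ ‖A‖ i * flowMaj ‖lieL 𝔤‖ ‖A‖ j :=
    mul_nonneg (mul_nonneg hl (hm i)) (hm j)
  split_ifs with h
  · rw [norm_smul, norm_pow, Real.norm_of_nonneg hε.le]
    have h1 : ‖brL 𝔤 (flowTerm A i T) (kappaL 𝔤 (flowTerm A j T))‖
        ≤ ‖lieL 𝔤‖ * flowMaj ‖lieL 𝔤‖ ‖A‖ i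
          * (flowMaj ‖lieL 𝔤‖ ‖A‖ j * Real.exp (-(T / 2))) := by
      refine (norm_brL_le _ _).trans ?_
      gcongr
      · exact mul_nonneg hl (hm i)
      · exact (flowTerm_bounds A i hT).1
      · exact (norm_kappaL_le _).trans (flowTerm_bounds A j hT).2
    have h2 : ε ^ (i + j) ≤ ε ^ N := pow_le_pow_of_le_one hε.le hε1 h
    calc _ ≤ ε ^ N * (‖lieL 𝔤‖ * flowMaj ‖lieL 𝔤‖ ‖A‖ i
          * (flowMaj ‖lieL 𝔤‖ ‖A‖ j * Real.exp (-(T / 2)))) := by gcongr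
      _ = _ := by ring
  · rw [norm_zero]
    positivity

theorem flowSum_eq_smul (A : Form1 𝔤) (N : ℕ) {ε : ℝ} (hε : 0 < ε) (hε1 : ε ≤ 1) {T : ℝ}
    (hT : 0 ≤ T) : ∃ b : Form1 𝔤, flowSum A N ε T = ε • b
      ∧ ‖b‖ ≤ ∑ n ∈ Finset.range N, flowMaj ‖lieL 𝔤‖ ‖A‖ n := by
  refine ⟨∑ n ∈ Finset.range N, ε ^ (n - 1) • flowTerm A n T, ?_, ?_⟩
  · rw [flowSum, Finset.smul_sum]
    refine Finset.sum_congr rfl fun n _ => ?_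
    cases n with
    | zero => simp only [flowTerm_zero, smul_zero]
    | succ n => rw [smul_smul, Nat.add_sub_cancel, pow_succ']
  · refine (norm_sum_le _ _).trans (Finset.sum_le_sum fun n _ => ?_)
    rw [norm_smul, norm_pow, Real.norm_of_nonneg hε.le]
    exact (mul_le_of_le_one_left (norm_nonneg _) (pow_le_one₀ hε.le hε1)).trans
      (flowTerm_bounds A n hT).1

theorem norm_perpL_flowSum_le (A : Form1 𝔤) (N : ℕ) {ε : ℝ} (hε : 0 < ε) (hε1 : ε ≤ 1) {T : ℝ}
    (hT : 0 ≤ T) : ‖perpL 𝔤 (flowSum A N ε T)‖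
      ≤ ε * (∑ n ∈ Finset.range N, flowMaj ‖lieL 𝔤‖ ‖A‖ n) * Real.exp (-(T / 2)) := by
  rw [flowSum, map_sum, Finset.mul_sum, Finset.sum_mul]
  refine (norm_sum_le _ _).trans (Finset.sum_le_sum fun n _ => ?_)
  rw [map_smul, norm_smul, norm_pow, Real.norm_of_nonneg hε.le, mul_assoc]
  have hm := flowMaj_nonneg (norm_nonneg (lieL 𝔤)) (norm_nonneg A) n
  cases n with
  | zero =>
    rw [flowTerm_zero, map_zero, norm_zero, mul_zero]
    positivity
  | succ n =>
    have h1 : ε ^ (n + 1) ≤ ε := pow_le_of_le_one hε.le hε1 (Nat.succ_ne_zero n)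
    gcongr
    exact (flowTerm_bounds A (n + 1) hT).2

end Limit

theorem norm_sub_le_of_norm_deriv_le_exp {F : Type*} [NormedAddCommGroup F] [NormedSpace ℝ F]
    {f f' : ℝ → F} {D : ℝ} (hf : ∀ t, HasDerivAt f (f' t) t)
    (hD : ∀ t, 0 ≤ t → ‖f' t‖ ≤ D * Real.exp (-(t / 2))) {T : ℝ} (hT : 0 ≤ T) :
    ‖f T - f 0‖ ≤ 2 * D := by
  have hB : ∀ t : ℝ, HasDerivAt (fun t : ℝ => 2 * D * (1 - Real.exp (-(t / 2))))
      (D * Real.exp (-(t / 2))) t := by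
    intro t
    have := ((((hasDerivAt_id t).div_const 2).fun_neg).exp.const_sub 1).const_mul (2 * D)
    refine this.congr_deriv ?_
    simp only [id_eq]
    ring
  have h := image_norm_le_of_norm_deriv_right_le_deriv_boundary (a := 0) (b := T)
    (f := fun t => f t - f 0) (f' := f')
    (fun t _ => ((hf t).sub_const (f 0)).continuousAt.continuousWithinAt)
    (fun t _ => ((hf t).sub_const (f 0)).hasDerivWithinAt) (by simp) hB (fun t ht => hD t ht.1)
    ⟨hT, le_rfl⟩
  have hD0 : 0 ≤ D := by simpa using (norm_nonneg _).trans (hD 0 le_rfl)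
  refine h.trans ?_
  nlinarith [Real.exp_pos (-(T / 2))]

/-! ### Identification of the limit at infinite time -/

section Limit

variable {𝔤 : Type u} [NormedLieRing 𝔤] [NormedRealLieAlgebra 𝔤] [FiniteDimensional ℝ 𝔤]

/-- The truncated Magnus series is almost conserved along the truncated flow. -/
theorem norm_sum_magnusLog_flowSum_sub_le (A : Form1 𝔤) (k : ℕ) :
    ∃ D, ∀ ε : ℝ, 0 < ε → ε ≤ 1 → ∀ T, 0 ≤ T →
      ‖∑ m ∈ Finset.range (k + 2), magnusLog (flowSum A (k + 2) ε T) m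
        - ∑ m ∈ Finset.range (k + 2), magnusLog (flowSum A (k + 2) ε 0) m‖ ≤ D * ε ^ (k + 2) := by
  set R := ∑ n ∈ Finset.range (k + 2), flowMaj ‖lieL 𝔤‖ ‖A‖ n
  have hR : 0 ≤ R :=
    Finset.sum_nonneg fun n _ => flowMaj_nonneg (norm_nonneg (lieL 𝔤)) (norm_nonneg A) n
  obtain ⟨C, hC, hdef⟩ := norm_flowDefect_le A (k + 2)
  obtain ⟨c₁, hc₁, hlast⟩ := norm_fderiv_magnusLog_le (𝔤 := 𝔤) k R
  have hc : ∀ m, ∃ c, 0 ≤ c ∧ ∀ ε : ℝ, 0 < ε → ε ≤ 1 → ∀ b : Form1 𝔤, ‖b‖ ≤ R → ∀ V,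
      ‖fderiv ℝ (fun A : Form1 𝔤 => magnusLog A m) (ε • b) V‖ ≤ c * ‖V‖ := by
    intro m
    cases m with
    | zero =>
      refine ⟨0, le_rfl, fun ε _ _ b _ V => ?_⟩
      simp [magnusLog_zero]
    | succ m =>
      obtain ⟨c, hc, h⟩ := norm_fderiv_magnusLog_le (𝔤 := 𝔤) m R
      refine ⟨c, hc, fun ε hε hε1 b hb V => (h ε hε b hb V).trans ?_⟩
      gcongr
      exact mul_le_of_le_one_right hc (pow_le_one₀ hε.le hε1)
  choose c hc0 hc using hc
  refine ⟨2 * (c₁ * ‖lieL 𝔤‖ * R ^ 2 + (∑ m ∈ Finset.range (k + 2), c m) * C),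
    fun ε hε hε1 T hT => ?_⟩
  set B := flowSum A (k + 2) ε
  -- Two errors remain. The uncancelled last term has size `ε^k · ε · ε`, because `D Mₖ₊₁` is
  -- homogeneous of degree `k` and the bracket is quadratic. The defect of the truncation has size
  -- `ε^{k+2}`. Both carry `e^{-t/2}`, so their integrals are bounded uniformly in `T`.
  have hder : ∀ t, HasDerivAt (fun t => ∑ m ∈ Finset.range (k + 2), magnusLog (B t) m)
      (-fderiv ℝ (fun A : Form1 𝔤 => magnusLog A (k + 1)) (B t) (brL 𝔤 (B t) (kappaL 𝔤 (B t)))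
        + ∑ m ∈ Finset.range (k + 2),
          fderiv ℝ (fun A : Form1 𝔤 => magnusLog A m) (B t) (flowDefect A (k + 2) ε t)) t := by
    intro t
    have h : HasDerivAt (fun t => ∑ m ∈ Finset.range (k + 2), magnusLog (B t) m) _ t :=
      HasDerivAt.fun_sum fun m _ => ((differentiable_magnusLog m (B t)).hasFDerivAt).comp_hasDerivAt
        t (hasDerivAt_flowSum A (k + 2) ε t)
    refine h.congr_deriv ?_
    simp only [map_add, Finset.sum_add_distrib]
    rw [← sum_fderiv_magnusLog_hamField]
    simp only [map_neg, map_add, Finset.sum_neg_distrib, Finset.sum_add_distrib]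
    rfl
  rw [mul_assoc]
  refine norm_sub_le_of_norm_deriv_le_exp hder (fun t ht => ?_) hT
  obtain ⟨b, hb, hbR⟩ := flowSum_eq_smul A (k + 2) hε hε1 ht
  have hBn : ‖B t‖ ≤ ε * R := by
    rw [show B t = ε • b from hb, norm_smul, Real.norm_of_nonneg hε.le]
    gcongr
  have hperp : ‖kappaL 𝔤 (B t)‖ ≤ ε * R * Real.exp (-(t / 2)) :=
    (norm_kappaL_le _).trans (norm_perpL_flowSum_le A (k + 2) hε hε1 ht)
  have h1 : ‖fderiv ℝ (fun A : Form1 𝔤 => magnusLog A (k + 1)) (B t)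
      (brL 𝔤 (B t) (kappaL 𝔤 (B t)))‖
      ≤ c₁ * ‖lieL 𝔤‖ * R ^ 2 * ε ^ (k + 2) * Real.exp (-(t / 2)) := by
    calc _ ≤ c₁ * ε ^ k * ‖brL 𝔤 (B t) (kappaL 𝔤 (B t))‖ := by
          rw [show B t = ε • b from hb]; exact hlast ε hε b hbR _
      _ ≤ c₁ * ε ^ k * (‖lieL 𝔤‖ * (ε * R) * (ε * R * Real.exp (-(t / 2)))) := by
          gcongr
          refine (norm_brL_le _ _).trans ?_
          gcongr
      _ = _ := by ring
  have h2 : ‖∑ m ∈ Finset.range (k + 2),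
      fderiv ℝ (fun A : Form1 𝔤 => magnusLog A m) (B t) (flowDefect A (k + 2) ε t)‖
      ≤ (∑ m ∈ Finset.range (k + 2), c m) * (C * ε ^ (k + 2) * Real.exp (-(t / 2))) := by
    rw [Finset.sum_mul]
    refine (norm_sum_le _ _).trans (Finset.sum_le_sum fun m _ => ?_)
    rw [show B t = ε • b from hb]
    refine (hc m ε hε hε1 b hbR _).trans ?_
    gcongr
    · exact hc0 m
    · exact hdef ε hε hε1 t ht
  refine (norm_add_le _ _).trans ?_
  rw [norm_neg]
  refine (add_le_add h1 h2).trans (le_of_eq ?_)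
  ring

/-- The part with zero integral decays exponentially, so convergence of the integral already forces
convergence to a constant form. -/
theorem tendsto_flowTerm {A : Form1 𝔤} {n : ℕ} {L : 𝔤}
    (h : Tendsto (fun T => proj (flowTerm A n T)) atTop (𝓝 L)) :
    Tendsto (flowTerm A n) atTop (𝓝 (incl L)) := by
  have h1 : Tendsto (fun T => perpL 𝔤 (flowTerm A n T)) atTop (𝓝 0) := by
    refine squeeze_zero_norm' (a := fun T => flowMaj ‖lieL 𝔤‖ ‖A‖ n * Real.exp (-(T / 2))) ?_ ?_
    · filter_upwards [eventually_ge_atTop 0] with T hT using (flowTerm_bounds A n hT).2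
    · have h2 : Tendsto (fun T : ℝ => Real.exp (-(T / 2))) atTop (𝓝 0) :=
        Real.tendsto_exp_neg_atTop_nhds_zero.comp (tendsto_id.atTop_div_const two_pos)
      simpa using h2.const_mul (flowMaj ‖lieL 𝔤‖ ‖A‖ n)
  have h2 := h1.add (((inclL 𝔤).continuous.tendsto L).comp h)
  rw [zero_add] at h2
  refine h2.congr fun T => ?_
  simp only [Function.comp]
  rw [perpL_apply, inclL_apply, sub_add_cancel]

theorem flowSum_at_zero (A : Form1 𝔤) (k : ℕ) (ε : ℝ) : flowSum A (k + 2) ε 0 = ε • A := by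
  simp [flowSum, flowTerm_at_zero]

theorem sum_magnusLog_incl (x : 𝔤) (k : ℕ) :
    ∑ m ∈ Finset.range (k + 2), magnusLog (incl x) m = x := by
  simp [magnusLog_incl]

theorem eq_of_norm_smul_le {F : Type*} [NormedAddCommGroup F] [NormedSpace ℝ F] {x : F} {D : ℝ}
    {n : ℕ} (h : ∀ ε : ℝ, 0 < ε → ε ≤ 1 → ‖ε ^ n • x‖ ≤ D * ε ^ (n + 1)) : x = 0 := by
  have h1 : ∀ ε : ℝ, 0 < ε → ε ≤ 1 → ‖x‖ ≤ D * ε := by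
    intro ε hε hε1
    have := h ε hε hε1
    rw [norm_smul, norm_pow, Real.norm_of_nonneg hε.le, pow_succ, mul_left_comm] at this
    exact le_of_mul_le_mul_left this (pow_pos hε n)
  have h2 : Tendsto (fun ε : ℝ => D * ε) (𝓝[>] 0) (𝓝 (D * 0)) :=
    (tendsto_id.const_mul D).mono_left nhdsWithin_le_nhds
  rw [mul_zero] at h2
  rw [← norm_le_zero_iff]
  refine ge_of_tendsto h2 ?_
  filter_upwards [Ioc_mem_nhdsGT zero_lt_one] with ε hε using h1 ε hε.1 hε.2

/-- The formal flow projects to the Magnus expansion. -/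
theorem tendsto_proj_flowTerm_magnusLog (A : Form1 𝔤) (n : ℕ) :
    Tendsto (fun T => proj (flowTerm A n T)) atTop (𝓝 (magnusLog A n)) := by
  induction n using Nat.strong_induction_on with
  | _ n ih =>
    cases n with
    | zero =>
      simp only [flowTerm_zero, magnusLog_zero]
      rw [show proj (0 : Form1 𝔤) = 0 from map_zero (projL 𝔤)]
      exact tendsto_const_nhds
    | succ k =>
      obtain ⟨L, hL⟩ := tendsto_proj_flowTerm A (k + 1)
      suffices h : L - magnusLog A (k + 1) = 0 by rwa [← sub_eq_zero.1 h]
      -- At fixed `ε` the truncated Magnus sum is compared at `T = 0` and `T = ∞`. At infinity the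
      -- flow reaches the constant form `x + ε^{k+1} L`, on which the Magnus sum is the identity. At
      -- zero it equals `x + ε^{k+1} Mₖ₊₁(A)`. The two differ by `O(ε^{k+2})`, so `ε → 0` gives `L =
      -- Mₖ₊₁(A)`.
      obtain ⟨D, hD⟩ := norm_sum_magnusLog_flowSum_sub_le A k
      refine eq_of_norm_smul_le (D := D) (n := k + 1) fun ε hε hε1 => ?_
      set x := ∑ n ∈ Finset.range (k + 1), ε ^ n • magnusLog A n
      have hB : Tendsto (flowSum A (k + 2) ε) atTop (𝓝 (incl (x + ε ^ (k + 1) • L))) := by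
        have h1 : Tendsto (flowSum A (k + 1) ε) atTop (𝓝 (incl x)) := by
          have : Tendsto (flowSum A (k + 1) ε) atTop
              (𝓝 (∑ n ∈ Finset.range (k + 1), ε ^ n • incl (magnusLog A n))) :=
            tendsto_finsetSum _ fun n hn =>
              (tendsto_flowTerm (ih n (Finset.mem_range.1 hn))).const_smul (ε ^ n)
          convert this using 2
          simp only [x, ← inclL_apply, map_sum, map_smul]
        have h2 := h1.add ((tendsto_flowTerm hL).const_smul (ε ^ (k + 1)))
        have e : incl x + ε ^ (k + 1) • incl L = incl (x + ε ^ (k + 1) • L) := by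
          simp only [← inclL_apply, map_add, map_smul]
        rw [e] at h2
        refine h2.congr fun T => ?_
        simp only [flowSum]
        rw [Finset.sum_range_succ _ (k + 1)]
      have hlim : Tendsto (fun T => ∑ m ∈ Finset.range (k + 2),
          magnusLog (flowSum A (k + 2) ε T) m) atTop (𝓝 (x + ε ^ (k + 1) • L)) := by
        have := tendsto_finsetSum (Finset.range (k + 2)) fun m _ =>
          ((differentiable_magnusLog (𝔤 := 𝔤) m).continuous.tendsto _).comp hB
        rwa [sum_magnusLog_incl] at this
      have h0 : ∑ m ∈ Finset.range (k + 2), magnusLog (flowSum A (k + 2) ε 0) m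
          = x + ε ^ (k + 1) • magnusLog A (k + 1) := by
        simp only [flowSum_at_zero, magnusLog_smul]
        rw [Finset.sum_range_succ]
      have h3 := le_of_tendsto ((hlim.sub_const (x + ε ^ (k + 1) • magnusLog A (k + 1))).norm)
        (b := D * ε ^ (k + 2)) (by
          filter_upwards [eventually_ge_atTop 0] with T hT
          rw [← h0]
          exact hD ε hε hε1 T hT)
      rwa [add_sub_add_left_eq_sub, ← smul_sub] at h3

end Limit

/-! ### The flow of small connections -/

section Series

variable {E F G : Type*} [NormedAddCommGroup E] [NormedSpace ℝ E]
  [CompleteSpace E] [NormedAddCommGroup F] [NormedSpace ℝ F] [CompleteSpace F]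
  [NormedAddCommGroup G] [NormedSpace ℝ G] [CompleteSpace G]

theorem hasSum_bilinear_antidiagonal (B : E →L[ℝ] F →L[ℝ] G)
    {a : ℕ → E} {b : ℕ → F} (ha : Summable fun n => ‖a n‖) (hb : Summable fun n => ‖b n‖) :
    HasSum (fun n => ∑ p ∈ antidiagonal n, B (a p.1) (b p.2)) (B (∑' n, a n) (∑' n, b n)) := by
  have hs : Summable fun p : ℕ × ℕ => B (a p.1) (b p.2) := by
    refine Summable.of_norm_bounded
      ((ha.mul_of_nonneg hb (fun _ => norm_nonneg _) fun _ => norm_nonneg _).mul_left ‖B‖)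
      fun p => ?_
    rw [← mul_assoc]
    exact B.le_opNorm₂ _ _
  have ht : ∑' p : ℕ × ℕ, B (a p.1) (b p.2) = B (∑' n, a n) (∑' n, b n) := by
    have h1 : B (∑' n, a n) (∑' n, b n) = ∑' i, B (a i) (∑' n, b n) :=
      (B.flip (∑' n, b n)).map_tsum ha.of_norm
    rw [hs.tsum_prod, h1]
    exact tsum_congr fun i => ((B (a i)).map_tsum hb.of_norm).symm
  rw [← ht, ← Finset.HasAntidiagonal.sigmaAntidiagonalEquivProd.tsum_eq]
  have h2 := Finset.HasAntidiagonal.sigmaAntidiagonalEquivProd.summable_iff.2 hs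
  have h3 := h2.hasSum.sigma fun n => hasSum_fintype _
  refine h3.congr_fun fun n => ?_
  exact (Finset.sum_attach (antidiagonal n) fun p => B (a p.1) (b p.2)).symm

/-- Termwise differentiation on `[0, ∞)`. -/
theorem hasDerivWithinAt_tsum_Ici {f f' : ℕ → ℝ → E} {u : ℕ → ℝ} (hu : Summable u)
    (hf : ∀ n t, HasDerivAt (f n) (f' n t) t) (hc : ∀ n, Continuous (f' n))
    (hb : ∀ n t, 0 ≤ t → ‖f' n t‖ ≤ u n) (h0 : Summable fun n => f n 0) {T : ℝ} (hT : 0 ≤ T) :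
    HasDerivWithinAt (fun t => ∑' n, f n t) (∑' n, f' n T) (Ici 0) T := by
  -- Termwise differentiation is available on the whole line, but the bounds hold only for `t ≥ 0`.
  -- Freezing the derivatives at `max s 0` extends them without changing the functions on `[0, ∞)`.
  have hc' : ∀ n, Continuous fun s => f' n (max s 0) := fun n =>
    (hc n).comp (continuous_id.max continuous_const)
  set g : ℕ → ℝ → E := fun n t => f n 0 + ∫ s in (0 : ℝ)..t, f' n (max s 0)
  have hg : ∀ n t, HasDerivAt (g n) (f' n (max t 0)) t := fun n t =>
    (intervalIntegral.integral_hasDerivAt_right ((hc' n).intervalIntegrable _ _)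
      ((hc' n).stronglyMeasurableAtFilter _ _) (hc' n).continuousAt).const_add (f n 0)
  have hfg : ∀ n t, 0 ≤ t → f n t = g n t := by
    intro n t ht
    have h1 : ∫ s in (0 : ℝ)..t, f' n (max s 0) = ∫ s in (0 : ℝ)..t, f' n s := by
      refine intervalIntegral.integral_congr fun s hs => ?_
      rw [uIcc_of_le ht] at hs
      simp only [max_eq_left hs.1]
    have h2 := intervalIntegral.integral_eq_sub_of_hasDerivAt (fun s _ => hf n s)
      ((hc n).intervalIntegrable (μ := volume) 0 t)
    simp only [g]
    rw [h1, h2, add_sub_cancel]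
  have h := hasDerivAt_tsum hu hg (fun n t => hb n _ (le_max_right t 0))
    (y₀ := 0) (by simpa [g] using h0) T
  rw [max_eq_left hT] at h
  exact h.hasDerivWithinAt.congr (fun t ht => tsum_congr fun n => hfg n t ht)
    (tsum_congr fun n => hfg n T hT)

end Series

/-! ### Convergence of the formal flow for small connections -/

section SmallFlow

variable {𝔤 : Type u} [NormedLieRing 𝔤] [NormedRealLieAlgebra 𝔤] [FiniteDimensional ℝ 𝔤]

/-- The flow line of a small connection, as the sum of the formal flow. -/
def flowLine (A : Form1 𝔤) (T : ℝ) : Form1 𝔤 := ∑' n, flowTerm A n T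

/-- The sum of the Magnus expansion. -/
def magnusSum (A : Form1 𝔤) : 𝔤 := ∑' n, magnusLog A n

variable {A : Form1 𝔤}

theorem summable_norm_flowTerm (hA : 72 * ‖lieL 𝔤‖ * ‖A‖ ≤ 1) {T : ℝ} (hT : 0 ≤ T) :
    Summable fun n => ‖flowTerm A n T‖ :=
  (summable_flowMaj (norm_nonneg (lieL 𝔤)) (norm_nonneg A) hA).of_nonneg_of_le
    (fun _ => norm_nonneg _) fun n => (flowTerm_bounds A n hT).1

theorem hasSum_flowSource (hA : 72 * ‖lieL 𝔤‖ * ‖A‖ ≤ 1) {T : ℝ} (hT : 0 ≤ T) :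
    HasSum (fun n => flowSource A n T)
      (brL 𝔤 (flowLine A T) (kappaL 𝔤 (flowLine A T))) := by
  have h := summable_norm_flowTerm hA hT
  have h' : Summable fun n => ‖kappaL 𝔤 (flowTerm A n T)‖ :=
    (h.mul_left 2).of_nonneg_of_le (fun _ => norm_nonneg _) fun n =>
      (norm_kappaL_le _).trans (norm_perpL_le _)
  have h2 := hasSum_bilinear_antidiagonal (brL 𝔤) h h'
  rw [← ContinuousLinearMap.map_tsum (kappaL 𝔤) h.of_norm] at h2
  have e : ∀ n, flowSource A n T
      = ∑ p ∈ antidiagonal n, brL 𝔤 (flowTerm A p.1 T) (kappaL 𝔤 (flowTerm A p.2 T)) := by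
    intro n
    symm
    refine sum_antidiagonal_eq_sum_range
      (f := fun i j => brL 𝔤 (flowTerm A i T) (kappaL 𝔤 (flowTerm A j T))) ?_ ?_
    · simp only [flowTerm_zero]
      rw [map_zero, zero_apply]
    · simp only [flowTerm_zero, map_zero]
  rw [funext e]
  exact h2

theorem isFlow_flowLine (hA : 72 * ‖lieL 𝔤‖ * ‖A‖ ≤ 1) : IsFlow A (flowLine A) where
  init := by
    rw [flowLine, tsum_eq_single 1 fun n hn => by rw [flowTerm_at_zero, if_neg hn],
      flowTerm_at_zero, if_pos rfl]
  flow T hT := by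
    have hmaj := summable_flowMaj (norm_nonneg (lieL 𝔤)) (norm_nonneg A) hA
    have h := hasDerivWithinAt_tsum_Ici (f := fun n t => flowTerm A n t)
      (f' := fun n t => -(perpL 𝔤 (flowTerm A n t) + flowSource A n t)) (hmaj.mul_left 3)
      (hasDerivAt_flowTerm A)
      (fun n => (((perpL 𝔤).continuous.comp (continuous_flowTerm A n)).add
        (continuous_flowSource A n)).neg)
      (fun n t ht => ?_) (summable_norm_flowTerm hA le_rfl).of_norm hT
    · refine h.congr_deriv ?_
      have h1 := (perpL 𝔤).hasSum (summable_norm_flowTerm hA hT).of_norm.hasSum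
      rw [hamField_eq]
      exact ((h1.add (hasSum_flowSource hA hT)).neg).tsum_eq
    · have h1 := flowTerm_bounds A n ht
      have h2 := norm_flowSource_le A n ht
      have h3 := flowMaj_nonneg (norm_nonneg (lieL 𝔤)) (norm_nonneg A) n
      have h4 : flowMaj ‖lieL 𝔤‖ ‖A‖ n * Real.exp (-(t / 2)) ≤ flowMaj ‖lieL 𝔤‖ ‖A‖ n :=
        mul_le_of_le_one_right h3 (Real.exp_le_one_iff.2 (by linarith))
      rw [norm_neg]
      refine (norm_add_le _ _).trans ?_
      linarith [h1.2]

/-- The bound passes to the limit from the flow, so no estimate of Bernoulli coefficients is needed.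
-/
theorem norm_magnusLog_le (A : Form1 𝔤) (n : ℕ) :
    ‖magnusLog A n‖ ≤ flowMaj ‖lieL 𝔤‖ ‖A‖ n := by
  refine le_of_tendsto (tendsto_proj_flowTerm_magnusLog A n).norm ?_
  filter_upwards [eventually_ge_atTop 0] with T hT
  exact (norm_proj_le _).trans (flowTerm_bounds A n hT).1

theorem summable_norm_magnusLog (hA : 72 * ‖lieL 𝔤‖ * ‖A‖ ≤ 1) :
    Summable fun n => ‖magnusLog A n‖ :=
  (summable_flowMaj (norm_nonneg (lieL 𝔤)) (norm_nonneg A) hA).of_nonneg_of_le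
    (fun _ => norm_nonneg _) (norm_magnusLog_le A)

theorem hasSum_magnusLog (hA : 72 * ‖lieL 𝔤‖ * ‖A‖ ≤ 1) : HasSum (magnusLog A) (magnusSum A) :=
  (summable_norm_magnusLog hA).of_norm.hasSum

/-- The majorant does not depend on `T`, so dominated convergence interchanges the limit and the sum
over orders. -/
theorem tendsto_proj_flowLine (hA : 72 * ‖lieL 𝔤‖ * ‖A‖ ≤ 1) :
    Tendsto (fun T => proj (flowLine A T)) atTop (𝓝 (magnusSum A)) := by
  have h := tendsto_tsum_of_dominated_convergence (𝓕 := atTop)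
    (summable_flowMaj (norm_nonneg (lieL 𝔤)) (norm_nonneg A) hA)
    (fun n => tendsto_proj_flowTerm_magnusLog A n) (by
      filter_upwards [eventually_ge_atTop 0] with T hT n
      exact (norm_proj_le _).trans (flowTerm_bounds A n hT).1)
  refine h.congr' ?_
  filter_upwards [eventually_ge_atTop 0] with T hT
  exact ((projL 𝔤).map_tsum (summable_norm_flowTerm hA hT).of_norm).symm

/-- Only orders other than one contribute, and they are controlled by the quadratic part of the
majorant: `216 = 6 · 6²`. -/
theorem norm_magnusSum_sub_proj_le (hA : 72 * ‖lieL 𝔤‖ * ‖A‖ ≤ 1) :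
    ‖magnusSum A - proj A‖ ≤ 216 * ‖lieL 𝔤‖ * ‖A‖ ^ 2 := by
  have hb := norm_nonneg (lieL 𝔤)
  have hx := norm_nonneg A
  have h1 : HasSum (fun n => magnusLog A n - if n = 1 then proj A else 0)
      (magnusSum A - proj A) := (hasSum_magnusLog hA).sub (hasSum_ite_eq 1 (proj A))
  have hle : ∀ N, ∑ n ∈ Finset.range N,
      |flowMaj ‖lieL 𝔤‖ ‖A‖ n - 3 * (if n = 1 then ‖A‖ else 0)| ≤ 216 * ‖lieL 𝔤‖ * ‖A‖ ^ 2 := by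
    intro N
    refine (Finset.sum_le_sum_of_subset_of_nonneg
      (Finset.range_subset_range.2 (Nat.le_succ N)) fun _ _ _ => abs_nonneg _).trans ?_
    refine (sum_flowMaj_le hb hx N).trans ?_
    have h3 := pow_le_pow_left₀ (Finset.sum_nonneg fun n _ => flowMaj_nonneg hb hx n)
      (sum_flowMaj_le_of_small hb hx hA N) 2
    calc 6 * (‖lieL 𝔤‖ * (∑ n ∈ Finset.range N, flowMaj ‖lieL 𝔤‖ ‖A‖ n) ^ 2)
        ≤ 6 * (‖lieL 𝔤‖ * (6 * ‖A‖) ^ 2) := by gcongr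
      _ = _ := by ring
  have hs := summable_of_sum_range_le (fun _ => abs_nonneg _) hle
  refine (h1.norm_le_of_bounded hs.hasSum fun n => ?_).trans
    (Real.tsum_le_of_sum_range_le (fun _ => abs_nonneg _) hle)
  split_ifs with hn
  · rw [hn, magnusLog_one, sub_self, norm_zero]
    exact abs_nonneg _
  · rw [sub_zero, mul_zero, sub_zero]
    exact (norm_magnusLog_le A n).trans (le_abs_self _)

end SmallFlow

/-! ### Linear differential equations -/

section LinearODE

variable {E : Type*} [NormedAddCommGroup E] [NormedSpace ℝ E] [CompleteSpace E]
  {m : ℝ → E →L[ℝ] E} {x : ℕ → ℝ → E}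

theorem continuous_of_iterated (h0 : Continuous (x 0))
    (hs : ∀ n t, HasDerivAt (x (n + 1)) (m t (x n t)) t) (n : ℕ) : Continuous (x n) := by
  cases n with
  | zero => exact h0
  | succ n => exact continuous_iff_continuousAt.2 fun t => (hs n t).continuousAt

theorem norm_iterated_le (hm : Continuous m) (h0 : Continuous (x 0))
    (hs : ∀ n t, HasDerivAt (x (n + 1)) (m t (x n t)) t) (hz : ∀ n, x (n + 1) 0 = 0)
    {R C K : ℝ} (hC : ∀ t, |t| ≤ R → ‖m t‖ ≤ C) (hK : ∀ t, |t| ≤ R → ‖x 0 t‖ ≤ K)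
    (n : ℕ) {t : ℝ} (ht : |t| ≤ R) : ‖x n t‖ ≤ K * (C ^ n / n.factorial * |t| ^ n) := by
  have hC0 : 0 ≤ C := (norm_nonneg _).trans (hC t ht)
  have hK0 : 0 ≤ K := (norm_nonneg _).trans (hK t ht)
  induction n generalizing t with
  | zero => simpa using hK t ht
  | succ n ih =>
    have hcont : Continuous fun s => m s (x n s) := hm.clm_apply (continuous_of_iterated h0 hs n)
    have h1 := intervalIntegral.integral_eq_sub_of_hasDerivAt (fun s _ => hs n s)
      (hcont.intervalIntegrable (μ := volume) 0 t)
    rw [hz, sub_zero] at h1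
    rw [← h1]
    have hcb : Continuous fun s : ℝ => C * (K * (C ^ n / n.factorial)) * |s - 0| ^ n := by fun_prop
    have h2 := intervalIntegral.norm_integral_le_abs_of_norm_le (μ := volume) (a := 0) (b := t)
      (f := fun s => m s (x n s)) (g := fun s => C * (K * (C ^ n / n.factorial)) * |s - 0| ^ n)
      ((ae_restrict_mem measurableSet_uIoc).mono fun s hs => by
        have hsR : |s| ≤ R := by
          refine le_trans ?_ ht
          rcases Set.mem_uIoc.1 hs with h | h
          · rw [abs_of_pos h.1]; exact h.2.trans (le_abs_self t)
          · rw [abs_of_nonpos h.2]; exact (neg_le_neg h.1.le).trans (neg_le_abs t)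
        rw [sub_zero]
        calc ‖m s (x n s)‖ ≤ C * (K * (C ^ n / n.factorial * |s| ^ n)) :=
              ((m s).le_opNorm _).trans (by gcongr; exacts [hC s hsR, ih hsR])
          _ = _ := by ring) (hcb.intervalIntegrable _ _)
    refine h2.trans (le_of_eq ?_)
    rw [intervalIntegral.abs_integral_eq_abs_integral_uIoc, integral_const_mul,
      integral_pow_abs_sub_uIoc, sub_zero, abs_of_nonneg (by positivity), Nat.factorial_succ]
    push_cast
    field_simp
    ring

theorem summable_iterated_bound (K C R : ℝ) :
    Summable fun n : ℕ => K * (C ^ n / n.factorial * R ^ n) := by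
  refine ((Real.summable_pow_div_factorial (C * R)).mul_left K).congr fun n => ?_
  rw [mul_pow]
  ring

/-- The series of iterated integrals solves the linear differential equation `x' = m x + h`. -/
theorem hasDerivAt_tsum_iterated (hm : Continuous m) {h : ℝ → E}
    (h0 : ∀ t, HasDerivAt (x 0) (h t) t)
    (hs : ∀ n t, HasDerivAt (x (n + 1)) (m t (x n t)) t) (hz : ∀ n, x (n + 1) 0 = 0) (t : ℝ) :
    HasDerivAt (fun t => ∑' n, x n t) (m t (∑' n, x n t) + h t) t := by
  have hc0 : Continuous (x 0) := continuous_iff_continuousAt.2 fun t => (h0 t).continuousAt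
  set R := |t| + 1
  obtain ⟨C, hC⟩ := (isCompact_Icc (a := -R) (b := R)).exists_bound_of_continuousOn hm.continuousOn
  obtain ⟨K, hK⟩ := (isCompact_Icc (a := -R) (b := R)).exists_bound_of_continuousOn hc0.continuousOn
  have hx : ∀ n s, |s| ≤ R → ‖x n s‖ ≤ K * (C ^ n / n.factorial * R ^ n) := by
    intro n s hs'
    have hC0 : 0 ≤ C := (norm_nonneg _).trans (hC s (abs_le.1 hs'))
    have hK0 : 0 ≤ K := (norm_nonneg _).trans (hK s (abs_le.1 hs'))
    refine (norm_iterated_le hm hc0 hs hz (fun s hs => hC s (abs_le.1 hs))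
      (fun s hs => hK s (abs_le.1 hs)) n hs').trans ?_
    gcongr
  have hsum := summable_iterated_bound K C R
  have ht : |t| ≤ R := by simp [R]
  have hxs : ∀ s, |s| ≤ R → Summable fun n => x n s := fun s hs' =>
    Summable.of_norm_bounded hsum fun n => hx n s hs'
  -- The term of index `0` carries the inhomogeneity and is split off. The later terms vanish at `0`
  -- and are differentiated termwise on `(-R, R)`, where `m` and `x 0` are bounded.
  have htail := hasDerivAt_tsum_of_isPreconnected (hsum.mul_left C) (isOpen_Ioo (a := -R) (b := R))
    isPreconnected_Ioo (fun n s _ => hs n s) (fun n s hs' => by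
      have hsR : |s| ≤ R := abs_le.2 ⟨hs'.1.le, hs'.2.le⟩
      refine ((m s).le_opNorm _).trans ?_
      have hC0 : 0 ≤ C := (norm_nonneg _).trans (hC s (abs_le.1 hsR))
      exact mul_le_mul (hC s (abs_le.1 hsR)) (hx n s hsR) (norm_nonneg _) hC0)
    (y₀ := 0) ⟨by linarith [abs_nonneg t], by positivity⟩ (by simp [hz, summable_zero])
    (show t ∈ Ioo (-R) R from abs_lt.1 (lt_add_one |t|))
  rw [(m t).map_tsum (hxs t ht), add_comm]
  refine ((h0 t).add htail).congr_of_eventuallyEq ?_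
  filter_upwards [Ioo_mem_nhds (a := -R) (b := R) (abs_lt.1 (lt_add_one |t|)).1
    (abs_lt.1 (lt_add_one |t|)).2] with s hs'
  exact (hxs s (abs_le.2 ⟨hs'.1.le, hs'.2.le⟩)).tsum_eq_zero_add

/-- Existence of solutions of linear differential equations. -/
theorem exists_hasDerivAt_linear (hm : Continuous m) {h : ℝ → E} (hh : Continuous h) (x₀ : E) :
    ∃ f : ℝ → E, f 0 = x₀ ∧ ∀ t, HasDerivAt f (m t (f t) + h t) t := by
  let x : ℕ → ℝ → E := fun n => Nat.rec (fun t => x₀ + ∫ s in (0 : ℝ)..t, h s)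
    (fun _ y t => ∫ s in (0 : ℝ)..t, m s (y s)) n
  have hder : ∀ {g : ℝ → E}, Continuous g → ∀ t,
      HasDerivAt (fun t => ∫ s in (0 : ℝ)..t, g s) (g t) t := fun hg t =>
    intervalIntegral.integral_hasDerivAt_right (hg.intervalIntegrable _ _)
      (hg.stronglyMeasurableAtFilter _ _) hg.continuousAt
  have h0 : ∀ t, HasDerivAt (x 0) (h t) t := fun t => (hder hh t).const_add x₀
  have hc : ∀ n, Continuous (x n) := by
    intro n
    induction n with
    | zero => exact continuous_iff_continuousAt.2 fun t => (h0 t).continuousAt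
    | succ n ih =>
      exact continuous_iff_continuousAt.2 fun t => (hder (hm.clm_apply ih) t).continuousAt
  have hs : ∀ n t, HasDerivAt (x (n + 1)) (m t (x n t)) t := fun n t =>
    hder (hm.clm_apply (hc n)) t
  have hz : ∀ n, x (n + 1) 0 = 0 := fun n => intervalIntegral.integral_same
  refine ⟨fun t => ∑' n, x n t, ?_, hasDerivAt_tsum_iterated hm h0 hs hz⟩
  have : ∀ n, n ≠ 0 → x n 0 = 0 := by
    intro n hn
    obtain ⟨k, rfl⟩ := Nat.exists_eq_succ_of_ne_zero hn
    exact hz k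
  simp only
  rw [tsum_eq_single 0 this]
  simp [x]

end LinearODE

/-! ### Absolutely summable power series -/

section SummableSeries

variable {𝔸 : Type*} [NormedRing 𝔸] [CompleteSpace 𝔸] {x y : PowerSeries 𝔸}

theorem summable_norm_coeff_mul (hx : Summable fun n => ‖PowerSeries.coeff n x‖)
    (hy : Summable fun n => ‖PowerSeries.coeff n y‖) :
    Summable fun n => ‖PowerSeries.coeff n (x * y)‖ := by
  simp only [PowerSeries.coeff_mul]
  exact summable_norm_sum_mul_antidiagonal_of_summable_norm
    (f := fun n => PowerSeries.coeff n x) (g := fun n => PowerSeries.coeff n y) hx hy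

theorem tsum_coeff_mul (hx : Summable fun n => ‖PowerSeries.coeff n x‖)
    (hy : Summable fun n => ‖PowerSeries.coeff n y‖) :
    ∑' n, PowerSeries.coeff n (x * y)
      = (∑' n, PowerSeries.coeff n x) * ∑' n, PowerSeries.coeff n y := by
  simp only [PowerSeries.coeff_mul]
  exact (tsum_mul_tsum_eq_tsum_sum_antidiagonal_of_summable_norm
    (f := fun n => PowerSeries.coeff n x) (g := fun n => PowerSeries.coeff n y) hx hy).symm

theorem tsum_norm_coeff_mul_le (hx : Summable fun n => ‖PowerSeries.coeff n x‖)
    (hy : Summable fun n => ‖PowerSeries.coeff n y‖) :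
    ∑' n, ‖PowerSeries.coeff n (x * y)‖
      ≤ (∑' n, ‖PowerSeries.coeff n x‖) * ∑' n, ‖PowerSeries.coeff n y‖ := by
  rw [tsum_mul_tsum_eq_tsum_sum_antidiagonal_of_summable_norm (by simpa using hx)
    (by simpa using hy)]
  have hle : ∀ n, ‖PowerSeries.coeff n (x * y)‖
      ≤ ∑ p ∈ antidiagonal n, ‖PowerSeries.coeff p.1 x‖ * ‖PowerSeries.coeff p.2 y‖ := fun n => by
    rw [PowerSeries.coeff_mul]
    exact (norm_sum_le _ _).trans (Finset.sum_le_sum fun p _ => norm_mul_le _ _)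
  refine Summable.tsum_le_tsum hle (summable_norm_coeff_mul hx hy) ?_
  exact (summable_norm_sum_mul_antidiagonal_of_summable_norm
    (f := fun n => ‖PowerSeries.coeff n x‖) (g := fun n => ‖PowerSeries.coeff n y‖)
    (by simpa using hx) (by simpa using hy)).of_norm

theorem summable_norm_coeff_one : Summable fun n => ‖PowerSeries.coeff n (1 : PowerSeries 𝔸)‖ :=
  summable_of_ne_finset_zero (s := {0}) fun n hn => by
    rw [PowerSeries.coeff_one, if_neg (by simpa using hn), norm_zero]

theorem summable_norm_coeff_pow (hx : Summable fun n => ‖PowerSeries.coeff n x‖) (k : ℕ) :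
    Summable fun n => ‖PowerSeries.coeff n (x ^ k)‖ := by
  induction k with
  | zero => simpa only [pow_zero] using summable_norm_coeff_one
  | succ k ih => simpa only [pow_succ] using summable_norm_coeff_mul ih hx

theorem tsum_coeff_one : ∑' n, PowerSeries.coeff n (1 : PowerSeries 𝔸) = 1 := by
  rw [tsum_eq_single 0 fun n hn => by rw [PowerSeries.coeff_one, if_neg hn]]
  simp

theorem tsum_coeff_pow (hx : Summable fun n => ‖PowerSeries.coeff n x‖) (k : ℕ) :
    ∑' n, PowerSeries.coeff n (x ^ k) = (∑' n, PowerSeries.coeff n x) ^ k := by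
  induction k with
  | zero => simp only [pow_zero, tsum_coeff_one]
  | succ k ih => rw [pow_succ, tsum_coeff_mul (summable_norm_coeff_pow hx k) hx, ih, pow_succ]

/-- The factor `‖1‖` appears because the unit is not assumed to have norm one. -/
theorem tsum_norm_coeff_pow_le (hx : Summable fun n => ‖PowerSeries.coeff n x‖) (k : ℕ) :
    ∑' n, ‖PowerSeries.coeff n (x ^ k)‖
      ≤ ‖(1 : 𝔸)‖ * (∑' n, ‖PowerSeries.coeff n x‖) ^ k := by
  induction k with
  | zero =>
    rw [pow_zero, pow_zero, mul_one, tsum_eq_single 0 fun n hn => by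
      rw [PowerSeries.coeff_one, if_neg hn, norm_zero]]
    simp
  | succ k ih =>
    rw [pow_succ, pow_succ, ← mul_assoc]
    exact (tsum_norm_coeff_mul_le (summable_norm_coeff_pow hx k) hx).trans
      (mul_le_mul_of_nonneg_right ih (tsum_nonneg fun _ => norm_nonneg _))

variable [NormedAlgebra ℝ 𝔸]

/-- Substitution of a power series in a power series, evaluated at `1`. -/
theorem hasSum_coeff_subst {c : ℕ → ℝ} (hx0 : PowerSeries.coeff 0 x = 0)
    (hx : Summable fun n => ‖PowerSeries.coeff n x‖)
    (hc : Summable fun k => |c k| * (∑' n, ‖PowerSeries.coeff n x‖) ^ k) :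
    Summable (fun k => c k • (∑' n, PowerSeries.coeff n x) ^ k) ∧
      HasSum (fun n => ∑ k ∈ Finset.range (n + 1), c k • PowerSeries.coeff n (x ^ k))
        (∑' k, c k • (∑' n, PowerSeries.coeff n x) ^ k) := by
  -- The double series is absolutely summable. Rows, at fixed `k`, give powers of the sum. Columns,
  -- at fixed `n`, are finite because `x` has no constant term.
  set f : ℕ × ℕ → 𝔸 := fun p => c p.1 • PowerSeries.coeff p.2 (x ^ p.1)
  have hfn : ∀ k, ∑' n, ‖f (k, n)‖
      ≤ |c k| * (∑' n, ‖PowerSeries.coeff n x‖) ^ k * ‖(1 : 𝔸)‖ := by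
    intro k
    simp only [f, norm_smul, Real.norm_eq_abs]
    rw [tsum_mul_left, mul_assoc, mul_comm (_ ^ k)]
    exact mul_le_mul_of_nonneg_left (tsum_norm_coeff_pow_le hx k) (abs_nonneg _)
  have hf : Summable f := by
    refine Summable.of_norm ((summable_prod_of_nonneg fun _ => norm_nonneg _).2 ⟨fun k => ?_, ?_⟩)
    · simp only [f, norm_smul]
      exact (summable_norm_coeff_pow hx k).mul_left _
    · exact (hc.mul_right ‖(1 : 𝔸)‖).of_nonneg_of_le (fun _ => tsum_nonneg fun _ => norm_nonneg _)
        hfn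
  have hrow : ∀ k, HasSum (fun n => f (k, n)) (c k • (∑' n, PowerSeries.coeff n x) ^ k) := by
    intro k
    rw [← tsum_coeff_pow hx]
    exact (summable_norm_coeff_pow hx k).of_norm.hasSum.const_smul (c k)
  have hcol : ∀ n, HasSum (fun k => f (k, n))
      (∑ k ∈ Finset.range (n + 1), c k • PowerSeries.coeff n (x ^ k)) := by
    intro n
    refine hasSum_sum_of_ne_finset_zero fun k hk => ?_
    simp only [f]
    rw [coeff_pow_eq_zero hx0 k n (by simpa using hk), smul_zero]
  have h1 := hf.hasSum.prod_fiberwise hrow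
  refine ⟨h1.summable, ?_⟩
  rw [h1.tsum_eq]
  exact ((Equiv.prodComm ℕ ℕ).hasSum_iff.2 hf.hasSum).prod_fiberwise hcol

end SummableSeries

/-! ### The holonomy of small connections -/

section Holonomy

variable {𝔤 : Type u} [NormedLieRing 𝔤] [NormedRealLieAlgebra 𝔤] [FiniteDimensional ℝ 𝔤]
  {𝔸 : Type v} [NormedRing 𝔸] [NormedAlgebra ℝ 𝔸] [CompleteSpace 𝔸] {ρ : 𝔤 →ₗ[ℝ] 𝔸}

theorem IsParallelTransport.eqOn {A : Form1 𝔤} {U V : ℝ → 𝔸} (hU : IsParallelTransport ρ A U)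
    (hV : IsParallelTransport ρ A V) : EqOn V U (Icc 0 1) := by
  obtain ⟨C, hC⟩ := (isCompact_Icc (a := (0 : ℝ)) (b := 1)).exists_bound_of_continuousOn
    (continuous_rep_ext ρ A).continuousOn
  have hder : ∀ {W : ℝ → 𝔸}, IsParallelTransport ρ A W → ∀ t ∈ Ico (0 : ℝ) 1,
      HasDerivWithinAt W (-(ρ (ext A t) * W t)) (Ici t) t := fun hW t ht =>
    (hW.transport t (Ico_subset_Icc_self ht)).mono_of_mem_nhdsWithin
      (mem_of_superset (Icc_mem_nhdsGE ht.2) (Icc_subset_Icc_left ht.1))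
  refine ODE_solution_unique_of_mem_Icc_right (v := fun t W => -(ρ (ext A t) * W))
    (K := Real.toNNReal C) (s := fun _ => univ) (fun t ht => ?_)
    (fun t ht => (hV.transport t ht).continuousWithinAt) (hder hV) (fun _ _ => mem_univ _)
    (fun t ht => (hU.transport t ht).continuousWithinAt) (hder hU) (fun _ _ => mem_univ _)
    (hV.init.trans hU.init.symm)
  refine LipschitzOnWith.of_dist_le_mul fun x _ y _ => ?_
  have ht' := hC t (Ico_subset_Icc_self ht)
  rw [Real.coe_toNNReal _ ((norm_nonneg _).trans ht'), dist_eq_norm, dist_eq_norm, ← neg_sub',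
    norm_neg, ← mul_sub]
  exact (norm_mul_le _ _).trans (by gcongr)

theorem holTerm_at_zero (ρ : 𝔤 →ₗ[ℝ] 𝔸) (A : Form1 𝔤) (n : ℕ) : holTerm ρ A (n + 1) 0 = 0 := by
  simp [holTerm]

/-- Left multiplication by `-ρ(A(t))`. -/
def transportL (ρ : 𝔤 →ₗ[ℝ] 𝔸) (A : Form1 𝔤) (t : ℝ) : 𝔸 →L[ℝ] 𝔸 :=
  ContinuousLinearMap.mul ℝ 𝔸 (-ρ (ext A t))

theorem continuous_transportL (ρ : 𝔤 →ₗ[ℝ] 𝔸) (A : Form1 𝔤) : Continuous (transportL ρ A) :=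
  (ContinuousLinearMap.mul ℝ 𝔸).continuous.comp (continuous_rep_ext ρ A).neg

theorem hasDerivAt_holTerm_succ (ρ : 𝔤 →ₗ[ℝ] 𝔸) (A : Form1 𝔤) (n : ℕ) (t : ℝ) :
    HasDerivAt (holTerm ρ A (n + 1)) (transportL ρ A t (holTerm ρ A n t)) t := by
  refine ((hasDerivAt_holTerm ρ A n).2 t).congr_deriv ?_
  rw [transportL, ContinuousLinearMap.mul_apply', neg_mul]

theorem isParallelTransport_tsum (ρ : 𝔤 →ₗ[ℝ] 𝔸) (A : Form1 𝔤) :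
    IsParallelTransport ρ A fun t => ∑' n, holTerm ρ A n t where
  init := by
    rw [tsum_eq_single 0 fun n hn => by
      obtain ⟨k, rfl⟩ := Nat.exists_eq_succ_of_ne_zero hn
      exact holTerm_at_zero ρ A k]
    rfl
  transport t _ := by
    have h := hasDerivAt_tsum_iterated (x := holTerm ρ A) (h := fun _ => 0)
      (continuous_transportL ρ A) (fun t => hasDerivAt_const t 1) (hasDerivAt_holTerm_succ ρ A)
      (holTerm_at_zero ρ A) t
    refine h.hasDerivWithinAt.congr_deriv ?_
    rw [add_zero, transportL, ContinuousLinearMap.mul_apply', neg_mul]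

theorem norm_rep_le (ρ : 𝔤 →ₗ[ℝ] 𝔸) (x : 𝔤) :
    ‖ρ x‖ ≤ ‖LinearMap.toContinuousLinearMap ρ‖ * ‖x‖ :=
  (LinearMap.toContinuousLinearMap ρ).le_opNorm x

theorem norm_holTerm_le (ρ : 𝔤 →ₗ[ℝ] 𝔸) (A : Form1 𝔤) (n : ℕ) :
    ‖holTerm ρ A n 1‖
      ≤ ‖(1 : 𝔸)‖ * ((‖LinearMap.toContinuousLinearMap ρ‖ * ‖A‖) ^ n / n.factorial) := by
  have h := norm_iterated_le (x := holTerm ρ A) (continuous_transportL ρ A) continuous_const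
    (hasDerivAt_holTerm_succ ρ A) (holTerm_at_zero ρ A) (R := 1)
    (C := ‖LinearMap.toContinuousLinearMap ρ‖ * ‖A‖) (K := ‖(1 : 𝔸)‖) (fun t _ => ?_)
    (fun _ _ => le_rfl) n (t := 1) (by simp)
  · simpa using h
  · refine (ContinuousLinearMap.opNorm_mul_apply_le ℝ 𝔸 _).trans ?_
    rw [norm_neg]
    exact (norm_rep_le ρ _).trans (by gcongr; exact norm_ext_le A t)

theorem summable_norm_holTerm (ρ : 𝔤 →ₗ[ℝ] 𝔸) (A : Form1 𝔤) :
    Summable fun n => ‖holTerm ρ A n 1‖ :=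
  ((Real.summable_pow_div_factorial _).mul_left _).of_nonneg_of_le (fun _ => norm_nonneg _)
    (norm_holTerm_le ρ A)

variable {A : Form1 𝔤}

theorem summable_norm_logSeries (hA : 72 * ‖lieL 𝔤‖ * ‖A‖ ≤ 1) :
    Summable fun n => ‖PowerSeries.coeff n (logSeries ρ A)‖ := by
  refine ((summable_norm_magnusLog hA).mul_left
    ‖LinearMap.toContinuousLinearMap ρ‖).of_nonneg_of_le (fun _ => norm_nonneg _) fun n => ?_
  rw [logSeries, PowerSeries.coeff_mk, norm_neg]
  exact norm_rep_le ρ _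

theorem hasSum_rep_magnusLog (hA : 72 * ‖lieL 𝔤‖ * ‖A‖ ≤ 1) :
    HasSum (fun n => -ρ (magnusLog A n)) (-ρ (magnusSum A)) :=
  ((LinearMap.toContinuousLinearMap ρ).hasSum (hasSum_magnusLog hA)).neg

/-- The holonomy is the exponential of the sum of the Magnus expansion. -/
theorem tsum_holTerm_eq_exp (hρ : IsLieRep ρ) (hA : 72 * ‖lieL 𝔤‖ * ‖A‖ ≤ 1) :
    ∑' n, holTerm ρ A n 1 = NormedSpace.exp (-ρ (magnusSum A)) := by
  have h1 := (hasSum_coeff_subst (c := fun k => ((k.factorial : ℝ))⁻¹)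
    (coeff_zero_logSeries (ρ := ρ) A) (summable_norm_logSeries hA) (by
      refine (Real.summable_pow_div_factorial
        (∑' n, ‖PowerSeries.coeff n (logSeries ρ A)‖)).congr fun k => ?_
      rw [abs_of_nonneg (by positivity), div_eq_inv_mul])).2
  have h2 : ∑' n, PowerSeries.coeff n (logSeries ρ A) = -ρ (magnusSum A) := by
    simp only [logSeries, PowerSeries.coeff_mk]
    exact (hasSum_rep_magnusLog hA).tsum_eq
  rw [h2, (NormedSpace.exp_series_hasSum_exp' (𝕂 := ℝ) (-ρ (magnusSum A))).tsum_eq] at h1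
  rw [← h1.tsum_eq]
  refine tsum_congr fun n => ?_
  rw [holTerm_one_eq hρ, tot]
  refine Finset.sum_congr rfl fun k _ => ?_
  rw [expTerm_eq, PowerSeries.coeff_smul]

theorem summable_norm_holTerm_succ (ρ : 𝔤 →ₗ[ℝ] 𝔸) (A : Form1 𝔤) :
    Summable fun n => ‖holTerm ρ A (n + 1) 1‖ :=
  (summable_norm_holTerm ρ A).comp_injective (add_left_injective 1)

/-- The formal identity `rep_magnusLog` is summed at `ε = 1`. Smallness of the sum of the norms of
the iterated integrals, rather than of `u - 1` alone, permits the rearrangement of the logarithmic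
series. -/
theorem isLog_tsum_holTerm (hρ : IsLieRep ρ) (hA : 72 * ‖lieL 𝔤‖ * ‖A‖ ≤ 1)
    (hsmall : ∑' n, ‖holTerm ρ A (n + 1) 1‖ < 1) :
    IsLog (∑' n, holTerm ρ A n 1) (-ρ (magnusSum A)) := by
  set x := holSeries ρ A - 1
  have hxs : ∀ n, PowerSeries.coeff (n + 1) x = holTerm ρ A (n + 1) 1 := fun n => by
    simp [x, holSeries, PowerSeries.coeff_one]
  have hx0 : PowerSeries.coeff 0 x = 0 := by
    simp only [x, holSeries, map_sub, PowerSeries.coeff_mk, PowerSeries.coeff_zero_one]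
    exact sub_self _
  have hs' := summable_norm_holTerm_succ ρ A
  have hx : Summable fun n => ‖PowerSeries.coeff n x‖ := by
    refine (summable_nat_add_iff (f := fun n => ‖PowerSeries.coeff n x‖) 1).1 ?_
    simp only [hxs]
    exact hs'
  have hS : ∑' n, ‖PowerSeries.coeff n x‖ = ∑' n, ‖holTerm ρ A (n + 1) 1‖ := by
    rw [hx.tsum_eq_zero_add, hx0, norm_zero, zero_add]
    simp only [hxs]
  have hu : ∑' n, PowerSeries.coeff n x = ∑' n, holTerm ρ A n 1 - 1 := by
    rw [hx.of_norm.tsum_eq_zero_add, hx0, zero_add,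
      (summable_norm_holTerm ρ A).of_norm.tsum_eq_zero_add]
    simp only [hxs]
    rw [show holTerm ρ A 0 1 = 1 from rfl, add_sub_cancel_left]
  have hnorm : ‖∑' n, holTerm ρ A n 1 - 1‖ < 1 := by
    rw [← hu]
    exact (norm_tsum_le_tsum_norm hx).trans_lt (hS ▸ hsmall)
  refine ⟨hnorm, ?_⟩
  -- The logarithmic coefficients indexed by the power of `x`. Division by zero gives `c 0 = 0`, as
  -- the missing constant term requires.
  set c : ℕ → ℝ := fun k => (-1 : ℝ) ^ (k - 1) / k
  have hc0 : c 0 = 0 := by simp [c]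
  have hcs : ∀ k, c (k + 1) = (-1 : ℝ) ^ k / ((k : ℝ) + 1) := fun k => by simp [c]
  have hcle : ∀ k, |c k| ≤ 1 := by
    intro k
    cases k with
    | zero => simp [hc0]
    | succ k =>
      rw [hcs, abs_div, abs_pow, abs_neg, abs_one, one_pow, abs_of_pos (by positivity)]
      exact div_le_one_of_le₀ (by linarith [(Nat.cast_nonneg k : (0 : ℝ) ≤ k)]) (by positivity)
  have hS0 : 0 ≤ ∑' n, ‖PowerSeries.coeff n x‖ := tsum_nonneg fun _ => norm_nonneg _
  obtain ⟨h1, h2⟩ := hasSum_coeff_subst (c := c) hx0 hx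
    ((summable_geometric_of_lt_one hS0 (hS ▸ hsmall)).of_nonneg_of_le
      (fun k => mul_nonneg (abs_nonneg _) (pow_nonneg hS0 k))
      fun k => mul_le_of_le_one_left (pow_nonneg hS0 k) (hcle k))
  have h3 : ∀ n, ∑ k ∈ Finset.range (n + 1), c k • PowerSeries.coeff n (x ^ k)
      = -ρ (magnusLog A n) := by
    intro n
    rw [rep_magnusLog hρ, neg_neg, logCoeff, Finset.sum_range_succ', hc0, zero_smul, add_zero]
    simp only [hcs]
    rfl
  simp only [h3] at h2
  have h4 := h1.hasSum
  rw [h2.unique (hasSum_rep_magnusLog hA), hu, ← hasSum_nat_add_iff' 1] at h4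
  simpa only [hcs, Finset.sum_range_one, hc0, zero_smul, sub_zero] using h4

/-- For small connections, the remainder of the holonomy series is small. -/
theorem exists_tsum_holTerm_lt_one (ρ : 𝔤 →ₗ[ℝ] 𝔸) : ∃ δ : ℝ, 0 < δ ∧ ∀ A : Form1 𝔤, ‖A‖ < δ →
    ∑' n, ‖holTerm ρ A (n + 1) 1‖ < 1 := by
  set q := ‖LinearMap.toContinuousLinearMap ρ‖
  have hcont : Continuous fun s : ℝ => ‖(1 : 𝔸)‖ * (Real.exp (q * s) - 1) := by fun_prop
  have hev : ∀ᶠ s in 𝓝 (0 : ℝ), ‖(1 : 𝔸)‖ * (Real.exp (q * s) - 1) < 1 :=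
    hcont.continuousAt.eventually_lt continuousAt_const (by simp)
  obtain ⟨δ, hδ, h⟩ := Metric.eventually_nhds_iff.1 hev
  refine ⟨δ, hδ, fun A hA => ?_⟩
  refine lt_of_le_of_lt ?_ (h (y := ‖A‖) (by simpa using hA))
  have h1 : HasSum (fun n : ℕ => (q * ‖A‖) ^ n / n.factorial) (Real.exp (q * ‖A‖)) := by
    rw [Real.exp_eq_exp_ℝ]
    exact NormedSpace.expSeries_div_hasSum_exp (q * ‖A‖)
  have h2 := ((hasSum_nat_add_iff' (f := fun n : ℕ => (q * ‖A‖) ^ n / n.factorial) 1).2 h1).mul_left ‖(1 : 𝔸)‖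
  simp only [Finset.sum_range_one, pow_zero, Nat.factorial_zero, Nat.cast_one, div_one] at h2
  rw [← h2.tsum_eq]
  exact Summable.tsum_le_tsum (fun n => norm_holTerm_le ρ A (n + 1))
    (summable_norm_holTerm_succ ρ A) h2.summable

end Holonomy

/-! ### Smoothness of the flow -/

section Smoothness

variable {𝔤 : Type u} [NormedLieRing 𝔤] [NormedRealLieAlgebra 𝔤] [FiniteDimensional ℝ 𝔤]

/-- `A'` is the derivative of `A` along the interval. -/
def HasFormDeriv (A A' : Form1 𝔤) : Prop :=
  ∀ t ∈ Icc (0 : ℝ) 1, HasDerivWithinAt (ext A) (ext A' t) (Icc 0 1) t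

variable {A A' B B' : Form1 𝔤}

theorem HasFormDeriv.add (hA : HasFormDeriv A A') (hB : HasFormDeriv B B') :
    HasFormDeriv (A + B) (A' + B') := fun t ht => (hA t ht).add (hB t ht)

theorem HasFormDeriv.sub (hA : HasFormDeriv A A') (hB : HasFormDeriv B B') :
    HasFormDeriv (A - B) (A' - B') := fun t ht => (hA t ht).sub (hB t ht)

theorem HasFormDeriv.lie (hA : HasFormDeriv A A') (hB : HasFormDeriv B B') :
    HasFormDeriv (brL 𝔤 A B) (brL 𝔤 A' B + brL 𝔤 A B') := fun t ht => by
  have h := (lieL 𝔤).hasDerivWithinAt_of_bilinear (hA t ht) (hB t ht)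
  refine h.congr_deriv ?_
  rw [ext_add, add_comm]
  rfl

theorem hasFormDeriv_primL (A : Form1 𝔤) : HasFormDeriv (primL 𝔤 A) A :=
  fun _ ht => hasDerivWithinAt_ext_primL A ht

theorem hasFormDeriv_incl (x : 𝔤) : HasFormDeriv (incl x) 0 :=
  fun t _ => hasDerivWithinAt_const t _ x

variable (𝔤) in
/-- The constant form with the value of a form at `0`. -/
def baseL : Form1 𝔤 →L[ℝ] Form1 𝔤 :=
  (inclL 𝔤).comp (ContinuousMap.evalCLM ℝ (0 : unitInterval))

theorem baseL_apply (A : Form1 𝔤) : baseL 𝔤 A = incl (A 0) := rfl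

theorem baseL_brL (A B : Form1 𝔤) : baseL 𝔤 (brL 𝔤 A B) = brL 𝔤 (baseL 𝔤 A) (baseL 𝔤 B) := rfl

theorem baseL_baseL (A : Form1 𝔤) : baseL 𝔤 (baseL 𝔤 A) = baseL 𝔤 A := rfl

theorem baseL_primL (A : Form1 𝔤) : baseL 𝔤 (primL 𝔤 A) = 0 := by
  ext t
  exact intervalIntegral.integral_same

theorem HasFormDeriv.eq (h : HasFormDeriv A A') : A = baseL 𝔤 A + primL 𝔤 A' := by
  have h1 : HasFormDeriv (baseL 𝔤 A + primL 𝔤 A') A' := by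
    have := (hasFormDeriv_incl (A 0)).add (hasFormDeriv_primL A')
    rwa [zero_add] at this
  have h0 : ext A 0 = ext (baseL 𝔤 A + primL 𝔤 A') 0 := by
    have e1 : ext (primL 𝔤 A') 0 = 0 := by
      rw [ext_primL _ (left_mem_Icc.2 zero_le_one), intervalIntegral.integral_same]
    rw [ext_add, e1, add_zero]
    exact ext_coe A 0
  have := eqOn_of_hasDerivWithinAt h h1 h0
  ext t
  rw [← ext_coe, ← ext_coe (baseL 𝔤 A + primL 𝔤 A')]
  exact this t.2

/-- Curves of forms which are continuous in `T` and of class `C^k` along the interval. -/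
def CurveC : ℕ → (ℝ → Form1 𝔤) → Prop
  | 0 => fun h => ContinuousOn h (Ici 0)
  | k + 1 => fun h => ContinuousOn h (Ici 0) ∧
      ∃ h', CurveC k h' ∧ ∀ T, 0 ≤ T → HasFormDeriv (h T) (h' T)

variable {k : ℕ} {f g h : ℝ → Form1 𝔤}

theorem CurveC.continuousOn (hf : CurveC k f) : ContinuousOn f (Ici 0) := by
  cases k with
  | zero => exact hf
  | succ k => exact hf.1

theorem CurveC.of_succ (hf : CurveC (k + 1) f) : CurveC k f := by
  induction k generalizing f with
  | zero => exact hf.1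
  | succ k ih =>
    obtain ⟨hc, f', hf', hd⟩ := hf
    exact ⟨hc, f', ih hf', hd⟩

theorem CurveC.add (hf : CurveC k f) (hg : CurveC k g) : CurveC k fun T => f T + g T := by
  induction k generalizing f g with
  | zero => exact ContinuousOn.add hf hg
  | succ k ih =>
    obtain ⟨hfc, f', hf', hfd⟩ := hf
    obtain ⟨hgc, g', hg', hgd⟩ := hg
    exact ⟨hfc.add hgc, _, ih hf' hg', fun T hT => (hfd T hT).add (hgd T hT)⟩

theorem CurveC.sub (hf : CurveC k f) (hg : CurveC k g) : CurveC k fun T => f T - g T := by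
  induction k generalizing f g with
  | zero => exact ContinuousOn.sub hf hg
  | succ k ih =>
    obtain ⟨hfc, f', hf', hfd⟩ := hf
    obtain ⟨hgc, g', hg', hgd⟩ := hg
    exact ⟨hfc.sub hgc, _, ih hf' hg', fun T hT => (hfd T hT).sub (hgd T hT)⟩

theorem continuousOn_brL {s : Set ℝ} (hf : ContinuousOn f s) (hg : ContinuousOn g s) :
    ContinuousOn (fun T => brL 𝔤 (f T) (g T)) s :=
  ((brL 𝔤).continuous.comp_continuousOn hf).clm_apply hg

theorem CurveC.lie (hf : CurveC k f) (hg : CurveC k g) :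
    CurveC k fun T => brL 𝔤 (f T) (g T) := by
  induction k generalizing f g with
  | zero => exact continuousOn_brL hf hg
  | succ k ih =>
    have hf0 := hf.of_succ
    have hg0 := hg.of_succ
    obtain ⟨hfc, f', hf', hfd⟩ := hf
    obtain ⟨hgc, g', hg', hgd⟩ := hg
    exact ⟨continuousOn_brL hfc hgc, _, (ih hf' hg0).add (ih hf0 hg'),
      fun T hT => (hfd T hT).lie (hgd T hT)⟩

theorem CurveC.prim (hf : CurveC k f) : CurveC (k + 1) fun T => primL 𝔤 (f T) :=
  ⟨(primL 𝔤).continuous.comp_continuousOn hf.continuousOn, f, hf,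
    fun T _ => hasFormDeriv_primL (f T)⟩

theorem curveC_zero : CurveC k fun _ => (0 : Form1 𝔤) := by
  induction k with
  | zero => exact continuousOn_const
  | succ k ih => exact ⟨continuousOn_const, _, ih, fun _ _ => hasFormDeriv_incl 0⟩

theorem curveC_incl {x : ℝ → 𝔤} (hx : ContinuousOn x (Ici 0)) : CurveC k fun T => incl (x T) := by
  have hc : ContinuousOn (fun T => incl (x T)) (Ici 0) :=
    (inclL 𝔤).continuous.comp_continuousOn hx
  cases k with
  | zero => exact hc
  | succ k => exact ⟨hc, _, curveC_zero, fun T _ => hasFormDeriv_incl (x T)⟩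

theorem CurveC.incl_proj (hf : ContinuousOn f (Ici 0)) : CurveC k fun T => incl (proj (f T)) :=
  curveC_incl ((projL 𝔤).continuous.comp_continuousOn hf)

/-- The homotopy gains one derivative along the interval, which drives the regularity bootstrap. -/
theorem CurveC.homotopy (hf : CurveC k f) : CurveC (k + 1) fun T => kappaL 𝔤 (f T) :=
  CurveC.prim (f := fun T => perpL 𝔤 (f T)) (hf.sub (CurveC.incl_proj hf.continuousOn))

theorem CurveC.sum {ι : Type*} {s : Finset ι} {F : ι → ℝ → Form1 𝔤}
    (hF : ∀ i ∈ s, CurveC k (F i)) : CurveC k fun T => ∑ i ∈ s, F i T := by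
  classical
  induction s using Finset.induction_on with
  | empty => exact curveC_zero
  | insert i s hi ih =>
    simp only [Finset.sum_insert hi]
    exact (hF i (Finset.mem_insert_self i s)).add
      (ih fun j hj => hF j (Finset.mem_insert_of_mem hj))

theorem CurveC.contDiffOn (hf : CurveC k f) {T : ℝ} (hT : 0 ≤ T) :
    ContDiffOn ℝ k (ext (f T)) (Icc 0 1) := by
  induction k generalizing f with
  | zero => exact contDiffOn_zero.2 (continuous_ext _).continuousOn
  | succ k ih =>
    obtain ⟨hc, f', hf', hd⟩ := hf
    have hu := uniqueDiffOn_Icc (zero_lt_one (α := ℝ))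
    push_cast
    refine (contDiffOn_succ_iff_derivWithin hu).2
      ⟨fun t ht => (hd T hT t ht).differentiableWithinAt, fun h => absurd h (by simp), ?_⟩
    exact (ih hf').congr fun t ht => (hd T hT t ht).derivWithin (hu t ht)

theorem smoothForm_of_curveC (hf : ∀ k, CurveC k f) {T : ℝ} (hT : 0 ≤ T) : SmoothForm (f T) :=
  contDiffOn_infty.2 fun k => (hf k).contDiffOn hT

theorem SmoothForm.exists_hasFormDeriv (hA : SmoothForm A) :
    ∃ A', SmoothForm A' ∧ HasFormDeriv A A' := by
  have hu := uniqueDiffOn_Icc (zero_lt_one (α := ℝ))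
  obtain ⟨hd, hA'⟩ := (contDiffOn_infty_iff_derivWithin hu).1 hA
  let A' : Form1 𝔤 := ⟨fun t => derivWithin (ext A) (Icc 0 1) t,
    hA'.continuousOn.domRestrict⟩
  have he : ∀ t ∈ Icc (0 : ℝ) 1, ext A' t = derivWithin (ext A) (Icc 0 1) t := fun t ht =>
    ext_coe A' ⟨t, ht⟩
  refine ⟨A', hA'.congr he, fun t ht => ?_⟩
  rw [he t ht]
  exact (hd t ht).hasDerivWithinAt

theorem SmoothForm.curveC (hA : SmoothForm A) (k : ℕ) : CurveC k fun _ => A := by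
  induction k generalizing A with
  | zero => exact continuousOn_const
  | succ k ih =>
    obtain ⟨A', hA', hd⟩ := hA.exists_hasFormDeriv
    exact ⟨continuousOn_const, _, ih hA', fun _ _ => hd⟩

end Smoothness

/-! ### Linear flow equations and the regularity bootstrap -/

section Smoothness

variable {𝔤 : Type u} [NormedLieRing 𝔤] [NormedRealLieAlgebra 𝔤] [FiniteDimensional ℝ 𝔤]

/-- Solutions of `z' = -z - [z, c] + h` on `[0, ∞)`. -/
def IsLinearFlow (c h z : ℝ → Form1 𝔤) : Prop :=
  ∀ T, 0 ≤ T → HasDerivWithinAt z (-z T - brL 𝔤 (z T) (c T) + h T) (Ici 0) T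

theorem IsLinearFlow.continuousOn {c h z : ℝ → Form1 𝔤} (hz : IsLinearFlow c h z) :
    ContinuousOn z (Ici 0) := fun T hT => (hz T hT).continuousWithinAt

theorem exists_isLinearFlow {c h : ℝ → Form1 𝔤} (hc : ContinuousOn c (Ici 0))
    (hh : ContinuousOn h (Ici 0)) (z₀ : Form1 𝔤) : ∃ z, z 0 = z₀ ∧ IsLinearFlow c h z := by
  have hmax : ∀ {f : ℝ → Form1 𝔤}, ContinuousOn f (Ici 0) → Continuous fun T => f (max T 0) :=
    fun hf => hf.comp_continuous (continuous_id.max continuous_const) fun T => le_max_right T 0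
  have hm : Continuous fun T => -ContinuousLinearMap.id ℝ (Form1 𝔤)
      - (brL 𝔤).flip (c (max T 0)) :=
    continuous_const.sub ((brL 𝔤).flip.continuous.comp (hmax hc))
  obtain ⟨z, hz0, hz⟩ := exists_hasDerivAt_linear hm (hmax hh) z₀
  refine ⟨z, hz0, fun T hT => (hz T).hasDerivWithinAt.congr_deriv ?_⟩
  rw [max_eq_left hT]
  rfl

/-- A solution of a linear flow equation is differentiable along the interval if the coefficients
are. -/
theorem IsLinearFlow.hasFormDeriv {c c' h h' z z' : ℝ → Form1 𝔤} (hc : ContinuousOn c (Ici 0))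
    (hc' : ContinuousOn c' (Ici 0))
    (hcd : ∀ T, 0 ≤ T → HasFormDeriv (c T) (c' T)) (hhd : ∀ T, 0 ≤ T → HasFormDeriv (h T) (h' T))
    (hz : IsLinearFlow c h z) (hz' : IsLinearFlow c (fun T => h' T - brL 𝔤 (z T) (c' T)) z')
    (h0 : HasFormDeriv (z 0) (z' 0)) {T : ℝ} (hT : 0 ≤ T) : HasFormDeriv (z T) (z' T) := by
  -- The candidate `w` has derivative `z'` along the interval and agrees with `z` at the left
  -- endpoint. It remains to show `w = z`, and for this the difference is shown to solve a
  -- homogeneous linear equation in `T` with zero initial value.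
  obtain ⟨w, hwT⟩ : ∃ w : ℝ → Form1 𝔤, ∀ T, w T = baseL 𝔤 (z T) + primL 𝔤 (z' T) :=
    ⟨_, fun _ => rfl⟩
  have hw : ∀ T, HasFormDeriv (w T) (z' T) := fun T => by
    have := (hasFormDeriv_incl (z T 0)).add (hasFormDeriv_primL (z' T))
    rwa [zero_add, ← baseL_apply, ← hwT] at this
  have hwb : ∀ T, baseL 𝔤 (w T) = baseL 𝔤 (z T) := fun T => by
    rw [hwT, map_add, baseL_primL, baseL_baseL, add_zero]
  suffices hD : EqOn (fun T => w T - z T) (fun _ => 0) (Ici 0) by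
    rw [← sub_eq_zero.1 (hD hT)]
    exact hw T
  refine eqOn_Ici_of_ode
    (v := fun T x => -x - brL 𝔤 x (c T) + primL 𝔤 (brL 𝔤 x (c' T))) (fun T R => ?_)
    (fun T hT => ?_) (fun T _ => ?_) ?_
  · obtain ⟨C, hC⟩ := isCompact_Icc.exists_bound_of_continuousOn
      (hc.mono fun t (ht : t ∈ Icc 0 T) => ht.1)
    obtain ⟨C', hC'⟩ := isCompact_Icc.exists_bound_of_continuousOn
      (hc'.mono fun t (ht : t ∈ Icc 0 T) => ht.1)
    refine ⟨Real.toNNReal (1 + ‖lieL 𝔤‖ * C + ‖lieL 𝔤‖ * C'), fun t ht => ?_⟩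
    refine LipschitzOnWith.of_dist_le_mul fun x _ y _ => ?_
    have hC0 : 0 ≤ C := (norm_nonneg _).trans (hC t ht)
    have hC0' : 0 ≤ C' := (norm_nonneg _).trans (hC' t ht)
    have hl := norm_nonneg (lieL 𝔤)
    rw [Real.coe_toNNReal _ (by positivity), dist_eq_norm, dist_eq_norm]
    have e : -x - brL 𝔤 x (c t) + primL 𝔤 (brL 𝔤 x (c' t))
        - (-y - brL 𝔤 y (c t) + primL 𝔤 (brL 𝔤 y (c' t)))
        = -(x - y) - brL 𝔤 (x - y) (c t) + primL 𝔤 (brL 𝔤 (x - y) (c' t)) := by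
      rw [map_sub (brL 𝔤), sub_apply, sub_apply, map_sub (primL 𝔤)]
      abel
    rw [e]
    have h1 : ‖brL 𝔤 (x - y) (c t)‖ ≤ ‖lieL 𝔤‖ * ‖x - y‖ * C :=
      (norm_brL_le _ _).trans (by gcongr; exact hC t ht)
    have h2 : ‖primL 𝔤 (brL 𝔤 (x - y) (c' t))‖ ≤ ‖lieL 𝔤‖ * ‖x - y‖ * C' :=
      (norm_primL_le _).trans ((norm_brL_le _ _).trans (by gcongr; exact hC' t ht))
    calc _ ≤ ‖-(x - y)‖ + ‖brL 𝔤 (x - y) (c t)‖ + ‖primL 𝔤 (brL 𝔤 (x - y) (c' t))‖ :=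
          (norm_add_le _ _).trans (add_le_add_left (norm_sub_le _ _) _)
      _ ≤ ‖x - y‖ + ‖lieL 𝔤‖ * ‖x - y‖ * C + ‖lieL 𝔤‖ * ‖x - y‖ * C' := by
          rw [norm_neg]
          gcongr
      _ = _ := by ring
  · have d1 := (baseL 𝔤).hasFDerivAt.comp_hasDerivWithinAt T (hz T hT)
    have d2 := (primL 𝔤).hasFDerivAt.comp_hasDerivWithinAt T (hz' T hT)
    have d3 : HasDerivWithinAt w _ (Ici 0) T := (d1.add d2).congr (fun t _ => hwT t) (hwT T)
    refine (d3.sub (hz T hT)).congr_deriv ?_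
    -- Each of `h`, `[w, c]` and `w` is rebuilt from its value at the left endpoint and the
    -- primitive of its derivative. The source `-[z, c']` of `z'` then combines with `[w, c']` into
    -- a term in `w - z`.
    have e1 := sub_eq_of_eq_add (hhd T hT).eq
    have e2 := ((hw T).lie (hcd T hT)).eq
    rw [baseL_brL, hwb, ← baseL_brL, map_add] at e2
    have e2' := sub_eq_of_eq_add e2
    have e3 := sub_eq_of_eq_add (hwT T)
    simp only [map_add, map_sub, map_neg, sub_apply]
    rw [← e1, ← e2', ← e3]
    abel_nf
  · refine (hasDerivWithinAt_const T _ (0 : Form1 𝔤)).congr_deriv ?_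
    rw [map_zero, zero_apply, zero_apply, map_zero, neg_zero, sub_zero, add_zero]
  · rw [sub_eq_zero]
    rw [hwT]
    exact h0.eq.symm

theorem CurveC.const {k : ℕ} {f : ℝ → Form1 𝔤} (hf : CurveC k f) : CurveC k fun _ => f 0 := by
  induction k generalizing f with
  | zero => exact continuousOn_const
  | succ k ih =>
    obtain ⟨-, f', hf', hd⟩ := hf
    exact ⟨continuousOn_const, _, ih hf', fun _ _ => hd 0 le_rfl⟩

/-- Differentiating the equation along the interval gives a linear flow with the same `c` and the
source `h' - [z, c']`. That source is of class `C^k` by the induction hypothesis for `z`, and the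
induction hypothesis then applies to the derivative. -/
theorem IsLinearFlow.curveC {k : ℕ} {c h z : ℝ → Form1 𝔤} (hz : IsLinearFlow c h z)
    (hc : CurveC k c) (hh : CurveC k h) (h0 : CurveC k fun _ => z 0) : CurveC k z := by
  induction k generalizing h z with
  | zero => exact hz.continuousOn
  | succ k ih =>
    have hzk := ih hz hc.of_succ hh.of_succ h0.of_succ
    have hck := hc.of_succ
    obtain ⟨-, c', hc', hcd⟩ := hc
    obtain ⟨-, h', hh', hhd⟩ := hh
    obtain ⟨-, b, hb, hbd⟩ := h0
    have hsrc := hh'.sub (hzk.lie hc')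
    obtain ⟨z', hz0, hz'⟩ := exists_isLinearFlow hck.continuousOn hsrc.continuousOn (b 0)
    have hd : ∀ T, 0 ≤ T → HasFormDeriv (z T) (z' T) := fun T hT =>
      hz.hasFormDeriv hck.continuousOn hc'.continuousOn hcd hhd hz'
        (by rw [hz0]; exact hbd 0 le_rfl) hT
    exact ⟨hz.continuousOn, z', ih hz' hck hsrc (by rw [hz0]; exact hb.const), hd⟩

/-- The formal flow of a smooth form is smooth. -/
theorem curveC_flowTerm {A : Form1 𝔤} (hA : SmoothForm A) (k n : ℕ) : CurveC k (flowTerm A n) := by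
  induction n using Nat.strong_induction_on with
  | _ n ih =>
    have hS : CurveC k (flowSource A n) := CurveC.sum fun i hi => CurveC.sum fun j hj => by
      split_ifs
      · exact (ih i (Finset.mem_range.1 hi)).lie (ih j (Finset.mem_range.1 hj)).homotopy.of_succ
      · exact curveC_zero
    -- Writing `perpL` as identity minus `ιπ` moves the nonlocal term into the source, where it is
    -- constant along the interval and hence smooth.
    have hz : IsLinearFlow (fun _ => 0)
        (fun T => incl (proj (flowTerm A n T)) - flowSource A n T) (flowTerm A n) := fun T _ => by
      refine (hasDerivAt_flowTerm A n T).hasDerivWithinAt.congr_deriv ?_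
      rw [map_zero, perpL_apply]
      abel_nf
    refine hz.curveC curveC_zero ((CurveC.incl_proj hz.continuousOn).sub hS) ?_
    rw [flowTerm_at_zero]
    split_ifs
    · exact hA.curveC k
    · exact curveC_zero

/-- The flow of a smooth form is smooth. -/
theorem IsFlow.curveC {A : Form1 𝔤} {a : ℝ → Form1 𝔤} (ha : IsFlow A a) (hA : SmoothForm A)
    (k : ℕ) : CurveC k a := by
  -- The quadratic equation becomes linear once `κ(a)` is treated as a coefficient. If `a` is `C^k`
  -- along the interval then `κ(a)` is `C^{k+1}`, so each pass gains one derivative.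
  have hz : IsLinearFlow (fun T => kappaL 𝔤 (a T)) (fun T => incl (proj (a T))) a := fun T hT => by
    refine (ha.flow T hT).congr_deriv ?_
    rw [hamField_eq, perpL_apply]
    abel
  induction k with
  | zero => exact hz.continuousOn
  | succ k ih =>
    refine hz.curveC ih.homotopy (CurveC.incl_proj hz.continuousOn) ?_
    rw [ha.init]
    exact hA.curveC (k + 1)

end Smoothness

end

end OneDimBF

/-! ### Assembly of the formal and the analytic statements -/

open OneDimBF Asymptotics in
theorem mainTheorem8 {𝔤 : Type u} [NormedLieRing 𝔤] [NormedRealLieAlgebra 𝔤]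
    [FiniteDimensional ℝ 𝔤] :
    -- the formal neighbourhood of zero, order by order in the connection
    (∀ A : Form1 𝔤,
      (∃ a : ℕ → ℝ → Form1 𝔤, IsFormalFlow A a ∧
        (∀ b, IsFormalFlow A b → ∀ n, EqOn (b n) (a n) (Ici 0)) ∧
        (SmoothForm A → ∀ n, ∀ T, 0 ≤ T → SmoothForm (a n T)) ∧
        (∀ n, Tendsto (fun T => proj (a n T)) atTop (𝓝 (magnusLog A n)))) ∧
      (∀ (𝔸 : Type v) [NormedRing 𝔸] [NormedAlgebra ℝ 𝔸] [CompleteSpace 𝔸] (ρ : 𝔤 →ₗ[ℝ] 𝔸),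
        IsLieRep ρ → ∀ n, ρ (magnusLog A n) = -logCoeff (holSeries ρ A) n) ∧
      (∀ (ξ : Module.Dual ℝ 𝔤) (n : ℕ), hplTerm ξ n A = ξ (magnusLog A (n + 1))) ∧
      magnusLog A 1 = proj A ∧
      magnusLog A 2 =
        -((1 / 2 : ℝ) • ∫ t in (0 : ℝ)..1, ∫ t' in (0 : ℝ)..t, ⁅ext A t, ext A t'⁆)) ∧
    -- an open neighbourhood of zero in the space of connections
    (∃ r : ℝ, 0 < r ∧ ∃ P : Form1 𝔤 → 𝔤,
      (∀ A : Form1 𝔤, ‖A‖ < r →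
        (∃ a : ℝ → Form1 𝔤, IsFlow A a ∧
          (∀ b, IsFlow A b → EqOn b a (Ici 0)) ∧
          (SmoothForm A → ∀ T, 0 ≤ T → SmoothForm (a T)) ∧
          Tendsto (fun T => proj (a T)) atTop (𝓝 (P A))) ∧
        HasSum (magnusLog A) (P A)) ∧
      ((fun A => P A - proj A) =O[𝓝 0] fun A => ‖A‖ ^ 2) ∧
      (∀ (𝔸 : Type v) [NormedRing 𝔸] [NormedAlgebra ℝ 𝔸] [CompleteSpace 𝔸] (ρ : 𝔤 →ₗ[ℝ] 𝔸),
        IsLieRep ρ →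
        (∀ A : Form1 𝔤, ‖A‖ < r →
          ∃ U : ℝ → 𝔸, IsParallelTransport ρ A U ∧
            (∀ V, IsParallelTransport ρ A V → EqOn V U (Icc 0 1)) ∧
            U 1 = NormedSpace.exp (-ρ (P A))) ∧
        ∃ δ : ℝ, 0 < δ ∧ δ ≤ r ∧ ∀ A : Form1 𝔤, ‖A‖ < δ →
          ∀ U : ℝ → 𝔸, IsParallelTransport ρ A U → IsLog (U 1) (-ρ (P A)))) := by
  refine ⟨fun A => ⟨⟨flowTerm A, isFormalFlow_flowTerm A, fun b hb n => hb.eqOn n,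
    fun hA n T hT => smoothForm_of_curveC (fun k => curveC_flowTerm hA k n) hT,
    tendsto_proj_flowTerm_magnusLog A⟩, fun 𝔸 _ _ _ ρ hρ n => rep_magnusLog hρ A n,
    fun ξ n => congrFun (hplTerm_eq ξ n) A, magnusLog_one A, magnusLog_two A⟩, ?_⟩
  have hl := norm_nonneg (lieL 𝔤)
  -- This radius guarantees `72 ‖lieL 𝔤‖ ‖A‖ ≤ 1`, the condition for summability of the majorant.
  -- The summand `1` covers a vanishing bracket.
  have hr : 0 < (72 * ‖lieL 𝔤‖ + 1)⁻¹ := by positivity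
  have hsmall : ∀ A : Form1 𝔤, ‖A‖ < (72 * ‖lieL 𝔤‖ + 1)⁻¹ → 72 * ‖lieL 𝔤‖ * ‖A‖ ≤ 1 := by
    intro A hA
    have h1 : (72 * ‖lieL 𝔤‖ + 1) * ‖A‖ ≤ (72 * ‖lieL 𝔤‖ + 1) * (72 * ‖lieL 𝔤‖ + 1)⁻¹ := by
      gcongr
    rw [mul_inv_cancel₀ (by positivity)] at h1
    linarith [norm_nonneg A]
  refine ⟨(72 * ‖lieL 𝔤‖ + 1)⁻¹, hr, magnusSum, fun A hA => ?_, ?_, fun 𝔸 _ _ _ ρ hρ => ⟨?_, ?_⟩⟩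
  · have hA' := hsmall A hA
    have hflow := isFlow_flowLine hA'
    exact ⟨⟨flowLine A, hflow, fun b hb => hflow.eqOn hb,
      fun hs T hT => smoothForm_of_curveC (hflow.curveC hs) hT, tendsto_proj_flowLine hA'⟩,
      hasSum_magnusLog hA'⟩
  · refine IsBigO.of_bound (216 * ‖lieL 𝔤‖) ?_
    filter_upwards [Metric.ball_mem_nhds (0 : Form1 𝔤) hr] with A hA
    rw [Real.norm_of_nonneg (by positivity)]
    exact norm_magnusSum_sub_proj_le (hsmall A (mem_ball_zero_iff.1 hA))
  · intro A hA
    have hU := isParallelTransport_tsum ρ A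
    exact ⟨_, hU, fun V hV => hU.eqOn hV, tsum_holTerm_eq_exp hρ (hsmall A hA)⟩
  · obtain ⟨δ, hδ, hlt⟩ := exists_tsum_holTerm_lt_one (𝔤 := 𝔤) ρ
    refine ⟨min δ (72 * ‖lieL 𝔤‖ + 1)⁻¹, lt_min hδ hr, min_le_right _ _, fun A hA U hU => ?_⟩
    rw [(isParallelTransport_tsum ρ A).eqOn hU (right_mem_Icc.2 zero_le_one)]
    exact isLog_tsum_holTerm hρ (hsmall A (hA.trans_le (min_le_right _ _)))
      (hlt A (hA.trans_le (min_le_left _ _)))
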